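/- Let $X$ be a smooth manifold (finite-dimensional, Hausdorff, $\sigma$-compact, without boundary). Let $C^\infty_X$, $T_X$ and $\Omega_X$ be its sheaves of smooth real functions, vector fields and commutative dg algebras of differential forms, and let $\Omega_X^\#$ be the graded algebra underlying $\Omega_X$. Let $\mathcal J$ be the sheaf of infinite jets of smooth functions, with fibres $\mathcal J_x=\varprojlim_k C^\infty(X)/\mathfrak m_x^k$ ($\mathfrak m_x$ the ideal of functions vanishing at $x$), let $F^k\mathcal J$ be the jets vanishing to order $k$, and equip $\mathcal J$ with its flat connection, for which the jets of functions are horizontal. Let $dR(\mathcal J)=\Omega^\#_X\otimes_{C^\infty_X}\mathcal J$ be its de Rham complex, a sheaf of commutative dg $\Omega_X$-algebras. For a graded locally free $\Omega^\#_X$-module $L$ of finite rank, a curved $L_\infty$ algebra structure on $L$ over $\Omega_X$ with nilpotent ideal $\Omega^{>0}_X$ is a degree one derivation $d$ of the completed symmetric algebra $\widehat{\mathrm{Sym}}_{\Omega_X^\#}(L^\vee[-1])$ with $d^2=0$ that makes it a sheaf of commutative dg algebras over $\Omega_X$ and preserves, modulo $\Omega_X^{>0}$, the ideal generated by $L^\vee[-1]$.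 The resulting dg algebra is the Chevalley--Eilenberg complex $C^*(L)$. For $L=T_X[-1]\otimes_{C^\infty_X}\Omega^\#_X$ the completed symmetric algebra is $\widehat{\mathrm{Sym}}_{C^\infty_X}(T_X^\vee)\otimes_{C^\infty_X}\Omega^\#_X$. **Lemma.** The ideal $\Omega_X^{>0}$ is nilpotent. The space of $C^\infty_X$-linear splittings $\sigma:\Omega^1_X\to F^1\mathcal J$ of $0\to F^2\mathcal J\to F^1\mathcal J\to\Omega^1_X\to 0$, with the weak $C^\infty$ topology, is contractible (in particular non-empty). For every such $\sigma$ there is a curved $L_\infty$ algebra $\mathfrak g_X$ over $\Omega_X$, with nilpotent ideal $\Omega_X^{>0}$, such that 1. the underlying graded $\Omega_X^\#$-module of $\mathfrak g_X$ is $T_X[-1]\otimes_{C^\infty_X}\Omega^\#_X$; 2. there is an isomorphism $C^*(\mathfrak g_X)\cong dR(\mathcal J)$ of sheaves of commutative dg $\Omega_X$-algebras which restricts to $\sigma$ on $T_X^\vee=\Omega^1_X$; 3. the augmentation $C^*(\mathfrak g_X)\to\Omega_X\to\Omega_X/\Omega_X^{>0}=C^\infty_X$ is a quasi-isomorphism of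 $\Omega_X$-modules, on sections over every open subset of $X$. Moreover, the curved $L_\infty$ structure on $T_X[-1]\otimes_{C^\infty_X}\Omega^\#_X$ is uniquely determined by $\sigma$ and property 2. -/

import Mathlib

open scoped Manifold ContDiff TensorProduct Topology
open TopologicalSpace

noncomputable section

namespace FormalGeometry

/-! Throughout, `M` is a smooth manifold modelled on `E`.  All sheaves on `M` are given by their
sections over every open set `U`; a section over `U` is a family indexed by the points of `U`,
with values in a (possibly infinite-dimensional) fibre, that is smooth in the sense specified, and
restriction of sections is restriction of families. -/

section Base

variable (E : Type*) [NormedAddCommGroup E] [NormedSpace ℝ E]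
variable (M : Type*) [TopologicalSpace M] [ChartedSpace E M]

/-- Smooth real functions on `M`. -/
abbrev Fun := C^∞⟮𝓘(ℝ, E), M; ℝ⟯

variable {M}

/-- The cotangent space at `x`. -/
abbrev Cotangent (x : M) := TangentSpace 𝓘(ℝ, E) x →L[ℝ] ℝ

/-- The exterior algebra of the cotangent space at `x`. -/
abbrev FormFibre (x : M) := ExteriorAlgebra ℝ (Cotangent E x)

variable {E}

/-- The differential of a smooth function at a point. -/
def diffAt (f : Fun E M) (x : M) : Cotangent E x := mfderiv 𝓘(ℝ, E) 𝓘(ℝ, ℝ) f x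

/-- Evaluation of smooth functions at a point. -/
def evalAt (x : M) : Fun E M →ₐ[ℝ] ℝ :=
  { ContMDiffMap.evalRingHom x with commutes' := fun _ => rfl }

variable (E M)

/-- Functions and exact one-forms, as families of elements of the exterior algebras. -/
def formGenerators : Set (∀ x : M, FormFibre E x) :=
  {w | ∃ a : Fun E M, w = fun x => algebraMap ℝ _ (a x)} ∪
  {w | ∃ f : Fun E M, w = fun x => ExteriorAlgebra.ι ℝ (diffAt f x)}

variable {M}

/-- `Ω^#(U)`: differential forms on `U`, that is, families `w x ∈ Λ (T*ₓM)` that are, near every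
point, finite sums of forms `a df₁ ∧ ⋯ ∧ df_q`. -/
def Forms (U : Opens M) : Subalgebra ℝ (∀ x : U, FormFibre E x.1) where
  carrier := {w | ∀ p : U, ∃ t ∈ Algebra.adjoin ℝ (formGenerators E M),
    ∀ᶠ x in 𝓝 p, w x = t x.1}
  mul_mem' := by
    intro a b ha hb p
    obtain ⟨t, ht, h⟩ := ha p
    obtain ⟨s, hs, h'⟩ := hb p
    refine ⟨t * s, mul_mem ht hs, ?_⟩
    filter_upwards [h, h'] with x hx hx'
    simp [hx, hx']
  add_mem' := by
    intro a b ha hb p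
    obtain ⟨t, ht, h⟩ := ha p
    obtain ⟨s, hs, h'⟩ := hb p
    refine ⟨t + s, add_mem ht hs, ?_⟩
    filter_upwards [h, h'] with x hx hx'
    simp [hx, hx']
  algebraMap_mem' := fun r _ =>
    ⟨algebraMap ℝ _ r, Subalgebra.algebraMap_mem _ r, Filter.Eventually.of_forall fun _ => rfl⟩

/-- Forms that are homogeneous of degree `q`. -/
def Forms.deg (U : Opens M) (q : ℕ) : Submodule ℝ (Forms E U) where
  carrier := {w | ∀ x : U, w.1 x ∈ ⋀[ℝ]^q (Cotangent E x.1)}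
  add_mem' := fun ha hb x => add_mem (ha x) (hb x)
  zero_mem' := fun _ => zero_mem _
  smul_mem' := fun r _ ha x => Submodule.smul_mem _ r (ha x)

variable (M)

/-- The linear span of the pairs `(a df₁ ∧ ⋯ ∧ df_q, da ∧ df₁ ∧ ⋯ ∧ df_q)`. -/
def exteriorGraph : Submodule ℝ ((∀ x : M, FormFibre E x) × (∀ x : M, FormFibre E x)) :=
  Submodule.span ℝ {w | ∃ (a : Fun E M) (f : List (Fun E M)), w =
    (fun x => a x • (f.map fun g => ExteriorAlgebra.ι ℝ (diffAt g x)).prod,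
     fun x => ExteriorAlgebra.ι ℝ (diffAt a x) *
       (f.map fun g => ExteriorAlgebra.ι ℝ (diffAt g x)).prod)}

variable {M}

/-- `z` is the exterior derivative of `w` on `U`: near every point, `w` is a finite sum of forms
`a df₁ ∧ ⋯ ∧ df_q` and `z` is the corresponding sum of the forms `da ∧ df₁ ∧ ⋯ ∧ df_q`. -/
def IsExteriorDerivative {U : Opens M} (w z : Forms E U) : Prop :=
  ∀ p : U, ∃ t ∈ exteriorGraph E M, ∀ᶠ x in 𝓝 p, w.1 x = t.1 x.1 ∧ z.1 x = t.2 x.1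

end Base

/-! ### Forms with coefficients in a bundle of complete augmented algebras -/

/-- A family of augmented commutative algebras indexed by the points of `M`, together with a set
of families `g x ∈ Alg x` that generates the smooth families. -/
structure AugFamily (M : Type*) where
  Alg : M → Type*
  [ring : ∀ x, CommRing (Alg x)]
  [alg : ∀ x, Algebra ℝ (Alg x)]
  ε : ∀ x, Alg x →ₐ[ℝ] ℝ
  gens : Set (∀ x, Alg x)

attribute [instance] AugFamily.ring AugFamily.alg

section Coefficients

variable (E : Type*) [NormedAddCommGroup E] [NormedSpace ℝ E]
variable {M : Type*} [TopologicalSpace M] [ChartedSpace E M]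
variable (A : AugFamily M)

/-- The augmentation ideal. -/
abbrev AugFamily.ideal (x : M) : Ideal (A.Alg x) := RingHom.ker (A.ε x)

/-- The completion of `A.Alg x` at the augmentation ideal; these are the fibres of the bundle of
coefficients. -/
abbrev AugFamily.Completed (x : M) := AdicCompletion (A.ideal x) (A.Alg x)

/-- The fibre `Λ (T*ₓM) ⊗ Âₓ`. -/
def CoeffFibre (x : M) := FormFibre E x ⊗[ℝ] A.Completed x

instance (x : M) : Ring (CoeffFibre E A x) :=
  inferInstanceAs (Ring (FormFibre E x ⊗[ℝ] A.Completed x))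

instance (x : M) : Algebra ℝ (CoeffFibre E A x) :=
  inferInstanceAs (Algebra ℝ (FormFibre E x ⊗[ℝ] A.Completed x))

variable {E A} in
/-- Elementary tensors in the fibre. -/
def CoeffFibre.tmul {x : M} (a : FormFibre E x) (b : A.Completed x) : CoeffFibre E A x :=
  a ⊗ₜ[ℝ] b

/-- The quotient `Λ (T*ₓM) ⊗ (Aₓ / Iₓ^k)` of the fibre, where `Iₓ` is the augmentation ideal. -/
def TruncFibre (k : ℕ) (x : M) := FormFibre E x ⊗[ℝ] (A.Alg x ⧸ A.ideal x ^ k)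

instance (k : ℕ) (x : M) : Ring (TruncFibre E A k x) :=
  inferInstanceAs (Ring (FormFibre E x ⊗[ℝ] (A.Alg x ⧸ A.ideal x ^ k)))

instance (k : ℕ) (x : M) : Algebra ℝ (TruncFibre E A k x) :=
  inferInstanceAs (Algebra ℝ (FormFibre E x ⊗[ℝ] (A.Alg x ⧸ A.ideal x ^ k)))

/-- The projection `Λ (T*ₓM) ⊗ Âₓ → Λ (T*ₓM) ⊗ (Aₓ / Iₓ^k)`. -/
def trunc (k : ℕ) (x : M) : CoeffFibre E A x →ₐ[ℝ] TruncFibre E A k x :=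
  Algebra.TensorProduct.map (AlgHom.id ℝ _)
    ((AdicCompletion.evalₐ (A.ideal x) k).restrictScalars ℝ)

/-- The projection `Λ (T*ₓM) ⊗ Aₓ → Λ (T*ₓM) ⊗ (Aₓ / Iₓ^k)`. -/
def mkTrunc (k : ℕ) (x : M) : FormFibre E x ⊗[ℝ] A.Alg x →ₐ[ℝ] TruncFibre E A k x :=
  Algebra.TensorProduct.map (AlgHom.id ℝ _) (Ideal.Quotient.mkₐ ℝ _)

variable {A} in
/-- `s` is represented by `t` modulo the `k`-th power of the augmentation ideal. -/
def AgreeMod (k : ℕ) {x : M} (s : CoeffFibre E A x) (t : FormFibre E x ⊗[ℝ] A.Alg x) : Prop :=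
  trunc E A k x s = mkTrunc E A k x t

lemma agreeMod_tmul (k : ℕ) {x : M} (a : FormFibre E x) (b : A.Completed x) (c : A.Alg x)
    (h : AdicCompletion.evalₐ (A.ideal x) k b = Ideal.Quotient.mk _ c) :
    AgreeMod E k (CoeffFibre.tmul a b) (a ⊗ₜ[ℝ] c) :=
  congrArg (fun z : A.Alg x ⧸ A.ideal x ^ k => a ⊗ₜ[ℝ] z) h

/-- Finite sums of products of forms with members of `A.gens`. -/
def polySections : Subalgebra ℝ (∀ x : M, FormFibre E x ⊗[ℝ] A.Alg x) :=
  Algebra.adjoin ℝ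
    ({w | ∃ t ∈ formGenerators E M, w = fun x => t x ⊗ₜ[ℝ] 1} ∪
     {w | ∃ g ∈ A.gens, w = fun x => 1 ⊗ₜ[ℝ] g x})

/-- Smooth forms on `U` with values in the bundle with fibres `Âₓ`: families whose reduction
modulo each power of the augmentation ideal is, near every point, a finite sum of products of
forms with members of `A.gens`. -/
def coeffSubalgebra (U : Opens M) : Subalgebra ℝ (∀ x : U, CoeffFibre E A x.1) where
  carrier := {s | ∀ (k : ℕ) (p : U), ∃ t ∈ polySections E A,
    ∀ᶠ x in 𝓝 p, AgreeMod E k (s x) (t x.1)}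
  mul_mem' := by
    intro a b ha hb k p
    obtain ⟨t, ht, h⟩ := ha k p
    obtain ⟨s, hs, h'⟩ := hb k p
    refine ⟨t * s, mul_mem ht hs, ?_⟩
    filter_upwards [h, h'] with x hx hx'
    exact (map_mul (trunc E A k x.1) _ _).trans
      ((congrArg₂ (· * ·) hx hx').trans (map_mul (mkTrunc E A k x.1) _ _).symm)
  add_mem' := by
    intro a b ha hb k p
    obtain ⟨t, ht, h⟩ := ha k p
    obtain ⟨s, hs, h'⟩ := hb k p
    refine ⟨t + s, add_mem ht hs, ?_⟩
    filter_upwards [h, h'] with x hx hx'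
    exact (map_add (trunc E A k x.1) _ _).trans
      ((congrArg₂ (· + ·) hx hx').trans (map_add (mkTrunc E A k x.1) _ _).symm)
  algebraMap_mem' := fun r k _ =>
    ⟨algebraMap ℝ _ r, Subalgebra.algebraMap_mem _ r,
      Filter.Eventually.of_forall fun x =>
        ((trunc E A k x.1).commutes r).trans ((mkTrunc E A k x.1).commutes r).symm⟩

/-- The sections over `U` of the sheaf of graded algebras `Ω^# ⊗ Â`. -/
def CoeffForms (U : Opens M) := coeffSubalgebra E A U

instance (U : Opens M) : Ring (CoeffForms E A U) :=
  inferInstanceAs (Ring (coeffSubalgebra E A U))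

instance (U : Opens M) : Algebra ℝ (CoeffForms E A U) :=
  inferInstanceAs (Algebra ℝ (coeffSubalgebra E A U))

variable {E A}

/-- Restriction of sections. -/
def CoeffForms.res {U W : Opens M} (h : W ≤ U) : CoeffForms E A U →ₐ[ℝ] CoeffForms E A W where
  toFun s := ⟨fun x => s.1 ⟨x.1, h x.2⟩, fun k p => by
    obtain ⟨t, ht, hs⟩ := s.2 k ⟨p.1, h p.2⟩
    refine ⟨t, ht, ?_⟩
    have hc : Continuous fun x : W => (⟨x.1, h x.2⟩ : U) := by fun_prop
    exact (hc.tendsto p).eventually hs⟩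
  map_one' := rfl
  map_mul' _ _ := rfl
  map_zero' := rfl
  map_add' _ _ := rfl
  commutes' _ := rfl

variable (E A)

/-- The elements of form degree `q` of a fibre. -/
def CoeffFibre.deg (x : M) (q : ℕ) : Submodule ℝ (CoeffFibre E A x) :=
  LinearMap.range (TensorProduct.map (⋀[ℝ]^q (Cotangent E x)).subtype
    (LinearMap.id : A.Completed x →ₗ[ℝ] A.Completed x))

/-- Sections that are homogeneous of form degree `q`. -/
def CoeffForms.deg (U : Opens M) (q : ℕ) : Submodule ℝ (CoeffForms E A U) where
  carrier := {s | ∀ x : U, s.1 x ∈ CoeffFibre.deg E A x.1 q}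
  add_mem' := fun ha hb x => add_mem (ha x) (hb x)
  zero_mem' := fun _ => zero_mem _
  smul_mem' := fun r _ ha x => Submodule.smul_mem _ r (ha x)

lemma tmul_one_mem_polySections (t : ∀ x : M, FormFibre E x)
    (ht : t ∈ Algebra.adjoin ℝ (formGenerators E M)) :
    (fun x => t x ⊗ₜ[ℝ] (1 : A.Alg x)) ∈ polySections E A := by
  induction ht using Algebra.adjoin_induction with
  | mem t ht => exact Algebra.subset_adjoin (Or.inl ⟨t, ht, rfl⟩)
  | algebraMap r => exact Subalgebra.algebraMap_mem _ r
  | add t s _ _ h h' =>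
    convert add_mem h h' using 1
    funext x
    exact TensorProduct.add_tmul _ _ _
  | mul t s _ _ h h' =>
    convert mul_mem h h' using 1
    funext x
    simp

/-- The map `w ↦ w ⊗ 1` that makes forms with coefficients an algebra over forms. -/
def ofForms (U : Opens M) : Forms E U →ₐ[ℝ] CoeffForms E A U where
  toFun w := ⟨fun x => .tmul (w.1 x) 1, fun k p => by
    obtain ⟨t, ht, h⟩ := w.2 p
    refine ⟨_, tmul_one_mem_polySections E A t ht, ?_⟩
    filter_upwards [h] with x hx
    rw [hx]
    exact agreeMod_tmul E A k _ _ _ (by rw [map_one, map_one])⟩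
  map_one' := rfl
  map_mul' a b := Subtype.ext (funext fun x =>
    ((Algebra.TensorProduct.tmul_mul_tmul _ _ _ _).trans (congrArg _ (mul_one 1))).symm)
  map_zero' := Subtype.ext (funext fun x => TensorProduct.zero_tmul _ _)
  map_add' a b := Subtype.ext (funext fun x => TensorProduct.add_tmul _ _ _)
  commutes' _ := rfl

/-- The section `1 ⊗ g` over `U` defined by a member `g` of `A.gens`. -/
def ofGen (U : Opens M) (g : A.gens) : CoeffForms E A U :=
  ⟨fun x => .tmul 1 (AdicCompletion.of _ _ (g.1 x.1)), fun k _ =>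
    ⟨fun x => 1 ⊗ₜ[ℝ] g.1 x, Algebra.subset_adjoin (Or.inr ⟨g.1, g.2, rfl⟩),
      Filter.Eventually.of_forall fun _ =>
        agreeMod_tmul E A k _ _ _ (AdicCompletion.evalₐ_of _ _ _)⟩⟩

/-- The augmentation `Âₓ → ℝ`. -/
def completedAug (x : M) : A.Completed x →ₐ[ℝ] ℝ :=
  (Ideal.Quotient.liftₐ (A.ideal x) (A.ε x) fun _ ha => ha).comp
    ((AdicCompletion.evalOneₐ (A.ideal x)).restrictScalars ℝ)

/-- The augmentation `Λ (T*ₓM) ⊗ Âₓ → ℝ`, which vanishes on forms of positive degree. -/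
def aug (x : M) : CoeffFibre E A x →ₐ[ℝ] ℝ :=
  Algebra.TensorProduct.lift ExteriorAlgebra.algebraMapInv (completedAug A x)
    fun _ _ => Commute.all _ _

end Coefficients

/-! ### Jets of smooth functions -/

section Jets

variable (E : Type*) [NormedAddCommGroup E] [NormedSpace ℝ E]
variable (M : Type*) [TopologicalSpace M] [ChartedSpace E M]

/-- The family of algebras `C^∞(M)`, augmented at `x` by evaluation at `x`, whose generating
families are the constant families `x ↦ f`. -/
abbrev jetFamily : AugFamily M where
  Alg _ := Fun E M
  ε := evalAt
  gens := Set.range fun f _ => f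

variable {M}

/-- The algebra `lim_k C^∞(M) / 𝔪ₓ^k` of infinite jets at `x` of smooth functions, where `𝔪ₓ` is
the ideal of functions that vanish at `x`. -/
abbrev Jet (x : M) := (jetFamily E M).Completed x

/-- The graded algebra `Ω^#(U) ⊗ 𝓙(U)` underlying the de Rham complex of jets.  A family of jets
is smooth if its reduction modulo `𝔪ₓ^k` is, for each `k`, locally a finite sum of products of
smooth functions (or forms) with the jets of fixed functions. -/
abbrev JetForms (U : Opens M) := CoeffForms E (jetFamily E M) U

variable (M) in
/-- The linear span of the pairs `(α ⊗ f, dα ⊗ f)`. -/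
def jetGraph : Submodule ℝ
    ((∀ x : M, FormFibre E x ⊗[ℝ] Fun E M) × (∀ x : M, FormFibre E x ⊗[ℝ] Fun E M)) :=
  Submodule.span ℝ {w | ∃ α ∈ exteriorGraph E M, ∃ f : Fun E M,
    w = (fun x => α.1 x ⊗ₜ[ℝ] f, fun x => α.2 x ⊗ₜ[ℝ] f)}

/-- `s'` is the differential of `s` in the de Rham complex `dR(𝓙)` over `U`.  The flat connection
on jets is the one for which the infinite jets `j(f)` of functions are horizontal, so that the
differential of `∑ αᵢ ⊗ j(fᵢ)` is `∑ dαᵢ ⊗ j(fᵢ)`.  It lowers the order of vanishing of jets by at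
most one, so that the differential modulo `𝔪^k` is determined by the section modulo `𝔪^(k+1)`. -/
def IsJetDifferential {U : Opens M} (s s' : JetForms E U) : Prop :=
  ∀ (k : ℕ) (p : U), ∃ t ∈ jetGraph E M, ∀ᶠ x in 𝓝 p,
    AgreeMod E (A := jetFamily E M) (k + 1) (s.1 x) (t.1 x.1) ∧
    AgreeMod E (A := jetFamily E M) k (s'.1 x) (t.2 x.1)

end Jets

/-! ### Curved L∞ algebras -/

section LInfinity

variable (E : Type*) [NormedAddCommGroup E] [NormedSpace ℝ E]
variable {M : Type*} [TopologicalSpace M] [ChartedSpace E M]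
variable (F : Type*) [NormedAddCommGroup F] [NormedSpace ℝ F]
variable (V : M → Type*) [TopologicalSpace (Bundle.TotalSpace F V)]
variable [∀ x, TopologicalSpace (V x)] [∀ x, AddCommGroup (V x)] [∀ x, Module ℝ (V x)]
variable [FiberBundle F V]

/-- Smooth sections of the dual bundle of `V`: their pairing with every smooth section of `V` is a
smooth function. -/
def DualSections : Submodule ℝ (∀ x : M, V x →L[ℝ] ℝ) where
  carrier := {l | ∀ v : Cₛ^∞⟮𝓘(ℝ, E); F, V⟯, ContMDiff 𝓘(ℝ, E) 𝓘(ℝ, ℝ) ∞ fun x => l x (v x)}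
  add_mem' := fun ha hb v => (ha v).add (hb v)
  zero_mem' := fun _ => contMDiff_const
  smul_mem' := fun r a ha v => by
    have h : ContMDiff 𝓘(ℝ, E) 𝓘(ℝ, ℝ) ∞ fun x => r * a x (v x) := contMDiff_const.mul (ha v)
    exact h

/-- The family of symmetric algebras of the duals of the fibres of `V`, with the augmentations
that vanish on linear elements. The generating families are the smooth sections of the dual. -/
def symFamily : AugFamily M where
  Alg x := SymmetricAlgebra ℝ (V x →L[ℝ] ℝ)
  ε _ := SymmetricAlgebra.algebraMapInv
  gens := {g | ∃ l ∈ DualSections E F V, g = fun x => SymmetricAlgebra.ι ℝ _ (l x)}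

/-- The completed symmetric algebra `Sym^(L^∨[-1])` over `Ω^#`, for the graded `Ω^#`-module
`L = V[-1] ⊗ Ω^#`.  Dualizing over `Ω^#`, one has `L^∨[-1] = V^∨ ⊗ Ω^#` with `V^∨` in degree zero.
Hence the completed symmetric algebra is `Sym^(V^∨) ⊗ Ω^#`, the grading being that of `Ω^#`. -/
abbrev CE (U : Opens M) := CoeffForms E (symFamily E F V) U

/-- The section of `L^∨[-1] ⊆ Sym^(L^∨[-1])` given by a smooth section of the dual of `V`. -/
def CE.gen (U : Opens M) (l : DualSections E F V) : CE E F V U :=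
  ofGen E (symFamily E F V) U ⟨fun x => SymmetricAlgebra.ι ℝ _ (l.1 x), l.1, l.2, rfl⟩

/-- The ideal generated by `L^∨[-1]`. It is generated by elements of degree zero, which are
central, so that it is a two-sided ideal. -/
def CE.genIdeal (U : Opens M) : Ideal (CE E F V U) :=
  Ideal.span (Set.range (CE.gen E F V U))

/-- The ideal generated by the ideal `Ω^{>0}` of forms of positive degree. It is generated by
homogeneous elements of a graded-commutative algebra, so that it is a two-sided ideal. -/
def CE.posIdeal (U : Opens M) : Ideal (CE E F V U) :=
  Ideal.span {s | ∃ q : ℕ, 0 < q ∧ ∃ w ∈ Forms.deg E U q, s = ofForms E _ U w}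

/-- A curved L∞ algebra over the sheaf `Ω` of commutative dg algebras, with nilpotent ideal
`Ω^{>0}`, whose underlying graded `Ω^#`-module is `L = V[-1] ⊗ Ω^#` for a smooth vector bundle `V`
of finite rank: a degree one derivation `d` of square zero of the sheaf of algebras
`Sym^(L^∨[-1])`, extending the exterior derivative of forms (so that `Sym^(L^∨[-1])` becomes a
sheaf of commutative dg algebras over `Ω`), and preserving, modulo `Ω^{>0}`, the ideal sheaf generated by `L^∨[-1]`. The sections of `CE`,
with this differential, are the Chevalley-Eilenberg complex. -/
structure CurvedLInfinity [FiniteDimensional ℝ F] [VectorBundle ℝ F V]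
    [ContMDiffVectorBundle ∞ F V 𝓘(ℝ, E)] where
  d : ∀ U : Opens M, CE E F V U →ₗ[ℝ] CE E F V U
  d_res : ∀ (U W : Opens M) (h : W ≤ U) (s : CE E F V U),
    CoeffForms.res h (d U s) = d W (CoeffForms.res h s)
  d_deg : ∀ (U : Opens M) (q : ℕ), ∀ s ∈ CoeffForms.deg E (symFamily E F V) U q,
    d U s ∈ CoeffForms.deg E (symFamily E F V) U (q + 1)
  d_mul : ∀ (U : Opens M) (q : ℕ), ∀ s ∈ CoeffForms.deg E (symFamily E F V) U q,
    ∀ t : CE E F V U, d U (s * t) = d U s * t + (-1) ^ q * (s * d U t)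
  d_d : ∀ (U : Opens M) (s : CE E F V U), d U (d U s) = 0
  d_forms : ∀ (U : Opens M) (w z : Forms E U), IsExteriorDerivative E w z →
    d U (ofForms E _ U w) = ofForms E _ U z
  d_ideal : ∀ (U : Opens M) (s : CE E F V U),
    (∀ p ∈ U, ∃ W : Opens M, p ∈ W ∧ ∃ h : W ≤ U, CoeffForms.res h s ∈ CE.genIdeal E F V W) →
    (∀ p ∈ U, ∃ W : Opens M, p ∈ W ∧ ∃ h : W ≤ U,
      CoeffForms.res h (d U s) ∈ CE.genIdeal E F V W ⊔ CE.posIdeal E F V W)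

variable {E F V}

/-- The augmentation `Sym^(L^∨[-1]) → Ω^# → Ω^#/Ω^{>0} = C^∞` is a quasi-isomorphism from the
Chevalley-Eilenberg complex to `C^∞`, the latter being concentrated in degree zero: over every
open set it is a morphism of complexes of `Ω`-modules which is an isomorphism in cohomology.
(It is a homomorphism of algebras, and `Ω` acts on `C^∞` through `Ω → Ω/Ω^{>0}`.) -/
def CurvedLInfinity.AugIsQuasiIso [FiniteDimensional ℝ F] [VectorBundle ℝ F V]
    [ContMDiffVectorBundle ∞ F V 𝓘(ℝ, E)] (g : CurvedLInfinity E F V) : Prop :=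
  ∀ U : Opens M,
    (∀ s : CE E F V U, ContMDiff 𝓘(ℝ, E) 𝓘(ℝ, ℝ) ∞ fun x : U => aug E _ x.1 (s.1 x)) ∧
    (∀ s : CE E F V U, ∀ x : U, aug E _ x.1 ((g.d U s).1 x) = 0) ∧
    (∀ f : C^∞⟮𝓘(ℝ, E), U; ℝ⟯, ∃! s : CE E F V U,
      s ∈ CoeffForms.deg E _ U 0 ∧ g.d U s = 0 ∧ ∀ x : U, aug E _ x.1 (s.1 x) = f x) ∧
    (∀ q : ℕ, ∀ s ∈ CoeffForms.deg E (symFamily E F V) U (q + 1), g.d U s = 0 →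
      ∃ t ∈ CoeffForms.deg E (symFamily E F V) U q, g.d U t = s)

end LInfinity

/-! ### Splittings of the jet sequence -/

section Splittings

variable (E : Type*) [NormedAddCommGroup E] [NormedSpace ℝ E]
variable (M : Type*) [TopologicalSpace M] [ChartedSpace E M] [IsManifold 𝓘(ℝ, E) ∞ M]

/-- The tangent bundle, as a family of vector spaces. -/
abbrev Tangent (x : M) := TangentSpace 𝓘(ℝ, E) x

/-- Smooth one-forms on `M`. -/
abbrev OneForms := DualSections E E (Tangent E M)

/-- A splitting of `0 → F² → F¹ → Ω¹ → 0`, where `F^k` is the sheaf of infinite jets that vanish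
to order `k` and the jet of `f` in `F¹` is mapped to `df`.  It is a smooth linear bundle map from
the cotangent bundle to jets; the second condition says that if `f` represents `σ ξ` modulo
`𝔪ₓ²` then `f x = 0` (so that `σ ξ ∈ F¹`) and `df x = ξ`. -/
structure JetSplitting where
  toFun : ∀ x : M, Cotangent E x →ₗ[ℝ] Jet E x
  smooth : ∀ l : OneForms E M,
    (fun x : (⊤ : Opens M) => CoeffFibre.tmul (A := jetFamily E M) 1 (toFun x.1 (l.1 x.1))) ∈
      coeffSubalgebra E (jetFamily E M) ⊤
  split : ∀ (x : M) (ξ : Cotangent E x) (f : Fun E M),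
    AdicCompletion.evalₐ _ 2 (toFun x ξ) = Ideal.Quotient.mk _ f → f x = 0 ∧ diffAt f x = ξ

variable {E M}

/-- The derivatives of order `j` at `x` of a jet at `x`, in the preferred chart at `p`. They only
depend on the jet modulo `𝔪ₓ^(j+1)`, and are computed with a function that represents it. -/
def jetCoeff (p : M) (j : ℕ) (x : M) (s : Jet E x) : E [×j]→L[ℝ] ℝ :=
  iteratedFDeriv ℝ j
    ((Function.surjInv (Ideal.Quotient.mk_surjective (I := (jetFamily E M).ideal x ^ (j + 1)))
      (AdicCompletion.evalₐ _ (j + 1) s) : Fun E M) ∘ (extChartAt 𝓘(ℝ, E) p).symm)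
    (extChartAt 𝓘(ℝ, E) p x)

/-- The weak `C^∞` topology on splittings: uniform convergence, on compact subsets of the domains
of charts, of all derivatives of all Taylor coefficients of the jets `σ(l)`, for all smooth
one-forms `l`. -/
instance : TopologicalSpace (JetSplitting E M) :=
  TopologicalSpace.induced
    (fun σ (i : M × OneForms E M × (Σ _ : ℕ, ℕ)) =>
      (UniformOnFun.ofFun {K | IsCompact K ∧ K ⊆ (extChartAt 𝓘(ℝ, E) i.1).target}
        (iteratedFDeriv ℝ i.2.2.2 fun y => jetCoeff i.1 i.2.2.1 ((extChartAt 𝓘(ℝ, E) i.1).symm y)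
          (σ.toFun _ (i.2.1.1 ((extChartAt 𝓘(ℝ, E) i.1).symm y))))))
    inferInstance

/-- An isomorphism of sheaves of commutative dg algebras over `Ω` from the Chevalley-Eilenberg
complex of `g` to the de Rham complex of jets, which is given on `T^∨` by the splitting `σ`. -/
structure CEIso [FiniteDimensional ℝ E] (g : CurvedLInfinity E E (Tangent E M)) (σ : JetSplitting E M) where
  iso : ∀ U : Opens M, CE E E (Tangent E M) U ≃ₐ[ℝ] JetForms E U
  iso_res : ∀ (U W : Opens M) (h : W ≤ U) (s : CE E E (Tangent E M) U),
    CoeffForms.res h (iso U s) = iso W (CoeffForms.res h s)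
  iso_deg : ∀ (U : Opens M) (q : ℕ) (s : CE E E (Tangent E M) U),
    iso U s ∈ CoeffForms.deg E (jetFamily E M) U q ↔ s ∈ CoeffForms.deg E _ U q
  iso_forms : ∀ (U : Opens M) (w : Forms E U), iso U (ofForms E _ U w) = ofForms E _ U w
  iso_d : ∀ (U : Opens M) (s : CE E E (Tangent E M) U),
    IsJetDifferential E (iso U s) (iso U (g.d U s))
  iso_gen : ∀ (U : Opens M) (l : OneForms E M) (x : U),
    (iso U (CE.gen E E (Tangent E M) U l)).1 x = .tmul 1 (σ.toFun x.1 (l.1 x.1))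

end Splittings

end FormalGeometry

end

/-! A splitting `σ` sends each covector to a jet vanishing at the base point with that covector as
differential. It therefore extends to a filtered homomorphism from the completed symmetric algebra
of the cotangent space to the algebra of jets. Both sides have the same leading terms, so this is an
isomorphism of fibres, and with forms as coefficients it is an isomorphism of sheaves of graded
algebras (`ceEquiv`). The fibre map reflects the filtration because derivatives of polynomials match
derivatives of functions to first order (`IsFrame.mem_pow_of_map`). Smooth sections are reached
because Euler's identity divides a jet of order `k + 1` by the `σ (dX_a)` (`exists_euler`,
`exists_ce_approx`). The curved structure is the flat differential of jets carried back along this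
isomorphism.

The flat differential is given only as a relation between families of representatives. It is a map
because the differential modulo `𝔪^k` depends only on the family modulo `𝔪^(k+1)`
(`jetGraph_mem_fil`). Its values are then limits, and its algebraic identities are checked modulo
every power.

The quasi-isomorphism is a Koszul argument. Let `h = ∑ σ (dX_a) ι_a`, with `ι_a` the contraction
with the coordinate field; it does not depend on the coordinates. The differential of `σ (dX_a)` is
`-dX_a` to leading order. Hence the anticommutator of `h` with the differential is an even
derivation acting as `-(k + q)` on leading terms of order `k` and form degree `q`
(`laplacian_weight`). By completeness it is invertible whenever `k + q > 0`. So the complex is exact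
in positive degrees, and a closed section of degree zero is determined by its values.

For uniqueness, two isomorphisms with property 2 differ by an algebra endomorphism that fixes forms
and `σ`. Division by the `σ (dX_a)` shows that such an endomorphism preserves the filtration. It
also fixes polynomials in `σ`, which approximate every section, so it is the identity
(`JetEnd.toFun_eq`). The differential is thereby determined.

Splittings form an affine space. It is non-empty by a partition of unity, and the straight-line
homotopy is continuous in the weak topology. Nilpotency of `Ω^{>0}` holds because there are no forms
of degree above the dimension. -/

set_option linter.unusedSectionVars false

noncomputable section

namespace FormalGeometry

/-! ### Exterior algebra: contraction, parity, degrees -/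

section Exterior

variable {V : Type*} [AddCommGroup V] [Module ℝ V]

/-- Contraction of the exterior algebra with a linear form. -/
def contract (d : Module.Dual ℝ V) : ExteriorAlgebra ℝ V →ₗ[ℝ] ExteriorAlgebra ℝ V :=
  CliffordAlgebra.contractLeft (Q := (0 : QuadraticForm ℝ V)) d

/-- The parity automorphism of the exterior algebra. -/
def parity : ExteriorAlgebra ℝ V →ₐ[ℝ] ExteriorAlgebra ℝ V :=
  CliffordAlgebra.involute (Q := (0 : QuadraticForm ℝ V))

lemma parity_ι (v : V) : parity (ExteriorAlgebra.ι ℝ v) = -ExteriorAlgebra.ι ℝ v :=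
  CliffordAlgebra.involute_ι v

lemma contract_ι_mul (d : Module.Dual ℝ V) (v : V) (b : ExteriorAlgebra ℝ V) :
    contract d (ExteriorAlgebra.ι ℝ v * b) =
      d v • b - ExteriorAlgebra.ι ℝ v * contract d b :=
  CliffordAlgebra.contractLeft_ι_mul (Q := (0 : QuadraticForm ℝ V)) d v b

lemma contract_ι (d : Module.Dual ℝ V) (v : V) :
    contract d (ExteriorAlgebra.ι ℝ v) = algebraMap ℝ _ (d v) :=
  CliffordAlgebra.contractLeft_ι (Q := (0 : QuadraticForm ℝ V)) d v

lemma contract_algebraMap (d : Module.Dual ℝ V) (r : ℝ) :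
    contract d (algebraMap ℝ _ r) = 0 :=
  CliffordAlgebra.contractLeft_algebraMap (Q := (0 : QuadraticForm ℝ V)) d r

lemma contract_one (d : Module.Dual ℝ V) : contract d 1 = 0 :=
  CliffordAlgebra.contractLeft_one (Q := (0 : QuadraticForm ℝ V)) d

/-- Induction on the exterior algebra, multiplying by vectors on the left. -/
lemma exterior_induction {P : ExteriorAlgebra ℝ V → Prop}
    (h0 : ∀ r, P (algebraMap ℝ _ r)) (ha : ∀ a b, P a → P b → P (a + b))
    (hm : ∀ v a, P a → P (ExteriorAlgebra.ι ℝ v * a)) (a : ExteriorAlgebra ℝ V) : P a :=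
  CliffordAlgebra.left_induction (Q := (0 : QuadraticForm ℝ V)) h0 ha (fun a v => hm v a) a

lemma contract_mul (d : Module.Dual ℝ V) (a b : ExteriorAlgebra ℝ V) :
    contract d (a * b) = contract d a * b + parity a * contract d b := by
  induction a using exterior_induction with
  | h0 r =>
    rw [contract_algebraMap, AlgHom.commutes, ← Algebra.smul_def, ← Algebra.smul_def]
    simp
  | ha x y hx hy => rw [add_mul, map_add, hx, hy, map_add, map_add]; noncomm_ring
  | hm v x hx =>
    rw [mul_assoc, contract_ι_mul, hx, contract_ι_mul, map_mul, parity_ι, sub_mul, smul_mul_assoc]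
    noncomm_ring

lemma parity_contract (d : Module.Dual ℝ V) (a : ExteriorAlgebra ℝ V) :
    parity (contract d a) = -contract d (parity a) := by
  induction a using exterior_induction with
  | h0 r => simp [contract_algebraMap]
  | ha x y hx hy => rw [map_add, map_add, map_add, map_add, hx, hy]; abel
  | hm v x hx =>
    rw [map_mul parity, parity_ι, neg_mul, map_neg, contract_ι_mul, contract_ι_mul, map_sub,
      map_mul parity, map_smul, hx, parity_ι]
    noncomm_ring

lemma exteriorPower_succ (q : ℕ) :
    ⋀[ℝ]^(q + 1) V = LinearMap.range (ExteriorAlgebra.ι ℝ) * ⋀[ℝ]^q V :=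
  pow_succ' _ _

lemma parity_of_mem {q : ℕ} {a : ExteriorAlgebra ℝ V} (ha : a ∈ ⋀[ℝ]^q V) :
    parity a = (-1) ^ q * a := by
  induction q generalizing a with
  | zero =>
    obtain ⟨r, rfl⟩ := Submodule.mem_one.1 (by simpa using ha)
    simp
  | succ q ih =>
    rw [exteriorPower_succ] at ha
    induction ha using Submodule.mul_induction_on' with
    | mem_mul_mem m hm n hn =>
      obtain ⟨v, rfl⟩ := hm
      rw [map_mul, ih hn, parity_ι, pow_succ, neg_mul, mul_neg_one, neg_mul, ← mul_assoc,
        ← mul_assoc, ((Commute.neg_one_left _).pow_left q).eq]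
    | add x _ y _ hx hy => rw [map_add, hx, hy, mul_add]

lemma contract_mem {q : ℕ} (d : Module.Dual ℝ V) {a : ExteriorAlgebra ℝ V}
    (ha : a ∈ ⋀[ℝ]^(q + 1) V) : contract d a ∈ ⋀[ℝ]^q V := by
  induction q generalizing a with
  | zero =>
    obtain ⟨v, rfl⟩ : ∃ v, ExteriorAlgebra.ι ℝ v = a := by simpa using ha
    rw [contract_ι]
    exact SetLike.algebraMap_mem_graded _ _
  | succ q ih =>
    rw [exteriorPower_succ] at ha
    induction ha using Submodule.mul_induction_on' with
    | mem_mul_mem m hm n hn =>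
      obtain ⟨v, rfl⟩ := hm
      rw [contract_ι_mul]
      refine sub_mem (Submodule.smul_mem _ _ hn) ?_
      rw [exteriorPower_succ]
      exact Submodule.mul_mem_mul ⟨v, rfl⟩ (ih hn)
    | add x _ y _ hx hy => rw [map_add]; exact add_mem hx hy

/-- Euler's identity for the exterior algebra. -/
lemma sum_ι_mul_contract {ι : Type*} [Fintype ι] (e : ι → V) (d : ι → Module.Dual ℝ V)
    (h : ∀ v, ∑ i, d i v • e i = v) {q : ℕ} {a : ExteriorAlgebra ℝ V} (ha : a ∈ ⋀[ℝ]^q V) :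
    ∑ i, ExteriorAlgebra.ι ℝ (e i) * contract (d i) a = (q : ℝ) • a := by
  induction q generalizing a with
  | zero =>
    obtain ⟨r, rfl⟩ := Submodule.mem_one.1 (by simpa using ha)
    simp [contract_algebraMap]
  | succ q ih =>
    rw [exteriorPower_succ] at ha
    induction ha using Submodule.mul_induction_on' with
    | mem_mul_mem m hm n hn =>
      obtain ⟨v, rfl⟩ := hm
      have h1 : ∀ i, ExteriorAlgebra.ι ℝ (e i) * contract (d i) (ExteriorAlgebra.ι ℝ v * n) =
          ExteriorAlgebra.ι ℝ (d i v • e i) * n +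
          ExteriorAlgebra.ι ℝ v * (ExteriorAlgebra.ι ℝ (e i) * contract (d i) n) := by
        intro i
        have h2 : ExteriorAlgebra.ι ℝ v * ExteriorAlgebra.ι ℝ (e i) =
            -(ExteriorAlgebra.ι ℝ (e i) * ExteriorAlgebra.ι ℝ v) :=
          eq_neg_of_add_eq_zero_left (ExteriorAlgebra.ι_add_mul_swap v (e i))
        rw [contract_ι_mul, mul_sub, map_smul, smul_mul_assoc, mul_smul_comm,
          ← mul_assoc (ExteriorAlgebra.ι ℝ v), h2]
        noncomm_ring
      rw [Finset.sum_congr rfl fun i _ => h1 i, Finset.sum_add_distrib, ← Finset.sum_mul,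
        ← map_sum, h, ← Finset.mul_sum, ih hn]
      push_cast
      rw [add_smul, one_smul, mul_smul_comm, add_comm]
    | add x _ y _ hx hy => simp only [map_add, mul_add, Finset.sum_add_distrib, hx, hy, smul_add]

/-- Projection of the exterior algebra to its part of degree `q`. -/
def degProj (q : ℕ) : ExteriorAlgebra ℝ V →ₗ[ℝ] ExteriorAlgebra ℝ V :=
  GradedAlgebra.proj (fun i : ℕ => ⋀[ℝ]^i V) q

lemma degProj_mem (q : ℕ) (a : ExteriorAlgebra ℝ V) : degProj q a ∈ ⋀[ℝ]^q V :=
  SetLike.coe_mem _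

lemma degProj_of_mem {q : ℕ} {a : ExteriorAlgebra ℝ V} (ha : a ∈ ⋀[ℝ]^q V) : degProj q a = a := by
  exact (GradedAlgebra.proj_apply _ _ _).trans
    (DirectSum.decompose_of_mem_same (fun i : ℕ => ⋀[ℝ]^i V) ha)

lemma degProj_of_mem_ne {q r : ℕ} (h : q ≠ r) {a : ExteriorAlgebra ℝ V} (ha : a ∈ ⋀[ℝ]^q V) :
    degProj r a = 0 := by
  exact (GradedAlgebra.proj_apply _ _ _).trans
    (DirectSum.decompose_of_mem_ne (fun i : ℕ => ⋀[ℝ]^i V) ha h)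

variable [FiniteDimensional ℝ V]

lemma exteriorPower_eq_bot {q : ℕ} (h : Module.finrank ℝ V < q) : ⋀[ℝ]^q V = ⊥ := by
  rw [← Submodule.finrank_eq_zero (R := ℝ), exteriorPower.finrank_eq, Nat.choose_eq_zero_of_lt h]

lemma sum_degProj (a : ExteriorAlgebra ℝ V) {N : ℕ} (hN : Module.finrank ℝ V < N) :
    ∑ q ∈ Finset.range N, degProj q a = a := by
  classical
  conv_rhs => rw [← DirectSum.sum_support_decompose (fun i : ℕ => ⋀[ℝ]^i V) a]
  symm
  refine Finset.sum_subset (fun q hq => ?_) fun q _ hq => ?_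
  · rw [Finset.mem_range]
    by_contra h
    have h1 : degProj q a ∈ ⋀[ℝ]^q V := degProj_mem q a
    rw [exteriorPower_eq_bot (by omega)] at h1
    exact (DFinsupp.mem_support_iff.1 hq) (Subtype.ext h1)
  · have := DFinsupp.notMem_support_iff.1 hq
    exact congrArg Subtype.val this

/-- Finiteness lets an element of `Λ ⊗ Â` be written as a finite sum over a basis of `Λ`. This is
how multiplicativity and completeness of the filtration pass from `Â` to the fibres. -/
instance : Module.Finite ℝ (ExteriorAlgebra ℝ V) := by
  have h : (⨆ q ∈ Finset.range (Module.finrank ℝ V + 1), ⋀[ℝ]^q V : Submodule ℝ (ExteriorAlgebra ℝ V))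
      = ⊤ := by
    rw [eq_top_iff]
    intro a _
    rw [← sum_degProj a (Nat.lt_succ_self _)]
    exact sum_mem fun q hq => Submodule.mem_iSup_of_mem q (Submodule.mem_iSup_of_mem hq
      (degProj_mem q a))
  rw [Module.finite_def, ← h]
  refine Submodule.fg_biSup _ _ fun q _ => ?_
  exact Module.Finite.iff_fg.1 (inferInstanceAs (Module.Finite ℝ (⋀[ℝ]^q V)))

/-- Degrees add, so a product of more than `dim V` elements of positive degree lies in a degree
where the exterior power is zero. -/
lemma exterior_list_prod_eq_zero (l : List (ExteriorAlgebra ℝ V))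
    (h : ∀ a ∈ l, ∃ q : ℕ, 0 < q ∧ a ∈ ⋀[ℝ]^q V) (hl : Module.finrank ℝ V < l.length) :
    l.prod = 0 := by
  have key : ∀ l : List (ExteriorAlgebra ℝ V), (∀ a ∈ l, ∃ q : ℕ, 0 < q ∧ a ∈ ⋀[ℝ]^q V) →
      ∃ q, l.length ≤ q ∧ l.prod ∈ ⋀[ℝ]^q V := by
    intro l
    induction l with
    | nil => exact fun _ => ⟨0, le_rfl, SetLike.one_mem_graded (fun i : ℕ => ⋀[ℝ]^i V)⟩
    | cons a l ih =>
      intro h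
      obtain ⟨q, hq, h1⟩ := h a (by simp)
      obtain ⟨r, hr, h2⟩ := ih fun b hb => h b (by simp [hb])
      refine ⟨q + r, by simp; omega, ?_⟩
      rw [List.prod_cons]
      exact SetLike.mul_mem_graded h1 h2
  obtain ⟨q, hq, h1⟩ := key l h
  rwa [exteriorPower_eq_bot (by omega)] at h1

end Exterior

/-! ### Components of tensors with respect to the first factor -/

section Slices

variable {Λ B C : Type*} [AddCommGroup Λ] [Module ℝ Λ] [AddCommGroup B] [Module ℝ B]
  [AddCommGroup C] [Module ℝ C]

/-- The map `a ⊗ b ↦ μ(a) b`. -/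
def slice (μ : Module.Dual ℝ Λ) : Λ ⊗[ℝ] B →ₗ[ℝ] B :=
  (TensorProduct.lid ℝ B).toLinearMap ∘ₗ TensorProduct.map μ LinearMap.id

@[simp]
lemma slice_tmul (μ : Module.Dual ℝ Λ) (a : Λ) (b : B) : slice μ (a ⊗ₜ[ℝ] b) = μ a • b := by
  simp [slice]

lemma slice_map (μ : Module.Dual ℝ Λ) (f : Λ →ₗ[ℝ] Λ) (g : B →ₗ[ℝ] C) (z : Λ ⊗[ℝ] B) :
    slice μ (TensorProduct.map f g z) = g (slice (μ ∘ₗ f) z) := by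
  induction z using TensorProduct.induction_on with
  | zero => simp
  | tmul a b => simp
  | add x y hx hy => simp [hx, hy]

lemma slice_lTensor (μ : Module.Dual ℝ Λ) (g : B →ₗ[ℝ] C) (z : Λ ⊗[ℝ] B) :
    slice μ (TensorProduct.map LinearMap.id g z) = g (slice μ z) :=
  slice_map μ LinearMap.id g z

/-- The coordinates of a tensor in a basis of the first factor are slices along the coordinate
forms. -/
lemma eq_zero_of_slice {z : Λ ⊗[ℝ] B} (h : ∀ μ : Module.Dual ℝ Λ, slice μ z = 0) : z = 0 := by
  classical
  let b := Module.Basis.ofVectorSpace ℝ Λ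
  apply (TensorProduct.equivFinsuppOfBasisLeft b).injective
  rw [map_zero]
  ext i
  have key : ∀ z : Λ ⊗[ℝ] B, TensorProduct.equivFinsuppOfBasisLeft b z i = slice (b.coord i) z := by
    intro z
    induction z using TensorProduct.induction_on with
    | zero => simp
    | tmul a c => simp
    | add x y hx hy => simp [hx, hy]
  rw [key, h]
  rfl

lemma sum_tmul_slice {ι : Type*} [Fintype ι] (b : Module.Basis ι ℝ Λ) (z : Λ ⊗[ℝ] B) :
    ∑ i, b i ⊗ₜ[ℝ] slice (b.coord i) z = z := by
  induction z using TensorProduct.induction_on with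
  | zero => simp
  | tmul a c =>
    simp only [slice_tmul, Module.Basis.coord_apply, ← TensorProduct.smul_tmul]
    rw [← TensorProduct.sum_tmul, b.sum_repr]
  | add x y hx hy => simp only [map_add, TensorProduct.tmul_add, Finset.sum_add_distrib, hx, hy]

end Slices


/-! ### Powers of augmentation ideals and first-order frames -/

section AugmentedAlgebra

variable {A B : Type*} [CommRing A] [Algebra ℝ A] [CommRing B] [Algebra ℝ B]

/-- By the Leibniz rule at most one factor is differentiated, so differentiation costs one order of
vanishing. The shifts by one in the filtrations below come from this. -/
lemma derivation_mem_pow (I : Ideal A) (D : Derivation ℝ A A) {r : ℕ} {g : A}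
    (hg : g ∈ I ^ (r + 1)) : D g ∈ I ^ r := by
  induction r generalizing g with
  | zero => simp
  | succ r ih =>
    rw [pow_succ'] at hg
    induction hg using Submodule.mul_induction_on' with
    | mem_mul_mem a ha b hb =>
      rw [Derivation.leibniz, smul_eq_mul, smul_eq_mul]
      refine add_mem ?_ (Ideal.mul_mem_right _ _ hb)
      rw [pow_succ']
      exact Ideal.mul_mem_mul ha (ih hb)
    | add x _ y _ hx hy => rw [map_add]; exact add_mem hx hy

/-- The derivations `D i` form, to first order at the augmentation `ε`, a frame dual to the
coordinates `X i`. -/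
structure IsFrame {ι : Type*} [Fintype ι] (ε : A →ₐ[ℝ] ℝ) (X : ι → A)
    (D : ι → Derivation ℝ A A) : Prop where
  mem : ∀ i, X i ∈ RingHom.ker ε
  expand : ∀ h ∈ RingHom.ker ε, h - ∑ i, ε (D i h) • X i ∈ RingHom.ker ε ^ 2

variable {ι : Type*} [Fintype ι] {ε : A →ₐ[ℝ] ℝ} {X : ι → A} {D : ι → Derivation ℝ A A}

lemma sub_algebraMap_mem_ker (ε : A →ₐ[ℝ] ℝ) (h : A) : h - algebraMap ℝ A (ε h) ∈ RingHom.ker ε := by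
  simp [RingHom.mem_ker]

/-- Euler's identity for homogeneous functions, to leading order. -/
lemma IsFrame.euler (hF : IsFrame ε X D) {r : ℕ} {g : A} (hg : g ∈ RingHom.ker ε ^ r) :
    ∑ i, X i * D i g - (r : ℝ) • g ∈ RingHom.ker ε ^ (r + 1) := by
  induction r generalizing g with
  | zero =>
    simp only [Nat.cast_zero, zero_smul, sub_zero, zero_add, pow_one]
    exact sum_mem fun i _ => Ideal.mul_mem_right _ _ (hF.mem i)
  | succ r ih =>
    rw [pow_succ'] at hg
    induction hg using Submodule.mul_induction_on' with
    | mem_mul_mem a ha b hb =>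
      -- Euler's identity for a single factor: replacing `D i a` by its augmentation costs an
      -- element of `I ^ 2`, and the rest is `hF.expand`.
      have h1 : ∑ i, X i * D i a - a ∈ RingHom.ker ε ^ 2 := by
        have h2 : ∑ i, X i * D i a - a = ∑ i, X i * (D i a - algebraMap ℝ A (ε (D i a))) -
            (a - ∑ i, ε (D i a) • X i) := by
          simp only [mul_sub, Finset.sum_sub_distrib, Algebra.smul_def]
          simp only [mul_comm (X _)]
          ring
        rw [h2]
        refine sub_mem (sum_mem fun i _ => ?_) (hF.expand a ha)
        rw [pow_two]
        exact Ideal.mul_mem_mul (hF.mem i) (sub_algebraMap_mem_ker ε _)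
      have h3 : ∑ i, X i * D i (a * b) - ((r + 1 : ℕ) : ℝ) • (a * b) =
          a * (∑ i, X i * D i b - (r : ℝ) • b) + (∑ i, X i * D i a - a) * b := by
        simp only [Derivation.leibniz, smul_eq_mul, mul_add, Finset.sum_add_distrib, mul_sub,
          sub_mul, Finset.mul_sum, Finset.sum_mul, Nat.cast_add, Nat.cast_one, add_smul, one_smul,
          mul_smul_comm]
        rw [Finset.sum_congr rfl fun i _ => show X i * (a * D i b) = a * (X i * D i b) by ring,
          Finset.sum_congr rfl fun i _ => show X i * (b * D i a) = X i * D i a * b by ring]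
        ring
      rw [h3]
      refine add_mem ?_ ?_
      · rw [pow_succ']
        exact Ideal.mul_mem_mul ha (ih hb)
      · rw [show r + 1 + 1 = 2 + r by ring, pow_add]
        exact Ideal.mul_mem_mul h1 hb
    | add x _ y _ hx hy =>
      convert add_mem hx hy using 1
      simp only [map_add, mul_add, Finset.sum_add_distrib, smul_add]
      ring

/-- In characteristic zero Euler's identity can be solved for `g`: up to a higher power, `g` is a
multiple of `∑ X i * D i g`, and the factors `X i` supply the extra order. -/
lemma IsFrame.mem_pow_succ (hF : IsFrame ε X D) {r : ℕ} {g : A} (h0 : ε g = 0)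
    (h : ∀ i, D i g ∈ RingHom.ker ε ^ r) : g ∈ RingHom.ker ε ^ (r + 1) := by
  induction r with
  | zero => simpa [RingHom.mem_ker] using h0
  | succ r ih =>
    have h1 : g ∈ RingHom.ker ε ^ (r + 1) :=
      ih fun i => Ideal.pow_le_pow_right (Nat.le_succ r) (h i)
    have h2 : ∑ i, X i * D i g ∈ RingHom.ker ε ^ (r + 1 + 1) := sum_mem fun i _ => by
      rw [pow_succ']
      exact Ideal.mul_mem_mul (hF.mem i) (h i)
    have h3 := sub_mem h2 (hF.euler h1)
    rw [sub_sub_cancel] at h3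
    have h4 := Submodule.smul_of_tower_mem (RingHom.ker ε ^ (r + 1 + 1)) ((r + 1 : ℕ) : ℝ)⁻¹ h3
    rwa [smul_smul, inv_mul_cancel₀ (by positivity), one_smul] at h4

/-- A homomorphism compatible with frames to first order reflects powers of the augmentation
ideals. -/
lemma IsFrame.mem_pow_of_map (hF : IsFrame ε X D) {δ : B →ₐ[ℝ] ℝ} {D' : ι → Derivation ℝ B B}
    {φ : A →ₐ[ℝ] B} (hε : ∀ a, δ (φ a) = ε a)
    (hD : ∀ i a, D' i (φ a) - φ (D i a) ∈ RingHom.ker δ) {k : ℕ} {P : A}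
    (hP : φ P ∈ RingHom.ker δ ^ k) : P ∈ RingHom.ker ε ^ k := by
  have hφ : ∀ r : ℕ, ∀ a ∈ RingHom.ker ε ^ r, φ a ∈ RingHom.ker δ ^ r := by
    intro r a ha
    have h1 : RingHom.ker ε ≤ (RingHom.ker δ).comap φ := fun a ha => by
      simpa [RingHom.mem_ker, hε] using ha
    have h2 : RingHom.ker ε ^ r ≤ (RingHom.ker δ ^ r).comap φ :=
      (Ideal.pow_right_mono h1 r).trans (Ideal.le_comap_pow _ r)
    exact h2 ha
  -- The defect `D' φ - φ D` is a derivation along `φ` with values in the augmentation ideal, so it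
  -- preserves orders instead of lowering them.
  have hΔ : ∀ i, ∀ r : ℕ, ∀ a ∈ RingHom.ker ε ^ r,
      D' i (φ a) - φ (D i a) ∈ RingHom.ker δ ^ r := by
    intro i r
    induction r with
    | zero => simp
    | succ r ih =>
      intro a ha
      rw [pow_succ'] at ha
      induction ha using Submodule.mul_induction_on' with
      | mem_mul_mem a ha b hb =>
        have h : D' i (φ (a * b)) - φ (D i (a * b)) =
            φ a * (D' i (φ b) - φ (D i b)) + (D' i (φ a) - φ (D i a)) * φ b := by
          simp only [map_mul, Derivation.leibniz, smul_eq_mul, map_add]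
          ring
        rw [h, pow_succ']
        exact add_mem (Ideal.mul_mem_mul (by simpa using hφ 1 a (by simpa using ha)) (ih b hb))
          (Ideal.mul_mem_mul (hD i a) (hφ r b hb))
      | add x _ y _ hx hy =>
        convert add_mem hx hy using 1
        simp only [map_add]
        ring
  -- If `φ a` has one order more than is known for `a`, the same holds for each derivative `D i a`,
  -- since the defect is negligible. The induction hypothesis improves the derivatives, and
  -- `mem_pow_succ` integrates.
  have key : ∀ r : ℕ, ∀ a ∈ RingHom.ker ε ^ r, φ a ∈ RingHom.ker δ ^ (r + 1) →
      a ∈ RingHom.ker ε ^ (r + 1) := by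
    intro r
    induction r with
    | zero =>
      intro a _ ha
      simpa [RingHom.mem_ker, hε] using ha
    | succ r ih =>
      intro a ha ha'
      refine hF.mem_pow_succ ?_ fun i => ih _ (derivation_mem_pow _ _ ha) ?_
      · have := Ideal.pow_le_self (Nat.succ_ne_zero _) ha
        exact this
      · have := sub_mem (derivation_mem_pow _ (D' i) ha') (hΔ i _ a ha)
        rwa [sub_sub_cancel] at this
  induction k with
  | zero => simp
  | succ k ih => exact key k P (ih (Ideal.pow_le_pow_right (Nat.le_succ k) hP)) hP

end AugmentedAlgebra

/-! ### Adic completions through their truncations -/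

section Completion

variable {A : Type*} [CommRing A] (I : Ideal A)

lemma evalₐ_factor {j k : ℕ} (h : j ≤ k) (z : AdicCompletion I A) :
    Ideal.Quotient.factor (Ideal.pow_le_pow_right h) (AdicCompletion.evalₐ I k z) =
      AdicCompletion.evalₐ I j z := by
  induction z using AdicCompletion.induction_on with
  | _ z =>
    rw [AdicCompletion.evalₐ_mk, AdicCompletion.evalₐ_mk, Ideal.Quotient.factor_mk]
    exact (AdicCompletion.Ideal.mk_eq_mk I h z)

lemma evalₐ_eq_zero_of_le {j k : ℕ} (h : j ≤ k) {z : AdicCompletion I A}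
    (hz : AdicCompletion.evalₐ I k z = 0) : AdicCompletion.evalₐ I j z = 0 := by
  rw [← evalₐ_factor I h, hz, map_zero]

lemma exists_evalₐ_eq (u : ℕ → AdicCompletion I A)
    (hu : ∀ k, AdicCompletion.evalₐ I k (u (k + 1)) = AdicCompletion.evalₐ I k (u k)) :
    ∃ z, ∀ k, AdicCompletion.evalₐ I k z = AdicCompletion.evalₐ I k (u k) := by
  choose a ha using fun k => Ideal.Quotient.mk_surjective (AdicCompletion.evalₐ I k (u k))
  refine ⟨AdicCompletion.mk I A (AdicCompletion.AdicCauchySequence.mk I A a fun n => ?_),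
    fun k => ?_⟩
  · rw [SModEq.comm]
    have h1 : Ideal.Quotient.mk (I ^ n) (a (n + 1)) = Ideal.Quotient.mk (I ^ n) (a n) := by
      rw [ha n, ← hu n, ← evalₐ_factor I (Nat.le_succ n), ← ha (n + 1), Ideal.Quotient.factor_mk]
    rw [SModEq.sub_mem]
    have := Ideal.Quotient.eq.1 h1
    simpa using this
  · rw [AdicCompletion.evalₐ_mk]
    exact ha k

lemma evalₐ_mul_eq_zero {i j : ℕ} {y z : AdicCompletion I A}
    (hy : AdicCompletion.evalₐ I i y = 0) (hz : AdicCompletion.evalₐ I j z = 0) :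
    AdicCompletion.evalₐ I (i + j) (y * z) = 0 := by
  -- Vanishing at level `i` means that a representative at any higher level lies in `I ^ i`; the
  -- product is computed on such representatives at level `i + j`.
  have key : ∀ (i k : ℕ) (_ : i ≤ k) (y : AdicCompletion I A),
      AdicCompletion.evalₐ I i y = 0 →
      ∃ a ∈ I ^ i, AdicCompletion.evalₐ I k y = Ideal.Quotient.mk _ a := by
    intro i k h y hy
    obtain ⟨a, ha⟩ := Ideal.Quotient.mk_surjective (AdicCompletion.evalₐ I k y)
    refine ⟨a, ?_, ha.symm⟩
    rw [← evalₐ_factor I h, ← ha, Ideal.Quotient.factor_mk] at hy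
    exact Ideal.Quotient.eq_zero_iff_mem.1 hy
  obtain ⟨a, ha, h1⟩ := key i (i + j) (by omega) y hy
  obtain ⟨b, hb, h2⟩ := key j (i + j) (by omega) z hz
  rw [map_mul, h1, h2, ← map_mul, Ideal.Quotient.eq_zero_iff_mem, pow_add]
  exact Ideal.mul_mem_mul ha hb

end Completion

/-! ### The filtration of the fibres: separated, multiplicative, complete -/

section Fibres

variable {E : Type*} [NormedAddCommGroup E] [NormedSpace ℝ E]
variable {M : Type*} [TopologicalSpace M] [ChartedSpace E M]

instance [FiniteDimensional ℝ E] (x : M) : FiniteDimensional ℝ (TangentSpace 𝓘(ℝ, E) x) :=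
  inferInstanceAs (FiniteDimensional ℝ E)

variable {A : AugFamily M} {x : M}

/-- The part of order at least `k` of a fibre. -/
def fil (k : ℕ) (x : M) : Ideal (CoeffFibre E A x) := RingHom.ker (trunc E A k x)

lemma mem_fil {k : ℕ} {z : CoeffFibre E A x} : z ∈ fil k x ↔ trunc E A k x z = 0 := Iff.rfl

/-- The component `μ ⊗ 1` of an element of the fibre. -/
def comp (μ : Module.Dual ℝ (FormFibre E x)) : CoeffFibre E A x →ₗ[ℝ] A.Completed x :=
  slice (B := A.Completed x) μ

@[simp]
lemma comp_tmul (μ : Module.Dual ℝ (FormFibre E x)) (a : FormFibre E x) (b : A.Completed x) :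
    comp μ (CoeffFibre.tmul a b) = μ a • b := slice_tmul μ a b

/-- Components separate tensors, so the order of an element of `Λ ⊗ Â` is read off from its
components in `Â`. -/
lemma mem_fil_iff {k : ℕ} {z : CoeffFibre E A x} :
    z ∈ fil k x ↔ ∀ μ, AdicCompletion.evalₐ (A.ideal x) k (comp μ z) = 0 := by
  have key : ∀ μ, slice (B := A.Alg x ⧸ A.ideal x ^ k) μ (trunc E A k x z) =
      AdicCompletion.evalₐ (A.ideal x) k (comp μ z) := fun μ =>
    slice_lTensor μ ((AdicCompletion.evalₐ (A.ideal x) k).restrictScalars ℝ).toLinearMap z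
  constructor
  · intro h μ
    rw [← key, mem_fil.1 h]
    exact map_zero _
  · intro h
    refine eq_zero_of_slice (B := A.Alg x ⧸ A.ideal x ^ k) fun μ => ?_
    rw [key, h]

lemma eq_zero_of_comp {z : CoeffFibre E A x} (h : ∀ μ, comp μ z = 0) : z = 0 :=
  eq_zero_of_slice (B := A.Completed x) h

/-- The filtration is separated. This is what allows equalities of sections to be checked modulo
each power only. -/
lemma eq_zero_of_mem_fil {z : CoeffFibre E A x} (h : ∀ k, z ∈ fil k x) : z = 0 :=
  eq_zero_of_comp fun μ => AdicCompletion.ext_evalₐ fun k => by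
    rw [mem_fil_iff.1 (h k), map_zero]

lemma fil_anti {j k : ℕ} (h : j ≤ k) : fil (E := E) (A := A) k x ≤ fil j x := fun _ hz =>
  mem_fil_iff.2 fun μ => evalₐ_eq_zero_of_le _ h (mem_fil_iff.1 hz μ)

lemma fil_zero : fil (E := E) (A := A) 0 x = ⊤ := by
  rw [eq_top_iff]
  intro z _
  refine mem_fil_iff.2 fun μ => ?_
  have : Subsingleton (A.Alg x ⧸ A.ideal x ^ 0) := by
    rw [pow_zero, Ideal.one_eq_top]
    infer_instance
  exact Subsingleton.elim _ _

lemma fil_mul_right {k : ℕ} {y : CoeffFibre E A x} (z : CoeffFibre E A x)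
    (hy : y ∈ fil k x) : y * z ∈ fil k x := by
  rw [mem_fil] at hy ⊢
  rw [map_mul, hy, zero_mul]

lemma evalₐ_smul (k : ℕ) (r : ℝ) (b : A.Completed x) :
    AdicCompletion.evalₐ (A.ideal x) k (r • b) = r • AdicCompletion.evalₐ (A.ideal x) k b :=
  map_smul ((AdicCompletion.evalₐ (A.ideal x) k).restrictScalars ℝ) r b

lemma tmul_mem_fil {k : ℕ} (a : FormFibre E x) {b : A.Completed x}
    (hb : AdicCompletion.evalₐ (A.ideal x) k b = 0) : CoeffFibre.tmul a b ∈ fil k x :=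
  mem_fil_iff.2 fun μ => by rw [comp_tmul, evalₐ_smul, hb, smul_zero]

lemma one_tmul_mem_fil_iff {k : ℕ} {b : A.Completed x} :
    (CoeffFibre.tmul 1 b : CoeffFibre E A x) ∈ fil k x ↔
      AdicCompletion.evalₐ (A.ideal x) k b = 0 := by
  refine ⟨fun h => ?_, tmul_mem_fil 1⟩
  have := mem_fil_iff.1 h ExteriorAlgebra.algebraMapInv.toLinearMap
  rwa [comp_tmul, AlgHom.toLinearMap_apply, map_one, one_smul] at this

lemma tmul_mul_tmul (a b : FormFibre E x) (c d : A.Completed x) :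
    (CoeffFibre.tmul a c * CoeffFibre.tmul b d : CoeffFibre E A x) =
      CoeffFibre.tmul (a * b) (c * d) :=
  Algebra.TensorProduct.tmul_mul_tmul _ _ _ _

lemma coeff_induction {P : CoeffFibre E A x → Prop} (h0 : P 0)
    (ht : ∀ a b, P (CoeffFibre.tmul a b)) (ha : ∀ y z, P y → P z → P (y + z))
    (z : CoeffFibre E A x) : P z :=
  TensorProduct.induction_on (R := ℝ) (M := FormFibre E x) (N := A.Completed x) (motive := P)
    z h0 ht ha

lemma sum_tmul_comp {κ : Type*} [Fintype κ] (b : Module.Basis κ ℝ (FormFibre E x))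
    (z : CoeffFibre E A x) : ∑ i, CoeffFibre.tmul (b i) (comp (b.coord i) z) = z :=
  sum_tmul_slice (B := A.Completed x) b z

variable (E A x) in
/-- The inclusion `Λ ⊗ Aₓ → Λ ⊗ Âₓ`. -/
def emb : FormFibre E x ⊗[ℝ] A.Alg x →ₐ[ℝ] CoeffFibre E A x :=
  Algebra.TensorProduct.map (AlgHom.id ℝ _)
    (IsScalarTower.toAlgHom ℝ (A.Alg x) (A.Completed x))

lemma emb_tmul (a : FormFibre E x) (c : A.Alg x) :
    emb E A x (a ⊗ₜ c) = CoeffFibre.tmul a (AdicCompletion.of _ _ c) := rfl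

lemma trunc_emb (k : ℕ) (t : FormFibre E x ⊗[ℝ] A.Alg x) :
    trunc E A k x (emb E A x t) = mkTrunc E A k x t := by
  induction t using TensorProduct.induction_on with
  | zero => simp
  | tmul a c => exact agreeMod_tmul E A k a _ c (AdicCompletion.evalₐ_of _ _ _)
  | add y z hy hz => rw [map_add, map_add, map_add, hy, hz]

/-- Restates approximation as membership in an ideal, so that approximations can be added,
multiplied and compared. -/
lemma agreeMod_iff {k : ℕ} {s : CoeffFibre E A x} {t : FormFibre E x ⊗[ℝ] A.Alg x} :
    AgreeMod E k s t ↔ s - emb E A x t ∈ fil k x := by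
  rw [mem_fil, map_sub, trunc_emb, sub_eq_zero]
  rfl

lemma emb_mem_fil_iff {k : ℕ} {t : FormFibre E x ⊗[ℝ] A.Alg x} :
    emb E A x t ∈ fil k x ↔ ∀ μ : Module.Dual ℝ (FormFibre E x), slice μ t ∈ A.ideal x ^ k := by
  rw [mem_fil_iff]
  refine forall_congr' fun μ => ?_
  have : comp μ (emb E A x t) = AdicCompletion.of _ _ (slice μ t) :=
    slice_lTensor μ (IsScalarTower.toAlgHom ℝ (A.Alg x) (A.Completed x)).toLinearMap t
  rw [this, AdicCompletion.evalₐ_of, Ideal.Quotient.eq_zero_iff_mem]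

variable [FiniteDimensional ℝ E]

lemma fil_mul_fil {i j : ℕ} {y z : CoeffFibre E A x} (hy : y ∈ fil i x)
    (hz : z ∈ fil j x) : y * z ∈ fil (i + j) x := by
  let b := Module.finBasis ℝ (FormFibre E x)
  rw [← sum_tmul_comp b y, ← sum_tmul_comp b z, Finset.sum_mul_sum]
  refine sum_mem fun m _ => sum_mem fun n _ => ?_
  rw [tmul_mul_tmul]
  exact tmul_mem_fil _ (evalₐ_mul_eq_zero _ (mem_fil_iff.1 hy _) (mem_fil_iff.1 hz _))

/-- The fibres are complete. -/
lemma exists_limit (u : ℕ → CoeffFibre E A x) (hu : ∀ k, u (k + 1) - u k ∈ fil k x) :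
    ∃ z, ∀ k, z - u k ∈ fil k x := by
  let b := Module.finBasis ℝ (FormFibre E x)
  have h1 : ∀ i, ∃ z : A.Completed x, ∀ k, AdicCompletion.evalₐ (A.ideal x) k z =
      AdicCompletion.evalₐ (A.ideal x) k (comp (b.coord i) (u k)) := fun i =>
    exists_evalₐ_eq _ _ fun k => by
      have := mem_fil_iff.1 (hu k) (b.coord i)
      rwa [map_sub, map_sub, sub_eq_zero] at this
  choose z hz using h1
  refine ⟨∑ i, CoeffFibre.tmul (b i) (z i), fun k => ?_⟩
  rw [← sum_tmul_comp b (u k), ← Finset.sum_sub_distrib]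
  refine sum_mem fun i _ => ?_
  have h2 : (CoeffFibre.tmul (b i) (z i) - CoeffFibre.tmul (b i) (comp (b.coord i) (u k)) :
      CoeffFibre E A x) = CoeffFibre.tmul (b i) (z i - comp (b.coord i) (u k)) :=
    (TensorProduct.tmul_sub _ _ _).symm
  rw [h2]
  exact tmul_mem_fil _ (by rw [map_sub, hz, sub_self])

end Fibres


/-! ### Hadamard's lemma on a vector space -/

section Hadamard

variable {E : Type*} [NormedAddCommGroup E] [NormedSpace ℝ E]

/-- The integral is the value at `0` of the convolution of the indicator of `(0, 1]` with `s ↦ χ s *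
g y (-s)`. Convolutions depend smoothly on parameters of a compactly supported smooth kernel. -/
lemma contDiff_integral_unitInterval {g : E → ℝ → ℝ} (hg : ContDiff ℝ ∞ ↿g) :
    ContDiff ℝ ∞ fun y => ∫ t in (0 : ℝ)..1, g y t := by
  -- The cutoff only has to equal `1` on `[-1, 0]`; the radii `2` and `3` leave room for this.
  let χ : ContDiffBump (0 : ℝ) := ⟨2, 3, by norm_num, by norm_num⟩
  let k : E → ℝ → ℝ := fun y s => χ s * g y (-s)
  let f : ℝ → ℝ := (Set.Ioc (0 : ℝ) 1).indicator fun _ => 1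
  have hf : MeasureTheory.LocallyIntegrable f := by
    apply MeasureTheory.Integrable.locallyIntegrable
    rw [MeasureTheory.integrable_indicator_iff measurableSet_Ioc]
    exact MeasureTheory.integrableOn_const (by simp)
  have hk : ContDiffOn ℝ ((⊤ : ℕ∞) : WithTop ℕ∞) ↿k (Set.univ ×ˢ Set.univ) := by
    apply ContDiff.contDiffOn
    have h1 : ContDiff ℝ ∞ fun q : E × ℝ => χ q.2 := χ.contDiff.comp contDiff_snd
    have h2 : ContDiff ℝ ∞ fun q : E × ℝ => g q.1 (-q.2) :=
      hg.comp (contDiff_fst.prodMk contDiff_snd.neg)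
    exact h1.mul h2
  have h := MeasureTheory.contDiffOn_convolution_right_with_param (μ := MeasureTheory.volume)
    (ContinuousLinearMap.mul ℝ ℝ) isOpen_univ (isCompact_closedBall (0 : ℝ) 3)
    (fun p x _ hx => ?_) hf hk
  · have h3 : ContDiff ℝ ∞ fun q : E × ℝ =>
        (MeasureTheory.convolution f (k q.1) (ContinuousLinearMap.mul ℝ ℝ) MeasureTheory.volume) q.2 := by
      rw [← contDiffOn_univ, ← Set.univ_prod_univ]
      exact h
    have h4 := h3.comp (contDiff_id.prodMk (contDiff_const (c := (0 : ℝ))) :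
      ContDiff ℝ ∞ fun y : E => (y, (0 : ℝ)))
    convert h4 using 2 with y
    rw [intervalIntegral.integral_of_le zero_le_one, ← MeasureTheory.integral_indicator
      measurableSet_Ioc]
    simp only [Function.comp, MeasureTheory.convolution]
    refine MeasureTheory.integral_congr_ae (Filter.Eventually.of_forall fun t => ?_)
    by_cases ht : t ∈ Set.Ioc (0 : ℝ) 1
    · have h5 : χ (0 - t) = 1 := χ.one_of_mem_closedBall (by
        rw [mem_closedBall_zero_iff, zero_sub, norm_neg, Real.norm_eq_abs, abs_of_pos ht.1]
        exact ht.2.trans (by norm_num [χ]))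
      simp [f, k, ht]
      simp [← zero_sub, h5]
    · simp [f, ht]
  · have : χ x = 0 := χ.zero_of_le_dist (by
      rw [Metric.mem_closedBall, not_le] at hx
      exact hx.le)
    simp [k, this]

/-- Hadamard's lemma. -/
lemma exists_hadamard {κ : Type*} [Fintype κ] (b : Module.Basis κ ℝ E) {F : E → ℝ}
    (hF : ContDiff ℝ ∞ F) (y₀ : E) :
    ∃ G : κ → E → ℝ, (∀ a, ContDiff ℝ ∞ (G a)) ∧ (∀ a, G a y₀ = fderiv ℝ F y₀ (b a)) ∧
      ∀ y, F y - F y₀ = ∑ a, b.repr (y - y₀) a * G a y := by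
  have h1 : ∀ a, ContDiff ℝ ∞ ↿(fun (y : E) (t : ℝ) => fderiv ℝ F (y₀ + t • (y - y₀)) (b a)) := by
    intro a
    have h2 : ContDiff ℝ ∞ (fderiv ℝ F) := hF.fderiv_right (by simp)
    have h3 : ContDiff ℝ ∞ fun q : E × ℝ => y₀ + q.2 • (q.1 - y₀) :=
      contDiff_const.add (contDiff_snd.smul (contDiff_fst.sub contDiff_const))
    exact (h2.comp h3).clm_apply contDiff_const
  -- The fundamental theorem of calculus along the segment from `y₀` to `y`; at `y = y₀` the
  -- integrand is constant.
  refine ⟨fun a y => ∫ t in (0 : ℝ)..1, fderiv ℝ F (y₀ + t • (y - y₀)) (b a),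
    fun a => contDiff_integral_unitInterval (h1 a), fun a => by simp, fun y => ?_⟩
  have hc : ∀ a, Continuous fun t : ℝ => fderiv ℝ F (y₀ + t • (y - y₀)) (b a) := fun a =>
    (h1 a).continuous.comp (continuous_const.prodMk continuous_id)
  have h4 : ∀ t : ℝ, HasDerivAt (fun t : ℝ => F (y₀ + t • (y - y₀)))
      (∑ a, b.repr (y - y₀) a * fderiv ℝ F (y₀ + t • (y - y₀)) (b a)) t := by
    intro t
    have h5 : HasDerivAt (fun t : ℝ => y₀ + t • (y - y₀)) (y - y₀) t := by
      simpa using ((hasDerivAt_id t).smul_const (y - y₀)).const_add y₀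
    have h6 := (hF.differentiable (by simp) (y₀ + t • (y - y₀))).hasFDerivAt.comp_hasDerivAt t h5
    have h8 : fderiv ℝ F (y₀ + t • (y - y₀)) (y - y₀) =
        ∑ a, b.repr (y - y₀) a * fderiv ℝ F (y₀ + t • (y - y₀)) (b a) := by
      conv_lhs => arg 2; rw [← b.sum_repr (y - y₀)]
      rw [map_sum]
      simp
    rw [← h8]
    exact h6
  have h7 := intervalIntegral.integral_eq_sub_of_hasDerivAt (a := 0) (b := 1)
    (fun t _ => h4 t) (Continuous.intervalIntegrable
      (continuous_finsetSum _ fun a _ => continuous_const.mul (hc a)) _ _)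
  simp only [one_smul, zero_smul, add_zero, add_sub_cancel] at h7
  have h9 : ∀ a, Continuous fun t : ℝ =>
      b.repr (y - y₀) a * fderiv ℝ F (y₀ + t • (y - y₀)) (b a) := fun a =>
    continuous_const.mul (hc a)
  rw [← h7, intervalIntegral.integral_finsetSum fun a _ => (h9 a).intervalIntegrable _ _]
  simp

end Hadamard

/-! ### Differentials of functions and derivations given by vector fields -/

section Differential

variable {E : Type*} [NormedAddCommGroup E] [NormedSpace ℝ E]
variable {M : Type*} [TopologicalSpace M] [ChartedSpace E M]

lemma hasMFDerivAt_diffAt (f : Fun E M) (x : M) :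
    HasMFDerivAt 𝓘(ℝ, E) 𝓘(ℝ, ℝ) f x (diffAt f x) :=
  (f.contMDiff.mdifferentiableAt (by simp)).hasMFDerivAt

lemma diffAt_add (f g : Fun E M) (x : M) : diffAt (f + g) x = diffAt f x + diffAt g x :=
  ((hasMFDerivAt_diffAt f x).add (hasMFDerivAt_diffAt g x)).mfderiv

lemma diffAt_smul (r : ℝ) (f : Fun E M) (x : M) : diffAt (r • f) x = r • diffAt f x :=
  ((hasMFDerivAt_diffAt f x).const_smul r).mfderiv

lemma diffAt_mul (f g : Fun E M) (x : M) :
    diffAt (f * g) x = f x • diffAt g x + g x • diffAt f x :=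
  ((hasMFDerivAt_diffAt f x).mul (hasMFDerivAt_diffAt g x)).mfderiv

lemma diffAt_congr {f g : Fun E M} {x : M} (h : ∀ᶠ y in 𝓝 x, f y = g y) :
    diffAt f x = diffAt g x :=
  Filter.EventuallyEq.mfderiv_eq h

lemma diffAt_algebraMap (r : ℝ) (x : M) : diffAt (algebraMap ℝ (Fun E M) r) x = 0 :=
  (hasMFDerivAt_const r x).mfderiv

/-- Smooth vector fields. -/
abbrev VectorFields (E : Type*) [NormedAddCommGroup E] [NormedSpace ℝ E] (M : Type*)
    [TopologicalSpace M] [ChartedSpace E M] [IsManifold 𝓘(ℝ, E) ∞ M] :=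
  Cₛ^∞⟮𝓘(ℝ, E); E, (TangentSpace 𝓘(ℝ, E) : M → Type _)⟯

variable [IsManifold 𝓘(ℝ, E) ∞ M]

lemma contMDiff_diffAt_apply (f : Fun E M) (v : VectorFields E M) :
    ContMDiff 𝓘(ℝ, E) 𝓘(ℝ, ℝ) ∞ fun x => diffAt f x (v x) := by
  have h1 : ContMDiff 𝓘(ℝ, E).tangent 𝓘(ℝ, ℝ).tangent ∞ (tangentMap 𝓘(ℝ, E) 𝓘(ℝ, ℝ) f) :=
    f.contMDiff.contMDiff_tangentMap (by simp)
  have h2 := h1.comp v.contMDiff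
  exact (contMDiff_snd_tangentBundle_modelSpace ℝ 𝓘(ℝ, ℝ)).comp h2

/-- The derivation of the algebra of functions defined by a vector field. -/
def lieD (v : VectorFields E M) : Derivation ℝ (Fun E M) (Fun E M) :=
  Derivation.mk'
    { toFun := fun f => ⟨fun x => diffAt f x (v x), contMDiff_diffAt_apply f v⟩
      map_add' := fun f g => by
        ext x
        exact congrArg (fun l : Cotangent E x => l (v x)) (diffAt_add f g x)
      map_smul' := fun r f => by
        ext x
        exact congrArg (fun l : Cotangent E x => l (v x)) (diffAt_smul r f x) }
    fun f g => by
      ext x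
      exact congrArg (fun l : Cotangent E x => l (v x)) (diffAt_mul f g x)

end Differential

/-! ### Local coordinates, extended to global functions and fields -/

section Coordinates

variable {E : Type*} [NormedAddCommGroup E] [NormedSpace ℝ E] [FiniteDimensional ℝ E]
variable {M : Type*} [TopologicalSpace M] [ChartedSpace E M] [IsManifold 𝓘(ℝ, E) ∞ M]

section Bump

variable [T2Space M]

/-- A smooth function of the coordinates at `p`, cut off by a bump function. -/
def cutoff {p : M} (ψ : SmoothBumpFunction 𝓘(ℝ, E) p) (g : E → ℝ) (hg : ContDiff ℝ ∞ g) : Fun E M :=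
  ⟨fun x => ψ x • g (extChartAt 𝓘(ℝ, E) p x), ψ.contMDiff_smul (by
    have h := (contMDiffOn_extChartAt (I := 𝓘(ℝ, E)) (n := ∞) (x := p))
    exact hg.contMDiff.comp_contMDiffOn h)⟩

lemma cutoff_apply {p : M} (ψ : SmoothBumpFunction 𝓘(ℝ, E) p) (g : E → ℝ) (hg : ContDiff ℝ ∞ g)
    (x : M) : cutoff ψ g hg x = ψ x * g (extChartAt 𝓘(ℝ, E) p x) := rfl

/-- Forms are by definition locally restrictions of families built from global functions.
Multiplication by a bump function supported in `U` gives every germ of a smooth function such an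
extension. -/
lemma exists_extend_fun {U : Opens M} (f : C^∞⟮𝓘(ℝ, E), U; ℝ⟯) (p : U) :
    ∃ F : Fun E M, ∀ᶠ x in 𝓝 p, F x.1 = f x := by
  classical
  obtain ⟨ψ, hψ⟩ : ∃ ψ : SmoothBumpFunction 𝓘(ℝ, E) p.1, tsupport ψ ⊆ U := by
    obtain ⟨ψ, -, h⟩ := (SmoothBumpFunction.nhds_basis_tsupport (I := 𝓘(ℝ, E)) p.1).mem_iff.1
      (U.isOpen.mem_nhds p.2)
    exact ⟨ψ, h⟩
  let g : M → ℝ := fun x => if h : x ∈ U then f ⟨x, h⟩ else 0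
  have hg : ∀ x ∈ U, ContMDiffAt 𝓘(ℝ, E) 𝓘(ℝ, ℝ) ∞ g x := by
    intro x hx
    have h1 : ContMDiffAt 𝓘(ℝ, E) 𝓘(ℝ, ℝ) ∞ (fun y : U => g y) ⟨x, hx⟩ := by
      have h2 : (fun y : U => g y) = f := by
        funext y
        simp [g, y.2]
      rw [h2]
      exact f.contMDiff.contMDiffAt
    exact contMDiffAt_subtype_iff.1 h1
  refine ⟨⟨fun x => ψ x • g x, contMDiff_of_tsupport fun x hx => ?_⟩, ?_⟩
  · exact ψ.contMDiffAt.smul (hg x (hψ (tsupport_smul_subset_left _ _ hx)))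
  · have h3 : ∀ᶠ x : U in 𝓝 p, ψ x.1 = 1 :=
      (continuous_subtype_val.tendsto p).eventually ψ.eventuallyEq_one
    filter_upwards [h3] with x hx
    change ψ x.1 • g x.1 = f x
    rw [hx]
    simp [g]

/-- In a chart, Hadamard's lemma writes the function as a sum of products of two functions vanishing
at the point, the second factors vanishing because the differential does. Bump functions make the
factors global. This is the input for all Taylor expansions on the manifold. -/
lemma mem_sq_of_diffAt_eq_zero {f : Fun E M} {x : M} (h0 : f x = 0) (h1 : diffAt f x = 0) :
    f ∈ RingHom.ker (evalAt (E := E) x) ^ 2 := by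
  obtain ⟨ψ, -, -⟩ := (SmoothBumpFunction.nhds_basis_tsupport (I := 𝓘(ℝ, E)) x).mem_iff.1
    Filter.univ_mem
  let φ := extChartAt 𝓘(ℝ, E) x
  let F : E → ℝ := fun y => ψ.toContDiffBump y * f (φ.symm y)
  have hball : Metric.closedBall (φ x) ψ.rOut ⊆ φ.target := by
    simpa [φ] using ψ.closedBall_subset
  have hF : ContDiff ℝ ∞ F := by
    rw [← contMDiff_iff_contDiff]
    refine contMDiff_of_tsupport fun y hy => ?_
    have hy' : y ∈ φ.target := hball (by
      rw [← ψ.toContDiffBump.tsupport_eq]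
      exact tsupport_mul_subset_left hy)
    have h2 : ContMDiffAt 𝓘(ℝ, E) 𝓘(ℝ, E) ∞ φ.symm y :=
      (contMDiffOn_extChartAt_symm x).contMDiffAt
        ((isOpen_extChartAt_target x).mem_nhds hy')
    exact ψ.toContDiffBump.contDiff.contMDiff.contMDiffAt.mul
      (f.contMDiff.contMDiffAt.comp y h2)
  have hsymm : φ.symm (φ x) = x := extChartAt_to_inv x
  have hd : fderiv ℝ F (φ x) = 0 := by
    have h2 : HasMFDerivAt 𝓘(ℝ, E) 𝓘(ℝ, ℝ) f (φ.symm (φ x)) (0 : TangentSpace 𝓘(ℝ, E) _ →L[ℝ] ℝ) := by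
      rw [hsymm]
      have := hasMFDerivAt_diffAt f x
      rwa [h1] at this
    have h3 : MDifferentiableAt 𝓘(ℝ, E) 𝓘(ℝ, E) φ.symm (φ x) :=
      ((contMDiffOn_extChartAt_symm (n := ∞) x).contMDiffAt
        ((isOpen_extChartAt_target x).mem_nhds (mem_extChartAt_target x))).mdifferentiableAt (by simp)
    have h4 := h2.comp (φ x) h3.hasMFDerivAt
    have h5 : HasFDerivAt (f ∘ φ.symm) (0 : E →L[ℝ] ℝ) (φ x) := by
      exact h4.hasFDerivAt.congr_fderiv (ContinuousLinearMap.zero_comp _)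
    have h6 : F =ᶠ[𝓝 (φ x)] f ∘ φ.symm := by
      filter_upwards [ψ.toContDiffBump.eventuallyEq_one] with y hy
      simp only [F, hy, Pi.one_apply, one_mul, Function.comp]
    exact (h5.congr_of_eventuallyEq h6).fderiv
  have hF0 : F (φ x) = 0 := by simp only [F, hsymm, h0, mul_zero]
  let b := Module.finBasis ℝ E
  obtain ⟨G, hG, hG0, hFG⟩ := exists_hadamard b hF (φ x)
  have hlin : ∀ a, ContDiff ℝ ∞ fun y => b.repr (y - φ x) a := fun a =>
    (LinearMap.toContinuousLinearMap (b.coord a)).contDiff.comp (contDiff_id.sub contDiff_const)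
  let Ψ : Fun E M := ⟨ψ, ψ.contMDiff⟩
  have hΨ : 1 - Ψ ^ 3 ∈ RingHom.ker (evalAt (E := E) x) := by
    rw [RingHom.mem_ker, map_sub, map_one, map_pow]
    have : evalAt x Ψ = 1 := ψ.eq_one
    rw [this]
    norm_num
  -- Each of the two cutoffs carries one factor `ψ` and `F` carries a third, whence `ψ ^ 3`. The
  -- remainder `(1 - ψ ^ 3) * f` is again a product of two functions vanishing at `x`.
  have hdec : f = ∑ a, cutoff ψ _ (hlin a) * cutoff ψ _ (hG a) + (1 - Ψ ^ 3) * f := by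
    ext z
    have h7 : (∑ a, cutoff ψ _ (hlin a) * cutoff ψ _ (hG a)) z = ψ z ^ 3 * f z := by
      have h8 : (∑ a, cutoff ψ _ (hlin a) * cutoff ψ _ (hG a)) z =
          ∑ a, cutoff ψ _ (hlin a) z * cutoff ψ _ (hG a) z :=
        map_sum (evalAt (E := E) z) _ _
      rw [h8]
      simp only [cutoff_apply]
      have h9 : ∑ a, ψ z * b.repr (φ z - φ x) a * (ψ z * G a (φ z)) = ψ z ^ 2 * F (φ z) := by
        have := hFG (φ z)
        rw [hF0, sub_zero] at this
        rw [this, Finset.mul_sum]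
        exact Finset.sum_congr rfl fun a _ => by ring
      refine h9.trans ?_
      by_cases hz : z ∈ (chartAt E x).source
      · have h10 : ψ z = ψ.toContDiffBump (φ z) := ψ.eqOn_source hz
        have h11 : φ.symm (φ z) = z := φ.left_inv (by simpa [φ] using hz)
        simp only [F, h11, ← h10]
        ring
      · have h10 : ψ z = 0 := by
          by_contra h
          exact hz (ψ.support_subset_source h)
        rw [h10]
        ring
    change f z = (∑ a, cutoff ψ _ (hlin a) * cutoff ψ _ (hG a)) z + (1 - ψ z ^ 3) * f z
    rw [h7]
    ring
  rw [hdec, pow_two]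
  refine add_mem (sum_mem fun a _ => Ideal.mul_mem_mul ?_ ?_) (Ideal.mul_mem_mul hΨ h0)
  · change ψ x * b.repr (φ x - φ x) a = 0
    simp
  · change ψ x * G a (φ x) = 0
    rw [hG0, hd]
    simp

end Bump

variable (E M) in
/-- Smooth functions and vector fields that restrict to coordinates and their coordinate vector
fields on an open set. -/
structure Coords where
  X : Fin (Module.finrank ℝ E) → Fun E M
  v : Fin (Module.finrank ℝ E) → VectorFields E M
  dom : Opens M
  dual : ∀ x ∈ dom, ∀ a b, diffAt (X a) x (v b x) = if a = b then 1 else 0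

/-- Chart coordinates and the coordinate frame are multiplied by a bump function `ψ`. The domain is
the interior of `{ψ = 1}`, where the cutoff does not affect differentials. -/
lemma exists_coords [T2Space M] (p : M) : ∃ c : Coords E M, p ∈ c.dom := by
  classical
  obtain ⟨ψ, -, -⟩ := (SmoothBumpFunction.nhds_basis_tsupport (I := 𝓘(ℝ, E)) p).mem_iff.1
    Filter.univ_mem
  let φ := extChartAt 𝓘(ℝ, E) p
  let b := Module.finBasis ℝ E
  let e := trivializationAt E (TangentSpace 𝓘(ℝ, E) : M → Type _) p
  have hlin : ∀ a, ContDiff ℝ ∞ fun y => b.repr y a := fun a =>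
    (LinearMap.toContinuousLinearMap (b.coord a)).contDiff
  have hbase : e.baseSet = (chartAt E p).source := rfl
  have hv : ∀ a, ContMDiff 𝓘(ℝ, E) 𝓘(ℝ, E).tangent ∞
      fun x => Bundle.TotalSpace.mk' E x ((ψ : M → ℝ) x • e.localFrame b a x) := fun a =>
    ψ.contMDiff.contMDiffOn.smul_section_of_tsupport e.open_baseSet
      (hbase ▸ ψ.tsupport_subset_chartAt_source) (e.contMDiffOn_localFrame_baseSet ∞ b a)
  refine ⟨⟨fun a => cutoff ψ _ (hlin a), fun a => ⟨fun x => ψ x • e.localFrame b a x, hv a⟩,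
    ⟨{x | ∀ᶠ y in 𝓝 x, ψ y = 1}, isOpen_setOfPred_eventually_nhds⟩, ?_⟩, ψ.eventuallyEq_one⟩
  intro x hx a c
  have hx1 : ψ x = 1 := hx.self_of_nhds
  have hxs : x ∈ (chartAt E p).source := ψ.support_subset_source (by
    rw [Function.mem_support, hx1]; exact one_ne_zero)
  have hφ : MDifferentiableAt 𝓘(ℝ, E) 𝓘(ℝ, E) φ x := mdifferentiableAt_extChartAt hxs
  let L : E →L[ℝ] ℝ := LinearMap.toContinuousLinearMap (b.coord a)
  have h1 : HasMFDerivAt 𝓘(ℝ, E) 𝓘(ℝ, ℝ) (L ∘ φ) x (L.comp (mfderiv 𝓘(ℝ, E) 𝓘(ℝ, E) φ x)) :=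
    (L.hasFDerivAt.hasMFDerivAt).comp x hφ.hasMFDerivAt
  have h2 : diffAt (cutoff ψ _ (hlin a)) x = L.comp (mfderiv 𝓘(ℝ, E) 𝓘(ℝ, E) φ x) := by
    refine (h1.congr_of_eventuallyEq ?_).mfderiv
    filter_upwards [hx] with y hy
    rw [cutoff_apply, hy, one_mul]
    rfl
  have h3 : mfderiv 𝓘(ℝ, E) 𝓘(ℝ, E) φ x = e.continuousLinearMapAt ℝ x :=
    (TangentBundle.continuousLinearMapAt_trivializationAt hxs).symm
  rw [h2, h3]
  change L (e.continuousLinearMapAt ℝ x (ψ x • e.localFrame b c x)) = _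
  have hxe : x ∈ e.baseSet := hxs
  rw [hx1, one_smul, e.localFrame_apply_of_mem_baseSet b hxe]
  have h4 : e.continuousLinearMapAt ℝ x (e.basisAt b hxe c) = b c := by
    simp [Bundle.Trivialization.basisAt, hxe]
  rw [h4]
  simp [L, Finsupp.single_apply, eq_comm]

namespace Coords

variable (c : Coords E M) {x : M}

/-- The coordinate derivations. -/
def D (a : Fin (Module.finrank ℝ E)) : Derivation ℝ (Fun E M) (Fun E M) := lieD (c.v a)

lemma D_apply (a : Fin (Module.finrank ℝ E)) (f : Fun E M) (x : M) :
    c.D a f x = diffAt f x (c.v a x) := rfl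

/-- The coordinates vanishing at `x`. -/
def X₀ (x : M) (a : Fin (Module.finrank ℝ E)) : Fun E M := c.X a - algebraMap ℝ _ (c.X a x)

variable {c}

lemma linearIndependent (hx : x ∈ c.dom) :
    LinearIndependent ℝ fun a => (c.v a x : TangentSpace 𝓘(ℝ, E) x) := by
  rw [Fintype.linearIndependent_iff]
  intro g hg a
  have h := congrArg (diffAt (c.X a) x) hg
  rw [map_sum, map_zero] at h
  simpa [c.dual x hx] using h

/-- The frame of coordinate vector fields. -/
def basis (hx : x ∈ c.dom) :
    Module.Basis (Fin (Module.finrank ℝ E)) ℝ (TangentSpace 𝓘(ℝ, E) x) :=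
  .mk (linearIndependent hx) ((linearIndependent hx).span_eq_top_of_card_eq_finrank' (by
    rw [Fintype.card_fin]; rfl)).ge

lemma sum_v (hx : x ∈ c.dom) (w : TangentSpace 𝓘(ℝ, E) x) :
    ∑ a, diffAt (c.X a) x w • c.v a x = w := by
  have h0 : ∀ a, basis hx a = c.v a x := fun a => by simp [basis]
  have h1 := (basis hx).sum_repr w
  simp only [h0] at h1
  have h2 : ∀ a, diffAt (c.X a) x w = (basis hx).repr w a := fun a => by
    conv_lhs => rw [← h1]
    rw [map_sum]
    simp [c.dual x hx]
  simp only [h2, h1]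

lemma sum_dX (hx : x ∈ c.dom) (ξ : Cotangent E x) :
    ∑ a, ξ (c.v a x) • diffAt (c.X a) x = ξ := by
  ext w
  conv_rhs => rw [← sum_v hx w]
  rw [map_sum, sum_apply]
  refine Finset.sum_congr rfl fun a _ => ?_
  rw [smul_apply, map_smul, smul_eq_mul, smul_eq_mul, mul_comm]

lemma diffAt_X₀ (a : Fin (Module.finrank ℝ E)) : diffAt (c.X₀ x a) x = diffAt (c.X a) x := by
  have h : c.X a = c.X₀ x a + algebraMap ℝ _ (c.X a x) := by simp [X₀]
  conv_rhs => rw [h]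
  rw [diffAt_add, diffAt_algebraMap, add_zero]

variable [T2Space M]

/-- The remainder of the first-order expansion vanishes at `x` together with its differential, hence
lies in `𝔪ₓ²`. -/
lemma isFrame (hx : x ∈ c.dom) : IsFrame (evalAt x) (c.X₀ x) c.D where
  mem a := sub_algebraMap_mem_ker (evalAt x) (c.X a)
  expand h hh := by
    have h2 : (-∑ a, evalAt x (c.D a h) • c.X₀ x a) =
        ∑ a, (-evalAt x (c.D a h)) • c.X₀ x a := by simp
    refine mem_sq_of_diffAt_eq_zero ?_ ?_
    · have h3 : evalAt (E := E) x h = 0 := hh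
      have h4 : evalAt (E := E) x (h - ∑ a, evalAt x (c.D a h) • c.X₀ x a) = 0 := ?_
      · exact h4
      rw [map_sub, map_sum, h3, zero_sub, neg_eq_zero]
      refine Finset.sum_eq_zero fun a _ => ?_
      have : evalAt x (c.X₀ x a) = 0 := sub_algebraMap_mem_ker (evalAt x) (c.X a)
      rw [map_smul, this, smul_zero]
    · have h3 : ∀ (s : Finset (Fin (Module.finrank ℝ E))) (g : Fin (Module.finrank ℝ E) → ℝ),
          diffAt (∑ a ∈ s, g a • c.X₀ x a) x = ∑ a ∈ s, g a • diffAt (c.X a) x := by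
        intro s g
        induction s using Finset.cons_induction with
        | empty =>
          simp only [Finset.sum_empty]
          simpa using diffAt_algebraMap (E := E) 0 x
        | cons a s ha ih => rw [Finset.sum_cons, Finset.sum_cons, diffAt_add, diffAt_smul, diffAt_X₀, ih]
      rw [sub_eq_add_neg, h2, diffAt_add, h3]
      conv_lhs => arg 1; rw [← sum_dX hx (diffAt h x)]
      rw [← Finset.sum_add_distrib]
      refine Finset.sum_eq_zero fun a _ => ?_
      exact (congrArg _ (neg_smul _ _)).trans (add_neg_cancel _)

/-- The commutator is a derivation, and a derivation at `x` is determined by its values on the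
coordinates. There it vanishes, because the first derivatives of the coordinates are locally
constant. -/
lemma D_comm (hx : x ∈ c.dom) (a b : Fin (Module.finrank ℝ E)) (f : Fun E M) :
    c.D a (c.D b f) x = c.D b (c.D a f) x := by
  let K : Derivation ℝ (Fun E M) (Fun E M) := ⁅c.D a, c.D b⁆
  have hK : ∀ f, K f x = c.D a (c.D b f) x - c.D b (c.D a f) x := fun f => by
    simp only [K, Derivation.commutator_apply]
    rfl
  have hX : ∀ a b d, c.D a (c.D b (c.X d)) x = 0 := by
    intro a b d
    have h1 : diffAt (c.D b (c.X d)) x = 0 := by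
      rw [← diffAt_algebraMap (E := E) (if d = b then 1 else 0) x]
      refine diffAt_congr ?_
      filter_upwards [c.dom.isOpen.mem_nhds hx] with y hy
      exact c.dual y hy d b
    rw [D_apply, h1]
    rfl
  have h1 : K f x = 0 := by
    have h2 := (isFrame hx).expand _ (sub_algebraMap_mem_ker (evalAt x) f)
    have h3 := derivation_mem_pow _ K h2
    rw [pow_one, RingHom.mem_ker] at h3
    have h4 : ∀ d, evalAt x (K (c.X₀ x d)) = 0 := fun d => by
      rw [X₀, map_sub, Derivation.map_algebraMap, sub_zero]
      exact (hK _).trans (by rw [hX, hX, sub_zero])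
    have h5 : evalAt (E := E) x (K f) = 0 := by simpa [map_sub, map_sum, h4] using h3
    exact h5
  rw [hK] at h1
  exact sub_eq_zero.1 h1

end Coords

end Coordinates


/-! ### Smooth sections, polynomial families and fibrewise operators -/

section Sections

variable {E : Type*} [NormedAddCommGroup E] [NormedSpace ℝ E]
variable {M : Type*} [TopologicalSpace M] [ChartedSpace E M]
variable {A : AugFamily M} {U W : Opens M}

@[ext]
lemma CoeffForms.ext {s t : CoeffForms E A U} (h : ∀ x, s.1 x = t.1 x) : s = t :=
  Subtype.ext (funext h)

/-- The product of the differentials of a list of functions. -/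
def wedge (l : List (Fun E M)) (x : M) : FormFibre E x :=
  (l.map fun f => ExteriorAlgebra.ι ℝ (diffAt f x)).prod

lemma wedge_nil (x : M) : wedge (E := E) [] x = 1 := rfl

lemma wedge_cons (f : Fun E M) (l : List (Fun E M)) (x : M) :
    wedge (f :: l) x = ExteriorAlgebra.ι ℝ (diffAt f x) * wedge l x := rfl

lemma wedge_append (l m : List (Fun E M)) (x : M) :
    wedge (l ++ m) x = wedge l x * wedge m x := by
  simp [wedge]

lemma wedge_mem (l : List (Fun E M)) (x : M) :
    wedge l x ∈ ⋀[ℝ]^l.length (Cotangent E x) := by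
  induction l with
  | nil => exact SetLike.one_mem_graded (fun i : ℕ => ⋀[ℝ]^i (Cotangent E x))
  | cons f l ih =>
    rw [wedge_cons, List.length_cons, exteriorPower_succ]
    exact Submodule.mul_mem_mul ⟨_, rfl⟩ ih

variable (E M) in
/-- Finite sums of forms `a df₁ ∧ ⋯ ∧ df_q`. -/
abbrev polyForms : Subalgebra ℝ (∀ x : M, FormFibre E x) := Algebra.adjoin ℝ (formGenerators E M)

lemma fun_mem_polyForms (a : Fun E M) :
    (fun x => algebraMap ℝ (FormFibre E x) (a x)) ∈ polyForms E M :=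
  Algebra.subset_adjoin (Or.inl ⟨a, rfl⟩)

lemma ι_mem_polyForms (f : Fun E M) :
    (fun x => ExteriorAlgebra.ι ℝ (diffAt f x)) ∈ polyForms E M :=
  Algebra.subset_adjoin (Or.inr ⟨f, rfl⟩)

lemma wedge_mem_polyForms (l : List (Fun E M)) : wedge l ∈ polyForms E M := by
  induction l with
  | nil => exact one_mem _
  | cons f l ih => exact mul_mem (ι_mem_polyForms f) ih

lemma smul_mem_polyForms (a : Fun E M) {t : ∀ x : M, FormFibre E x} (ht : t ∈ polyForms E M) :
    (fun x => a x • t x) ∈ polyForms E M := by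
  convert mul_mem (fun_mem_polyForms a) ht using 1
  funext x
  exact Algebra.smul_def _ _

lemma polyForms_induction {P : (∀ x : M, FormFibre E x) → Prop}
    (hm : ∀ (a : Fun E M) (l : List (Fun E M)), P fun x => a x • wedge l x)
    (ha : ∀ s t, P s → P t → P (s + t))
    {t : ∀ x : M, FormFibre E x} (ht : t ∈ polyForms E M) : P t := by
  let S : Set (∀ x : M, FormFibre E x) := {t | ∃ (a : Fun E M) (l : List (Fun E M)),
    t = fun x => a x • wedge l x}
  have h : ∀ t ∈ Algebra.adjoin ℝ (formGenerators E M), t ∈ Submodule.span ℝ S := by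
    intro t ht
    induction ht using Algebra.adjoin_induction with
    | mem t ht =>
      apply Submodule.subset_span
      rcases ht with ⟨a, rfl⟩ | ⟨f, rfl⟩
      · exact ⟨a, [], funext fun x => Algebra.algebraMap_eq_smul_one _⟩
      · refine ⟨1, [f], funext fun x => ?_⟩
        change _ = (1 : ℝ) • (ExteriorAlgebra.ι ℝ (diffAt f x) * 1)
        rw [one_smul, mul_one]
    | algebraMap r =>
      apply Submodule.subset_span
      exact ⟨algebraMap ℝ _ r, [], funext fun x => Algebra.algebraMap_eq_smul_one r⟩
    | add s t _ _ hs ht => exact add_mem hs ht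
    | mul s t _ _ hs ht =>
      have := Submodule.mul_mem_mul hs ht
      rw [Submodule.span_mul_span] at this
      refine Submodule.span_mono ?_ this
      rintro _ ⟨_, ⟨a, l, rfl⟩, _, ⟨b, m, rfl⟩, rfl⟩
      refine ⟨a * b, l ++ m, funext fun x => ?_⟩
      change a x • wedge l x * b x • wedge m x = (a x * b x) • wedge (l ++ m) x
      rw [wedge_append, smul_mul_smul_comm]
  refine Submodule.closure_induction (p := fun t _ => P t) ?_ (fun s t _ _ => ha s t) ?_ (h t ht)
  · convert hm 0 [] using 1
    funext x
    exact (zero_smul ℝ _).symm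
  · rintro r _ ⟨a, l, rfl⟩
    convert hm (r • a) l using 1
    funext x
    exact smul_smul r (a x) (wedge l x)

/-- Induction on polynomial sections by means of monomials. -/
lemma polySections_induction {P : (∀ x : M, FormFibre E x ⊗[ℝ] A.Alg x) → Prop}
    (hm : ∀ (a : Fun E M) (l : List (Fun E M)) (g : List A.gens),
      P fun x => (a x • wedge l x) ⊗ₜ (g.map fun u => u.1 x).prod)
    (ha : ∀ s t, P s → P t → P (s + t))
    {t : ∀ x : M, FormFibre E x ⊗[ℝ] A.Alg x} (ht : t ∈ polySections E A) : P t := by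
  let S : Set (∀ x : M, FormFibre E x ⊗[ℝ] A.Alg x) := {t | ∃ w ∈ polyForms E M,
    ∃ g : List A.gens, t = fun x => w x ⊗ₜ (g.map fun u => u.1 x).prod}
  have h : ∀ t ∈ polySections E A, t ∈ Submodule.span ℝ S := by
    intro t ht
    induction ht using Algebra.adjoin_induction with
    | mem t ht =>
      apply Submodule.subset_span
      rcases ht with ⟨w, hw, rfl⟩ | ⟨g, hg, rfl⟩
      · exact ⟨w, Algebra.subset_adjoin hw, [], rfl⟩
      · exact ⟨1, one_mem _, [⟨g, hg⟩], funext fun x => by simp⟩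
    | algebraMap r =>
      apply Submodule.subset_span
      exact ⟨algebraMap ℝ _ r, Subalgebra.algebraMap_mem _ r, [], rfl⟩
    | add s t _ _ hs ht => exact add_mem hs ht
    | mul s t _ _ hs ht =>
      have := Submodule.mul_mem_mul hs ht
      rw [Submodule.span_mul_span] at this
      refine Submodule.span_mono ?_ this
      rintro _ ⟨_, ⟨a, ha, l, rfl⟩, _, ⟨b, hb, m, rfl⟩, rfl⟩
      refine ⟨a * b, mul_mem ha hb, l ++ m, funext fun x => ?_⟩
      simp
  have hS : ∀ w ∈ polyForms E M, ∀ g : List A.gens,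
      P fun x => w x ⊗ₜ (g.map fun u => u.1 x).prod := by
    intro w hw g
    refine polyForms_induction (P := fun w => P fun x => w x ⊗ₜ (g.map fun u => u.1 x).prod)
      (fun a l => hm a l g) (fun s t hs ht => ?_) hw
    convert ha _ _ hs ht using 1
    funext x
    exact TensorProduct.add_tmul _ _ _
  have key : ∀ t ∈ Submodule.span ℝ S, P t := by
    intro t ht
    refine Submodule.closure_induction (p := fun t _ => P t) ?_ (fun s t _ _ => ha s t) ?_ ht
    · convert hS 0 (zero_mem _) [] using 1
      funext x
      exact (TensorProduct.zero_tmul _ _).symm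
    · rintro r _ ⟨w, hw, g, rfl⟩
      exact hS (r • w) (Subalgebra.smul_mem _ hw r) g
  exact key t (h t ht)

lemma tmul_mem_polySections {w : ∀ x : M, FormFibre E x} (hw : w ∈ polyForms E M)
    (g : List A.gens) :
    (fun x => w x ⊗ₜ (g.map fun u => u.1 x).prod) ∈ polySections E A := by
  have h : (fun x => (1 : FormFibre E x) ⊗ₜ[ℝ] (g.map fun u => u.1 x).prod) ∈
      polySections E A := by
    induction g with
    | nil => exact one_mem _
    | cons u g ih =>
      have hu : (fun x => (1 : FormFibre E x) ⊗ₜ[ℝ] u.1 x) ∈ polySections E A :=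
        Algebra.subset_adjoin (Or.inr ⟨u.1, u.2, rfl⟩)
      convert mul_mem hu ih using 1
      funext x
      simp
  convert mul_mem (tmul_one_mem_polySections E A w hw) h using 1
  funext x
  simp

lemma mem_coeff_iff {s : ∀ x : U, CoeffFibre E A x.1} :
    s ∈ coeffSubalgebra E A U ↔ ∀ (k : ℕ) (p : U), ∃ t ∈ polySections E A,
      ∀ᶠ x in 𝓝 p, s x - emb E A x.1 (t x.1) ∈ fil k x.1 := by
  refine forall₂_congr fun k p => ?_
  simp only [agreeMod_iff]

lemma CoeffForms.approx (s : CoeffForms E A U) (k : ℕ) (p : U) : ∃ t ∈ polySections E A,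
      ∀ᶠ x in 𝓝 p, s.1 x - emb E A x.1 (t x.1) ∈ fil k x.1 := mem_coeff_iff.1 s.2 k p

/-- The section defined by a polynomial family. -/
def ofPoly (t : polySections E A) (U : Opens M) : CoeffForms E A U :=
  ⟨fun x => emb E A x.1 (t.1 x.1), mem_coeff_iff.2 fun k _ =>
    ⟨t.1, t.2, Filter.Eventually.of_forall fun x => by rw [sub_self]; exact zero_mem _⟩⟩

lemma eventually_subtype {p : U} {P : M → Prop} (h : ∀ᶠ x in 𝓝 p.1, P x) :
    ∀ᶠ x : U in 𝓝 p, P x.1 :=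
  (continuous_subtype_val.tendsto p).eventually h

/-- A family that can be approximated locally by smooth sections is smooth. -/
lemma mem_coeff_of_approx {s : ∀ x : U, CoeffFibre E A x.1}
    (h : ∀ (k : ℕ) (p : U), ∃ (W : Opens M) (_ : p.1 ∈ W) (u : CoeffForms E A W),
      ∀ (x : M) (hU : x ∈ U) (hW : x ∈ W), s ⟨x, hU⟩ - u.1 ⟨x, hW⟩ ∈ fil k x) :
    s ∈ coeffSubalgebra E A U := by
  refine mem_coeff_iff.2 fun k p => ?_
  obtain ⟨W, hp, u, hu⟩ := h k p
  obtain ⟨t, ht, h1⟩ := CoeffForms.approx u k ⟨p.1, hp⟩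
  refine ⟨t, ht, ?_⟩
  rw [nhds_subtype_eq_comap, Filter.eventually_comap] at h1 ⊢
  filter_upwards [h1, W.isOpen.mem_nhds hp] with x hx hxW y hy
  subst hy
  have := add_mem (hu y.1 y.2 hxW) (hx ⟨y.1, hxW⟩ rfl)
  rwa [sub_add_sub_cancel] at this

/-- Smoothness is a local property. -/
lemma mem_coeff_of_local {s : ∀ x : U, CoeffFibre E A x.1}
    (h : ∀ p : U, ∃ (W : Opens M) (_ : p.1 ∈ W) (u : CoeffForms E A W),
      ∀ (x : M) (hU : x ∈ U) (hW : x ∈ W), s ⟨x, hU⟩ = u.1 ⟨x, hW⟩) :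
    s ∈ coeffSubalgebra E A U := by
  refine mem_coeff_of_approx fun k p => ?_
  obtain ⟨W, hp, u, hu⟩ := h p
  exact ⟨W, hp, u, fun x hU hW => by rw [hu x hU hW, sub_self]; exact zero_mem _⟩

lemma exists_opens_of_eventually {p : U} {P : U → Prop} (h : ∀ᶠ x in 𝓝 p, P x) :
    ∃ (W : Opens M) (_ : p.1 ∈ W) (hWU : W ≤ U), ∀ x (hx : x ∈ W), P ⟨x, hWU hx⟩ := by
  obtain ⟨S, hS, hSo, hp⟩ := eventually_nhds_iff.1 h
  refine ⟨⟨Subtype.val '' S, U.isOpen.isOpenMap_subtype_val S hSo⟩, ⟨p, hp, rfl⟩, ?_, ?_⟩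
  · rintro _ ⟨y, _, rfl⟩
    exact y.2
  · rintro _ ⟨y, hy, rfl⟩
    exact hS y hy

variable (E M) in
/-- A smooth family of endomorphisms of the exterior algebras. -/
structure FormOp where
  op : ∀ x : M, FormFibre E x →ₗ[ℝ] FormFibre E x
  smooth : ∀ l : List (Fun E M), (fun x => op x (wedge l x)) ∈ polyForms E M

namespace FormOp

variable (T : FormOp E M)

variable (A) in
/-- The action on the fibres. -/
def fib (x : M) : CoeffFibre E A x →ₗ[ℝ] CoeffFibre E A x :=
  TensorProduct.map (T.op x) (LinearMap.id : A.Completed x →ₗ[ℝ] A.Completed x)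

@[simp]
lemma fib_tmul {x : M} (a : FormFibre E x) (b : A.Completed x) :
    T.fib A x (CoeffFibre.tmul a b) = CoeffFibre.tmul (T.op x a) b := rfl

lemma comp_fib {x : M} (μ : Module.Dual ℝ (FormFibre E x)) (z : CoeffFibre E A x) :
    comp μ (T.fib A x z) = comp (μ ∘ₗ T.op x) z :=
  slice_map (B := A.Completed x) μ (T.op x) LinearMap.id z

lemma fib_mem_fil {k : ℕ} {x : M} {z : CoeffFibre E A x} (hz : z ∈ fil k x) :
    T.fib A x z ∈ fil k x :=
  mem_fil_iff.2 fun μ => by rw [comp_fib]; exact mem_fil_iff.1 hz _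

lemma fib_emb {x : M} (t : FormFibre E x ⊗[ℝ] A.Alg x) :
    T.fib A x (emb E A x t) = emb E A x (TensorProduct.map (T.op x) LinearMap.id t) := by
  induction t using TensorProduct.induction_on with
  | zero => simp
  | tmul a b => rfl
  | add y z hy hz => simp only [map_add, hy, hz]

lemma map_mem_polySections {t : ∀ x : M, FormFibre E x ⊗[ℝ] A.Alg x} (ht : t ∈ polySections E A) :
    (fun x => TensorProduct.map (T.op x) LinearMap.id (t x)) ∈ polySections E A := by
  refine polySections_induction
    (P := fun t => (fun x => TensorProduct.map (T.op x) LinearMap.id (t x)) ∈ polySections E A)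
    (fun a l g => ?_) (fun s t hs ht => ?_) ht
  · convert tmul_mem_polySections (smul_mem_polyForms a (T.smooth l)) g using 1
    funext x
    simp
  · convert add_mem hs ht using 1
    funext x
    exact map_add _ _ _

/-- The action on sections. -/
def act : CoeffForms E A U →ₗ[ℝ] CoeffForms E A U where
  toFun s := ⟨fun x => T.fib A x.1 (s.1 x), mem_coeff_iff.2 fun k p => by
    obtain ⟨t, ht, h⟩ := CoeffForms.approx s k p
    refine ⟨_, T.map_mem_polySections ht, ?_⟩
    filter_upwards [h] with x hx
    rw [← fib_emb, ← map_sub]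
    exact T.fib_mem_fil hx⟩
  map_add' s t := CoeffForms.ext fun x => map_add _ _ _
  map_smul' r s := CoeffForms.ext fun x => map_smul (T.fib A x.1) r (s.1 x)

end FormOp

variable (E M) in
/-- The parity automorphism. -/
def parityOp : FormOp E M where
  op x := parity.toLinearMap
  smooth l := by
    have : (fun x => parity.toLinearMap (wedge l x)) =
        fun x => (algebraMap ℝ (FormFibre E x) ((-1) ^ l.length)) * wedge l x := by
      funext x
      rw [AlgHom.toLinearMap_apply, parity_of_mem (wedge_mem l x)]
      simp
    rw [this]
    exact mul_mem (fun_mem_polyForms (algebraMap ℝ _ ((-1) ^ l.length))) (wedge_mem_polyForms l)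

variable (E M) in
/-- Projection to the part of form degree `q`. -/
def degOp (q : ℕ) : FormOp E M where
  op x := degProj q
  smooth l := by
    by_cases h : l.length = q
    · convert wedge_mem_polyForms l using 1
      funext x
      exact degProj_of_mem (h ▸ wedge_mem l x)
    · convert zero_mem (polyForms E M) using 1
      funext x
      exact degProj_of_mem_ne h (wedge_mem l x)

/-- Contraction with a vector field. -/
def contractOp [IsManifold 𝓘(ℝ, E) ∞ M] (v : VectorFields E M) : FormOp E M where
  op x := contract
    { toFun := fun ξ : Cotangent E x => ξ (v x), map_add' := fun _ _ => rfl,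
      map_smul' := fun _ _ => rfl }
  smooth l := by
    induction l with
    | nil =>
      convert zero_mem (polyForms E M) using 1
      funext x
      exact contract_one _
    | cons f l ih =>
      convert sub_mem (smul_mem_polyForms (lieD v f) (wedge_mem_polyForms l))
        (mul_mem (ι_mem_polyForms f) ih) using 1
      funext x
      exact contract_ι_mul _ _ _

section FibreIdentities

variable {x : M}

lemma tmul_add_left (a b : FormFibre E x) (c : A.Completed x) :
    (CoeffFibre.tmul (a + b) c : CoeffFibre E A x) = CoeffFibre.tmul a c + CoeffFibre.tmul b c :=
  TensorProduct.add_tmul _ _ _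

lemma tmul_smul_left (r : ℝ) (a : FormFibre E x) (c : A.Completed x) :
    (CoeffFibre.tmul (r • a) c : CoeffFibre E A x) = r • CoeffFibre.tmul a c := rfl

lemma tmul_zero_left (c : A.Completed x) : (CoeffFibre.tmul 0 c : CoeffFibre E A x) = 0 :=
  TensorProduct.zero_tmul _ _

lemma contract_fib_mul [IsManifold 𝓘(ℝ, E) ∞ M] (v : VectorFields E M) (y z : CoeffFibre E A x) :
    (contractOp v).fib A x (y * z) = (contractOp v).fib A x y * z +
      (parityOp E M).fib A x y * (contractOp v).fib A x z := by
  induction y using coeff_induction with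
  | h0 => simp
  | ha y y' hy hy' => simp only [add_mul, map_add, hy, hy']; abel
  | ht a b =>
    induction z using coeff_induction with
    | h0 => simp
    | ha y y' hy hy' => simp only [mul_add, map_add, hy, hy']; abel
    | ht c d =>
      simp only [tmul_mul_tmul, FormOp.fib_tmul]
      rw [← tmul_add_left]
      exact congrArg (CoeffFibre.tmul · _) (contract_mul _ a c)

lemma degOp_fib_mem (q : ℕ) (z : CoeffFibre E A x) :
    (degOp E M q).fib A x z ∈ CoeffFibre.deg E A x q := by
  induction z using coeff_induction with
  | h0 => rw [map_zero]; exact zero_mem _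
  | ha y z hy hz => rw [map_add]; exact add_mem hy hz
  | ht a b => exact ⟨(⟨degProj q a, degProj_mem q a⟩ : ⋀[ℝ]^q (Cotangent E x)) ⊗ₜ b, rfl⟩

lemma deg_induction {q : ℕ} {P : CoeffFibre E A x → Prop} (h0 : P 0)
    (ht : ∀ a ∈ ⋀[ℝ]^q (Cotangent E x), ∀ b, P (CoeffFibre.tmul a b))
    (ha : ∀ y z, P y → P z → P (y + z)) {z : CoeffFibre E A x}
    (hz : z ∈ CoeffFibre.deg E A x q) : P z := by
  obtain ⟨y, rfl⟩ := hz
  induction y using TensorProduct.induction_on with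
  | zero => exact (map_zero (TensorProduct.map (⋀[ℝ]^q (Cotangent E x)).subtype
      (LinearMap.id : A.Completed x →ₗ[ℝ] A.Completed x))).symm ▸ h0
  | tmul a b => exact ht a a.2 b
  | add y z hy hz => exact (map_add (TensorProduct.map (⋀[ℝ]^q (Cotangent E x)).subtype
      (LinearMap.id : A.Completed x →ₗ[ℝ] A.Completed x)) y z).symm ▸ ha _ _ hy hz

/-- Expresses homogeneity by an equation, which can be verified modulo each power and so passes to
limits. -/
lemma mem_deg_iff {q : ℕ} {z : CoeffFibre E A x} :
    z ∈ CoeffFibre.deg E A x q ↔ (degOp E M q).fib A x z = z := by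
  refine ⟨fun hz => ?_, fun h => h ▸ degOp_fib_mem q z⟩
  refine deg_induction (P := fun z => (degOp E M q).fib A x z = z) (map_zero _)
    (fun a ha b => ?_) (fun y z hy hz => by rw [map_add, hy, hz]) hz
  exact congrArg (CoeffFibre.tmul · b) (degProj_of_mem ha)

lemma tmul_mem_deg {q : ℕ} {a : FormFibre E x} (ha : a ∈ ⋀[ℝ]^q (Cotangent E x))
    (b : A.Completed x) : (CoeffFibre.tmul a b : CoeffFibre E A x) ∈ CoeffFibre.deg E A x q :=
  ⟨(⟨a, ha⟩ : ⋀[ℝ]^q (Cotangent E x)) ⊗ₜ b, rfl⟩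

lemma one_tmul_mem_deg (b : A.Completed x) :
    (CoeffFibre.tmul 1 b : CoeffFibre E A x) ∈ CoeffFibre.deg E A x 0 :=
  tmul_mem_deg (SetLike.one_mem_graded (fun i : ℕ => ⋀[ℝ]^i (Cotangent E x))) b

lemma mem_deg_zero_iff {z : CoeffFibre E A x} :
    z ∈ CoeffFibre.deg E A x 0 ↔ ∃ b, z = CoeffFibre.tmul 1 b := by
  refine ⟨fun hz => ?_, fun ⟨b, hb⟩ => hb ▸ one_tmul_mem_deg b⟩
  refine deg_induction (P := fun z => ∃ b, z = CoeffFibre.tmul 1 b)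
    ⟨0, (TensorProduct.tmul_zero _ _).symm⟩ (fun a ha b => ?_) ?_ hz
  · obtain ⟨r, rfl⟩ := Submodule.mem_one.1 (by simpa using ha)
    refine ⟨r • b, ?_⟩
    rw [Algebra.algebraMap_eq_smul_one]
    exact TensorProduct.smul_tmul _ _ _
  · rintro _ _ ⟨b, rfl⟩ ⟨c, rfl⟩
    exact ⟨b + c, (TensorProduct.tmul_add _ _ _).symm⟩

lemma parity_fib_of_deg {q : ℕ} {z : CoeffFibre E A x} (hz : z ∈ CoeffFibre.deg E A x q) :
    (parityOp E M).fib A x z = (-1) ^ q * z := by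
  refine deg_induction (P := fun z => (parityOp E M).fib A x z = (-1) ^ q * z)
    (by rw [map_zero, mul_zero]) (fun a ha b => ?_)
    (fun y z hy hz => by rw [map_add, hy, hz, mul_add]) hz
  have h : (parityOp E M).op x a = ((-1 : ℝ) ^ q) • a := by
    refine (parity_of_mem ha).trans ?_
    rw [Algebra.smul_def, map_pow, map_neg, map_one]
  rw [FormOp.fib_tmul, h, tmul_smul_left, Algebra.smul_def, map_pow, map_neg, map_one]

lemma mul_mem_deg {q r : ℕ} {y z : CoeffFibre E A x} (hy : y ∈ CoeffFibre.deg E A x q)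
    (hz : z ∈ CoeffFibre.deg E A x r) : y * z ∈ CoeffFibre.deg E A x (q + r) := by
  refine deg_induction (P := fun y => y * z ∈ CoeffFibre.deg E A x (q + r))
    (by rw [zero_mul]; exact zero_mem _) (fun a ha b => ?_)
    (fun y y' h h' => by rw [add_mul]; exact add_mem h h') hy
  refine deg_induction (P := fun z => CoeffFibre.tmul a b * z ∈ CoeffFibre.deg E A x (q + r))
    (by rw [mul_zero]; exact zero_mem _) (fun c hc d => ?_)
    (fun y y' h h' => by rw [mul_add]; exact add_mem h h') hz
  rw [tmul_mul_tmul]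
  exact tmul_mem_deg (SetLike.mul_mem_graded ha hc) _

lemma contract_fib_of_deg_zero [IsManifold 𝓘(ℝ, E) ∞ M] (v : VectorFields E M)
    {z : CoeffFibre E A x} (hz : z ∈ CoeffFibre.deg E A x 0) : (contractOp v).fib A x z = 0 := by
  obtain ⟨b, rfl⟩ := mem_deg_zero_iff.1 hz
  rw [FormOp.fib_tmul]
  exact (congrArg (CoeffFibre.tmul · b) (contract_one _)).trans (tmul_zero_left b)

lemma contract_fib_mem_deg [IsManifold 𝓘(ℝ, E) ∞ M] (v : VectorFields E M) {q : ℕ}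
    {z : CoeffFibre E A x} (hz : z ∈ CoeffFibre.deg E A x (q + 1)) :
    (contractOp v).fib A x z ∈ CoeffFibre.deg E A x q := by
  refine deg_induction (P := fun z => (contractOp v).fib A x z ∈ CoeffFibre.deg E A x q)
    (by rw [map_zero]; exact zero_mem _) (fun a ha b => ?_)
    (fun y z hy hz => by rw [map_add]; exact add_mem hy hz) hz
  rw [FormOp.fib_tmul]
  exact tmul_mem_deg (contract_mem _ ha) b

variable [FiniteDimensional ℝ E]

lemma finrank_cotangent : Module.finrank ℝ (Cotangent E x) = Module.finrank ℝ E := by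
  change Module.finrank ℝ (E →L[ℝ] ℝ) = _
  have h1 : Module.finrank ℝ (E →L[ℝ] ℝ) = Module.finrank ℝ (E →ₗ[ℝ] ℝ) :=
    LinearEquiv.finrank_eq LinearMap.toContinuousLinearMap.symm
  rw [h1]
  exact Subspace.dual_finrank_eq

lemma sum_degOp_fib (z : CoeffFibre E A x) :
    ∑ q ∈ Finset.range (Module.finrank ℝ E + 1), (degOp E M q).fib A x z = z := by
  induction z using coeff_induction with
  | h0 => simp
  | ha y z hy hz => simp only [map_add, Finset.sum_add_distrib, hy, hz]
  | ht a b =>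
    simp only [FormOp.fib_tmul]
    refine (TensorProduct.sum_tmul _ _ _).symm.trans ?_
    exact congrArg (CoeffFibre.tmul · b) (sum_degProj a (by rw [finrank_cotangent]; omega))

/-- The identity `∑ dX_a ∧ ι_a = q` in form degree `q`. It supplies the contribution of forms to the
eigenvalues of `laplacian` and expresses sections of positive degree through the `dX_a`. -/
lemma euler_fib [IsManifold 𝓘(ℝ, E) ∞ M] (c : Coords E M) (hx : x ∈ c.dom) {q : ℕ}
    {z : CoeffFibre E A x} (hz : z ∈ CoeffFibre.deg E A x q) :
    ∑ a, CoeffFibre.tmul (ExteriorAlgebra.ι ℝ (diffAt (c.X a) x)) 1 *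
      (contractOp (c.v a)).fib A x z = (q : ℝ) • z := by
  refine deg_induction (P := fun z => ∑ a, CoeffFibre.tmul (ExteriorAlgebra.ι ℝ
    (diffAt (c.X a) x)) 1 * (contractOp (c.v a)).fib A x z = (q : ℝ) • z) (by simp)
    (fun w hw b => ?_)
    (fun y z hy hz => by simp only [map_add, mul_add, Finset.sum_add_distrib, hy, hz, smul_add]) hz
  simp only [FormOp.fib_tmul, tmul_mul_tmul, one_mul]
  refine (TensorProduct.sum_tmul _ _ _).symm.trans ?_
  exact congrArg (CoeffFibre.tmul · b) (sum_ι_mul_contract _ _ (fun ξ => Coords.sum_dX hx ξ) hw)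

end FibreIdentities

end Sections


/-! ### The differential on families of representatives of jets -/

section JetDifferential

variable {E : Type*} [NormedAddCommGroup E] [NormedSpace ℝ E]
variable {M : Type*} [TopologicalSpace M] [ChartedSpace E M]

lemma Fun.sum_apply {κ : Type*} (s : Finset κ) (f : κ → Fun E M) (x : M) :
    (∑ i ∈ s, f i) x = ∑ i ∈ s, f i x := map_sum (evalAt (E := E) x) f s

lemma ι_mul_eq_parity_mul {V : Type*} [AddCommGroup V] [Module ℝ V] (v : V)
    (w : ExteriorAlgebra ℝ V) :
    ExteriorAlgebra.ι ℝ v * w = parity w * ExteriorAlgebra.ι ℝ v := by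
  induction w using exterior_induction with
  | h0 r => rw [AlgHom.commutes, Algebra.commutes]
  | ha x y hx hy => rw [map_add, mul_add, add_mul, hx, hy]
  | hm u a h =>
    have h1 : ExteriorAlgebra.ι ℝ v * ExteriorAlgebra.ι ℝ u =
        -(ExteriorAlgebra.ι ℝ u * ExteriorAlgebra.ι ℝ v) :=
      eq_neg_of_add_eq_zero_left (ExteriorAlgebra.ι_add_mul_swap v u)
    rw [← mul_assoc, h1, neg_mul, mul_assoc, h, map_mul, parity_ι, neg_mul, neg_mul, mul_assoc]

/-- The pair `(a df₁ ∧ ⋯ ∧ df_q, da ∧ df₁ ∧ ⋯ ∧ df_q)`. -/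
def formPair (a : Fun E M) (l : List (Fun E M)) :
    (∀ x : M, FormFibre E x) × (∀ x : M, FormFibre E x) :=
  (fun x => a x • wedge l x, fun x => ExteriorAlgebra.ι ℝ (diffAt a x) * wedge l x)

lemma formPair_mem (a : Fun E M) (l : List (Fun E M)) : formPair a l ∈ exteriorGraph E M :=
  Submodule.subset_span ⟨a, l, rfl⟩

lemma smul_formPair (r : ℝ) (a : Fun E M) (l : List (Fun E M)) :
    r • formPair a l = formPair (r • a) l := by
  refine Prod.ext (funext fun x => ?_) (funext fun x => ?_)
  · exact smul_smul r (a x) (wedge l x)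
  · change r • (ExteriorAlgebra.ι ℝ (diffAt a x) * wedge l x) =
      ExteriorAlgebra.ι ℝ (diffAt (r • a) x) * wedge l x
    rw [diffAt_smul, map_smul, smul_mul_assoc]

lemma exteriorGraph_induction
    {P : (∀ x : M, FormFibre E x) × (∀ x : M, FormFibre E x) → Prop}
    (hm : ∀ a l, P (formPair a l)) (ha : ∀ s t, P s → P t → P (s + t))
    {t : (∀ x : M, FormFibre E x) × (∀ x : M, FormFibre E x)} (ht : t ∈ exteriorGraph E M) :
    P t := by
  have h : ∀ r a l, P (r • formPair a l) := fun r a l => by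
    rw [smul_formPair]
    exact hm _ _
  refine Submodule.closure_induction (p := fun t _ => P t) ?_ (fun s t _ _ => ha s t) ?_ ht
  · rw [← zero_smul ℝ (formPair (0 : Fun E M) [])]
    exact h _ _ _
  · rintro r _ ⟨a, l, rfl⟩
    exact h r a l

/-- The pair `(a df₁ ∧ ⋯ ∧ df_q ⊗ f, da ∧ df₁ ∧ ⋯ ∧ df_q ⊗ f)`. -/
def jetPair (a : Fun E M) (l : List (Fun E M)) (f : Fun E M) :
    (∀ x : M, FormFibre E x ⊗[ℝ] Fun E M) × (∀ x : M, FormFibre E x ⊗[ℝ] Fun E M) :=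
  (fun x => (a x • wedge l x) ⊗ₜ f, fun x => (ExteriorAlgebra.ι ℝ (diffAt a x) * wedge l x) ⊗ₜ f)

lemma jetPair_mem (a : Fun E M) (l : List (Fun E M)) (f : Fun E M) :
    jetPair a l f ∈ jetGraph E M :=
  Submodule.subset_span ⟨_, formPair_mem a l, f, rfl⟩

lemma jetGraph_induction
    {P : (∀ x : M, FormFibre E x ⊗[ℝ] Fun E M) × (∀ x : M, FormFibre E x ⊗[ℝ] Fun E M) → Prop}
    (hm : ∀ a l f, P (jetPair a l f)) (ha : ∀ s t, P s → P t → P (s + t))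
    {t : (∀ x : M, FormFibre E x ⊗[ℝ] Fun E M) × (∀ x : M, FormFibre E x ⊗[ℝ] Fun E M)}
    (ht : t ∈ jetGraph E M) : P t := by
  have h : ∀ α ∈ exteriorGraph E M, ∀ f : Fun E M,
      P (fun x => α.1 x ⊗ₜ[ℝ] f, fun x => α.2 x ⊗ₜ[ℝ] f) := by
    intro α hα f
    refine exteriorGraph_induction
      (P := fun α => P (fun x => α.1 x ⊗ₜ[ℝ] f, fun x => α.2 x ⊗ₜ[ℝ] f)) (fun a l => hm a l f)
      (fun s t hs ht => ?_) hα
    convert ha _ _ hs ht using 1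
    exact Prod.ext (funext fun x => TensorProduct.add_tmul _ _ _)
      (funext fun x => TensorProduct.add_tmul _ _ _)
  refine Submodule.closure_induction (p := fun t _ => P t) ?_ (fun s t _ _ => ha s t) ?_ ht
  · convert h 0 (zero_mem _) 0 using 1
    exact Prod.ext (funext fun x => (TensorProduct.zero_tmul _ _).symm)
      (funext fun x => (TensorProduct.zero_tmul _ _).symm)
  · rintro r _ ⟨α, hα, f, rfl⟩
    exact h (r • α) (Submodule.smul_mem _ r hα) f

lemma jetGraph_fst {t : (∀ x : M, FormFibre E x ⊗[ℝ] Fun E M) ×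
    (∀ x : M, FormFibre E x ⊗[ℝ] Fun E M)} (ht : t ∈ jetGraph E M) :
    t.1 ∈ polySections E (jetFamily E M) := by
  refine jetGraph_induction (P := fun t => t.1 ∈ polySections E (jetFamily E M))
    (fun a l f => ?_) (fun s t hs ht => add_mem hs ht) ht
  convert tmul_mem_polySections (A := jetFamily E M)
    (smul_mem_polyForms a (wedge_mem_polyForms l)) [⟨fun _ => f, f, rfl⟩] using 1
  funext x
  simp [jetPair]

lemma jetGraph_snd {t : (∀ x : M, FormFibre E x ⊗[ℝ] Fun E M) ×
    (∀ x : M, FormFibre E x ⊗[ℝ] Fun E M)} (ht : t ∈ jetGraph E M) :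
    t.2 ∈ polySections E (jetFamily E M) := by
  refine jetGraph_induction (P := fun t => t.2 ∈ polySections E (jetFamily E M))
    (fun a l f => ?_) (fun s t hs ht => add_mem hs ht) ht
  convert tmul_mem_polySections (A := jetFamily E M)
    (wedge_mem_polyForms (a :: l)) [⟨fun _ => f, f, rfl⟩] using 1
  funext x
  simp [jetPair, wedge_cons]

/-- Monomials whose coefficients in `C^∞(M)` are constant in `x`. -/
lemma jet_polySections_induction {P : (∀ x : M, FormFibre E x ⊗[ℝ] Fun E M) → Prop}
    (hm : ∀ (a : Fun E M) (l : List (Fun E M)) (f : Fun E M),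
      P fun x => (a x • wedge l x) ⊗ₜ f)
    (ha : ∀ s t, P s → P t → P (s + t))
    {t : ∀ x : M, FormFibre E x ⊗[ℝ] Fun E M} (ht : t ∈ polySections E (jetFamily E M)) :
    P t := by
  refine polySections_induction (A := jetFamily E M) (P := P) (fun a l g => ?_) ha ht
  have hg : ∃ f : Fun E M, ∀ x : M, (g.map fun u => u.1 x).prod = f := by
    induction g with
    | nil => exact ⟨1, fun x => rfl⟩
    | cons u g ih =>
      obtain ⟨f, hf⟩ := ih
      obtain ⟨-, f', rfl⟩ := u
      exact ⟨f' * f, fun x => by rw [List.map_cons, List.prod_cons, hf]⟩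
  obtain ⟨f, hf⟩ := hg
  simp_rw [hf]
  exact hm a l f

/-- A differential is obtained from a presentation by monomials and depends on it;
`jetGraph_mem_fil` controls this dependence. -/
lemma exists_jetGraph {t : ∀ x : M, FormFibre E x ⊗[ℝ] Fun E M}
    (ht : t ∈ polySections E (jetFamily E M)) : ∃ t', (t, t') ∈ jetGraph E M := by
  refine jet_polySections_induction (P := fun t => ∃ t', (t, t') ∈ jetGraph E M)
    (fun a l f => ⟨_, jetPair_mem a l f⟩) ?_ ht
  rintro s t ⟨s', hs⟩ ⟨t', ht⟩
  exact ⟨s' + t', add_mem hs ht⟩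

/-- The Leibniz rule. -/
lemma jetGraph_mul {s t : (∀ x : M, FormFibre E x ⊗[ℝ] Fun E M) ×
    (∀ x : M, FormFibre E x ⊗[ℝ] Fun E M)} (hs : s ∈ jetGraph E M) (ht : t ∈ jetGraph E M) :
    (s.1 * t.1, fun x => s.2 x * t.1 x +
      TensorProduct.map parity.toLinearMap LinearMap.id (s.1 x) * t.2 x) ∈ jetGraph E M := by
  refine jetGraph_induction (P := fun s => (s.1 * t.1, fun x => s.2 x * t.1 x +
      TensorProduct.map parity.toLinearMap LinearMap.id (s.1 x) * t.2 x) ∈ jetGraph E M)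
    (fun a l f => ?_) (fun s s' h h' => ?_) hs
  · refine jetGraph_induction (P := fun t => ((jetPair a l f).1 * t.1,
        fun x => (jetPair a l f).2 x * t.1 x + TensorProduct.map parity.toLinearMap LinearMap.id
          ((jetPair a l f).1 x) * t.2 x) ∈ jetGraph E M) (fun b m g => ?_) (fun t t' h h' => ?_) ht
    · convert jetPair_mem (a * b) (l ++ m) (f * g) using 1
      refine Prod.ext (funext fun x => ?_) (funext fun x => ?_)
      · change (a x • wedge l x) ⊗ₜ[ℝ] f * (b x • wedge m x) ⊗ₜ[ℝ] g =
          ((a x * b x) • wedge (l ++ m) x) ⊗ₜ[ℝ] (f * g)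
        rw [Algebra.TensorProduct.tmul_mul_tmul, wedge_append, smul_mul_smul_comm]
      · change (ExteriorAlgebra.ι ℝ (diffAt a x) * wedge l x) ⊗ₜ[ℝ] f *
            (b x • wedge m x) ⊗ₜ[ℝ] g +
          (parity (a x • wedge l x)) ⊗ₜ[ℝ] f *
            (ExteriorAlgebra.ι ℝ (diffAt b x) * wedge m x) ⊗ₜ[ℝ] g =
          (ExteriorAlgebra.ι ℝ (diffAt (a * b) x) * wedge (l ++ m) x) ⊗ₜ[ℝ] (f * g)
        rw [Algebra.TensorProduct.tmul_mul_tmul, Algebra.TensorProduct.tmul_mul_tmul,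
          ← TensorProduct.add_tmul, diffAt_mul, wedge_append]
        congr 1
        rw [map_smul, map_add, map_smul, map_smul, add_mul, ← mul_assoc, smul_mul_assoc,
          smul_mul_assoc, smul_mul_assoc, smul_mul_assoc, mul_smul_comm, ← mul_assoc, ← mul_assoc,
          ι_mul_eq_parity_mul (diffAt b x) (wedge l x), add_comm]
    · convert add_mem h h' using 1
      refine Prod.ext (mul_add _ _ _) (funext fun x => ?_)
      simp only [Prod.fst_add, Prod.snd_add, Pi.add_apply, mul_add]
      abel
  · convert add_mem h h' using 1
    refine Prod.ext (add_mul _ _ _) (funext fun x => ?_)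
    simp only [Prod.fst_add, Prod.snd_add, Pi.add_apply, add_mul, map_add]
    abel

/-- The form `da ∧ df₁ ∧ ⋯ ∧ df_q` is a monomial with coefficient `1`, and `d1 = 0`. -/
lemma jetGraph_sq {t : (∀ x : M, FormFibre E x ⊗[ℝ] Fun E M) ×
    (∀ x : M, FormFibre E x ⊗[ℝ] Fun E M)} (ht : t ∈ jetGraph E M) :
    (t.2, 0) ∈ jetGraph E M := by
  refine jetGraph_induction (P := fun t => (t.2, 0) ∈ jetGraph E M) (fun a l f => ?_)
    (fun s t hs ht => ?_) ht
  · convert jetPair_mem 1 (a :: l) f using 1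
    refine Prod.ext (funext fun x => ?_) (funext fun x => ?_)
    · change (ExteriorAlgebra.ι ℝ (diffAt a x) * wedge l x) ⊗ₜ[ℝ] f =
        ((1 : ℝ) • wedge (a :: l) x) ⊗ₜ[ℝ] f
      rw [one_smul, wedge_cons]
    · change 0 = (ExteriorAlgebra.ι ℝ (diffAt 1 x) * wedge (a :: l) x) ⊗ₜ[ℝ] f
      have : diffAt (1 : Fun E M) x = 0 := by
        rw [← map_one (algebraMap ℝ (Fun E M)), diffAt_algebraMap]
      rw [this, map_zero, zero_mul, TensorProduct.zero_tmul]
  · convert add_mem hs ht using 1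
    exact Prod.ext rfl (funext fun x => (add_zero _).symm)

lemma jetGraph_degProj (q : ℕ) {t : (∀ x : M, FormFibre E x ⊗[ℝ] Fun E M) ×
    (∀ x : M, FormFibre E x ⊗[ℝ] Fun E M)} (ht : t ∈ jetGraph E M) :
    (fun x => TensorProduct.map (degProj q) LinearMap.id (t.1 x),
      fun x => TensorProduct.map (degProj (q + 1)) LinearMap.id (t.2 x)) ∈ jetGraph E M := by
  refine jetGraph_induction (P := fun t =>
    (fun x => TensorProduct.map (degProj q) LinearMap.id (t.1 x),
      fun x => TensorProduct.map (degProj (q + 1)) LinearMap.id (t.2 x)) ∈ jetGraph E M)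
    (fun a l f => ?_) (fun s t hs ht => ?_) ht
  · by_cases h : l.length = q
    · convert jetPair_mem a l f using 1
      refine Prod.ext (funext fun x => ?_) (funext fun x => ?_)
      · exact congrArg (· ⊗ₜ[ℝ] f)
          (degProj_of_mem (Submodule.smul_mem _ _ (h ▸ wedge_mem l x)))
      · exact congrArg (· ⊗ₜ[ℝ] f) (degProj_of_mem (h ▸ wedge_mem (a :: l) x))
    · convert zero_mem (jetGraph E M) using 1
      refine Prod.ext (funext fun x => ?_) (funext fun x => ?_)
      · exact (congrArg (· ⊗ₜ[ℝ] f) (degProj_of_mem_ne h (Submodule.smul_mem _ _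
          (wedge_mem l x)))).trans (TensorProduct.zero_tmul _ _)
      · have h' : (a :: l).length ≠ q + 1 := by simpa using h
        exact (congrArg (· ⊗ₜ[ℝ] f) (degProj_of_mem_ne h' (wedge_mem (a :: l) x))).trans
          (TensorProduct.zero_tmul _ _)
  · convert add_mem hs ht using 1
    exact Prod.ext (funext fun x => map_add _ _ _) (funext fun x => map_add _ _ _)

variable [IsManifold 𝓘(ℝ, E) ∞ M] [FiniteDimensional ℝ E]

/-- The homomorphism `Λ (T*ₓM) → Λ (T*_pM)` that maps the differentials of the coordinates to
each other. -/
def transport (c : Coords E M) (p x : M) : FormFibre E x →ₐ[ℝ] FormFibre E p :=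
  ExteriorAlgebra.map
    { toFun := fun ξ : Cotangent E x => ∑ a, ξ (c.v a x) • diffAt (c.X a) p
      map_add' := fun ξ η => by
        rw [← Finset.sum_add_distrib]
        exact Finset.sum_congr rfl fun a _ => add_smul _ _ _
      map_smul' := fun r ξ => by
        rw [RingHom.id_apply, Finset.smul_sum]
        exact Finset.sum_congr rfl fun a _ => mul_smul _ _ _ }

lemma transport_ι (c : Coords E M) (p x : M) (ξ : Cotangent E x) :
    transport c p x (ExteriorAlgebra.ι ℝ ξ) =
      ∑ a, ξ (c.v a x) • ExteriorAlgebra.ι ℝ (diffAt (c.X a) p) := by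
  refine (ExteriorAlgebra.map_apply_ι _ _).trans ?_
  change ExteriorAlgebra.ι ℝ (∑ a, ξ (c.v a x) • diffAt (c.X a) p) = _
  rw [map_sum]
  exact Finset.sum_congr rfl fun a _ => map_smul (ExteriorAlgebra.ι ℝ) _ _

variable {c : Coords E M} {p : M}

lemma transport_self (hp : p ∈ c.dom) (w : FormFibre E p) : transport c p p w = w := by
  have : transport c p p = AlgHom.id ℝ _ := by
    refine ExteriorAlgebra.hom_ext (LinearMap.ext fun ξ => ?_)
    refine (transport_ι c p p ξ).trans ?_
    simp_rw [← map_smul, ← map_sum]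
    exact congrArg _ (Coords.sum_dX hp ξ)
  rw [this]
  rfl

/-- Multiplication by the differential of a coordinate. -/
abbrev mulDX (c : Coords E M) (p : M) (b : Fin (Module.finrank ℝ E)) :
    FormFibre E p →ₗ[ℝ] FormFibre E p :=
  LinearMap.mulLeft ℝ (ExteriorAlgebra.ι ℝ (diffAt (c.X b) p))

variable (c p) in
/-- The function `x ↦ μ (df₁ ∧ ⋯ ∧ df_q)`, computed after transport from `x` to `p`. -/
def frameCoeff : Module.Dual ℝ (FormFibre E p) → List (Fun E M) → Fun E M
  | μ, [] => algebraMap ℝ _ (μ 1)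
  | μ, f :: l => ∑ b, c.D b f * frameCoeff (μ ∘ₗ mulDX c p b) l

lemma frameCoeff_apply (μ : Module.Dual ℝ (FormFibre E p)) (l : List (Fun E M)) (x : M) :
    frameCoeff c p μ l x = μ (transport c p x (wedge l x)) := by
  induction l generalizing μ with
  | nil =>
    rw [wedge_nil, map_one]
    rfl
  | cons f l ih =>
    rw [wedge_cons, map_mul, transport_ι, Finset.sum_mul, map_sum, frameCoeff, Fun.sum_apply]
    refine Finset.sum_congr rfl fun b _ => ?_
    rw [smul_mul_assoc, map_smul, smul_eq_mul]
    exact congrArg _ (ih _)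

-- This is `d (df₁ ∧ ⋯ ∧ df_q) = 0` in coordinates: second derivatives are symmetric while exterior
-- products are antisymmetric.
variable [T2Space M] in
lemma sum_D_frameCoeff {x : M} (hx : x ∈ c.dom) (μ : Module.Dual ℝ (FormFibre E p))
    (l : List (Fun E M)) : ∑ b, c.D b (frameCoeff c p (μ ∘ₗ mulDX c p b) l) x = 0 := by
  have hswap : ∀ (μ : Module.Dual ℝ (FormFibre E p)) b d (l : List (Fun E M)),
      frameCoeff c p ((μ ∘ₗ mulDX c p b) ∘ₗ mulDX c p d) l =
        -frameCoeff c p ((μ ∘ₗ mulDX c p d) ∘ₗ mulDX c p b) l := by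
    intro μ b d l
    ext x
    change _ = -(frameCoeff c p ((μ ∘ₗ mulDX c p d) ∘ₗ mulDX c p b) l x)
    rw [frameCoeff_apply, frameCoeff_apply]
    simp only [LinearMap.comp_apply, LinearMap.mulLeft_apply, ← mul_assoc]
    rw [← map_neg, ← neg_mul]
    congr 2
    exact eq_neg_of_add_eq_zero_left (ExteriorAlgebra.ι_add_mul_swap _ _)
  induction l generalizing μ with
  | nil =>
    refine Finset.sum_eq_zero fun b _ => ?_
    rw [frameCoeff, Derivation.map_algebraMap]
    rfl
  | cons f l ih =>
    let G := fun b d => frameCoeff c p ((μ ∘ₗ mulDX c p b) ∘ₗ mulDX c p d) l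
    have h1 : ∀ b, c.D b (frameCoeff c p (μ ∘ₗ mulDX c p b) (f :: l)) x =
        ∑ d, (c.D b (c.D d f) x * G b d x - c.D d f x * c.D b (G d b) x) := by
      intro b
      rw [frameCoeff, map_sum, Fun.sum_apply]
      refine Finset.sum_congr rfl fun d _ => ?_
      rw [Derivation.leibniz]
      change c.D d f x * c.D b (G b d) x + G b d x * c.D b (c.D d f) x = _
      have h2 : G b d = -G d b := hswap μ b d l
      have h3 : c.D b (G b d) x = -c.D b (G d b) x := by
        rw [h2, map_neg]
        rfl
      rw [h3]
      ring
    simp_rw [h1, Finset.sum_sub_distrib]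
    have h4 : ∑ b, ∑ d, c.D d f x * c.D b (G d b) x = 0 := by
      rw [Finset.sum_comm]
      refine Finset.sum_eq_zero fun d _ => ?_
      rw [← Finset.mul_sum, ih (μ ∘ₗ mulDX c p d), mul_zero]
    -- The sum of a symmetric array against an antisymmetric one equals its own negative.
    have h5 : ∑ b, ∑ d, c.D b (c.D d f) x * G b d x =
        -∑ b, ∑ d, c.D b (c.D d f) x * G b d x := by
      conv_lhs => rw [Finset.sum_comm]
      rw [← Finset.sum_neg_distrib]
      refine Finset.sum_congr rfl fun b _ => ?_
      rw [← Finset.sum_neg_distrib]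
      refine Finset.sum_congr rfl fun d _ => ?_
      have h6 : G d b x = -(G b d x) := by
        have : G d b = -G b d := hswap μ d b l
        rw [this]
        rfl
      rw [h6, Coords.D_comm hx d b]
      ring
    rw [h4, sub_zero]
    linarith

/-- The linear span of the pairs `(x ↦ a x • f, x ↦ (∂_b a) x • f)`. -/
def directionGraph (c : Coords E M) (b : Fin (Module.finrank ℝ E)) :
    Submodule ℝ ((M → Fun E M) × (M → Fun E M)) :=
  Submodule.span ℝ {w | ∃ a f : Fun E M, w = (fun x => a x • f, fun x => c.D b a x • f)}

lemma directionGraph_D {b : Fin (Module.finrank ℝ E)} (d : Fin (Module.finrank ℝ E))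
    {K : (M → Fun E M) × (M → Fun E M)} (hK : K ∈ directionGraph c b) :
    (fun x => c.D d (K.1 x), fun x => c.D d (K.2 x)) ∈ directionGraph c b := by
  induction hK using Submodule.span_induction with
  | mem K hK =>
    obtain ⟨a, f, rfl⟩ := hK
    refine Submodule.subset_span ⟨a, c.D d f, ?_⟩
    exact Prod.ext (funext fun x => (c.D d).map_smul _ _) (funext fun x => (c.D d).map_smul _ _)
  | zero =>
    convert zero_mem (directionGraph c b) using 1
    exact Prod.ext (funext fun x => map_zero (c.D d)) (funext fun x => map_zero (c.D d))
  | add K L _ _ hK hL =>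
    convert add_mem hK hL using 1
    exact Prod.ext (funext fun x => map_add (c.D d) _ _) (funext fun x => map_add (c.D d) _ _)
  | smul r K _ hK =>
    convert Submodule.smul_mem _ r hK using 1
    exact Prod.ext (funext fun x => (c.D d).map_smul _ _) (funext fun x => (c.D d).map_smul _ _)

/-- The derivative along the diagonal. -/
lemma directionGraph_diagonal {b : Fin (Module.finrank ℝ E)}
    {K : (M → Fun E M) × (M → Fun E M)} (hK : K ∈ directionGraph c b) :
    ∃ g : Fun E M, ∀ x, g x = K.1 x x ∧ c.D b g x = K.2 x x + c.D b (K.1 x) x := by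
  induction hK using Submodule.span_induction with
  | mem K hK =>
    obtain ⟨a, f, rfl⟩ := hK
    refine ⟨a * f, fun x => ⟨rfl, ?_⟩⟩
    rw [Derivation.leibniz]
    change a x * c.D b f x + f x * c.D b a x = c.D b a x * f x + c.D b (a x • f) x
    rw [Derivation.map_smul]
    change _ = c.D b a x * f x + a x * c.D b f x
    ring
  | zero =>
    refine ⟨0, fun x => ⟨rfl, ?_⟩⟩
    change c.D b 0 x = 0 + c.D b 0 x
    rw [zero_add]
  | add K L _ _ hK hL =>
    obtain ⟨g, hg⟩ := hK
    obtain ⟨g', hg'⟩ := hL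
    refine ⟨g + g', fun x => ⟨congrArg₂ (· + ·) (hg x).1 (hg' x).1, ?_⟩⟩
    rw [map_add]
    change c.D b g x + c.D b g' x = K.2 x x + L.2 x x + c.D b (K.1 x + L.1 x) x
    rw [map_add, (hg x).2, (hg' x).2]
    change _ = K.2 x x + L.2 x x + (c.D b (K.1 x) x + c.D b (L.1 x) x)
    ring
  | smul r K _ hK =>
    obtain ⟨g, hg⟩ := hK
    refine ⟨r • g, fun x => ⟨congrArg (r * ·) (hg x).1, ?_⟩⟩
    rw [Derivation.map_smul]
    change r * c.D b g x = r * K.2 x x + c.D b (r • K.1 x) x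
    rw [Derivation.map_smul, (hg x).2]
    change _ = r * K.2 x x + r * c.D b (K.1 x) x
    ring

variable [T2Space M]

/-- Differentiation of the coefficients lowers the order of vanishing on the diagonal by at most
one. -/
lemma directionGraph_mem_pow {b : Fin (Module.finrank ℝ E)} {N : Set M} (hN : IsOpen N)
    (hNc : N ⊆ c.dom) {k : ℕ} {K : (M → Fun E M) × (M → Fun E M)} (hK : K ∈ directionGraph c b)
    (h : ∀ x ∈ N, K.1 x ∈ RingHom.ker (evalAt (E := E) x) ^ (k + 1)) :
    ∀ x ∈ N, K.2 x ∈ RingHom.ker (evalAt (E := E) x) ^ k := by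
  induction k generalizing K with
  | zero => simp
  | succ k ih =>
    intro x hx
    -- The restriction `g` of the family to the diagonal vanishes near `x`. Its derivative is the
    -- sum of the derivative of the coefficients and that of the representative; the latter vanishes
    -- at `x`, so the former does too. Higher order follows by induction, since the operators `D d`
    -- on representatives commute with differentiation of the coefficients.
    obtain ⟨g, hg⟩ := directionGraph_diagonal hK
    have h0 : ∀ y ∈ N, g y = 0 := fun y hy => by
      rw [(hg y).1]
      exact Ideal.pow_le_self (by omega) (h y hy)
    have h1 : c.D b g x = 0 := by
      have : diffAt g x = 0 := by
        rw [← diffAt_algebraMap (E := E) 0 x]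
        refine diffAt_congr ?_
        filter_upwards [hN.mem_nhds hx] with y hy
        rw [h0 y hy]
        rfl
      rw [Coords.D_apply, this]
      rfl
    have h2 : c.D b (K.1 x) x = 0 :=
      Ideal.pow_le_self (n := k + 1) (by omega) (derivation_mem_pow _ (c.D b) (h x hx))
    refine (Coords.isFrame (hNc hx)).mem_pow_succ ?_ fun d => ?_
    · have h3 := (hg x).2
      rw [h1, h2, add_zero] at h3
      exact h3.symm
    · exact ih (directionGraph_D d hK) (fun y hy => derivation_mem_pow _ (c.D d) (h y hy)) x hx

/-- Transport to `p` turns the components of a family of forms into functions of `x`. A component of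
the differential at `p` is then a sum of directional derivatives of coefficients, which reduces the
question to `directionGraph_mem_pow`. -/
lemma jetGraph_slice (hp : p ∈ c.dom) {t : (∀ x : M, FormFibre E x ⊗[ℝ] Fun E M) ×
    (∀ x : M, FormFibre E x ⊗[ℝ] Fun E M)} (ht : t ∈ jetGraph E M)
    (μ : Module.Dual ℝ (FormFibre E p)) :
    ∃ K' : Fin (Module.finrank ℝ E) → M → Fun E M,
      (∀ b, (fun x => slice ((μ ∘ₗ mulDX c p b) ∘ₗ (transport c p x).toLinearMap) (t.1 x), K' b) ∈
        directionGraph c b) ∧ ∑ b, K' b p = slice μ (t.2 p) := by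
  refine jetGraph_induction (P := fun t => ∃ K' : Fin (Module.finrank ℝ E) → M → Fun E M,
      (∀ b, (fun x => slice ((μ ∘ₗ mulDX c p b) ∘ₗ (transport c p x).toLinearMap) (t.1 x), K' b) ∈
        directionGraph c b) ∧ ∑ b, K' b p = slice μ (t.2 p)) (fun a l f => ?_) ?_ ht
  · let G := fun b => frameCoeff c p (μ ∘ₗ mulDX c p b) l
    refine ⟨fun b x => c.D b (a * G b) x • f, fun b => ?_, ?_⟩
    · refine Submodule.subset_span ⟨a * G b, f, Prod.ext (funext fun x => ?_) rfl⟩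
      refine (slice_tmul _ _ _).trans ?_
      rw [map_smul]
      exact congrArg (fun r : ℝ => (a x * r) • f) (frameCoeff_apply (μ ∘ₗ mulDX c p b) l x).symm
    · have h1 : ∀ b, c.D b (a * G b) p = c.D b a p * G b p + a p * c.D b (G b) p := fun b => by
        rw [Derivation.leibniz]
        change a p * c.D b (G b) p + G b p * c.D b a p = _
        ring
      simp_rw [h1]
      -- The derivatives of the frame coefficients cancel in the sum over `b`, so only the
      -- derivatives of `a` remain.
      rw [← Finset.sum_smul, Finset.sum_add_distrib, ← Finset.mul_sum, sum_D_frameCoeff hp,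
        mul_zero, add_zero]
      refine Eq.trans ?_ (slice_tmul _ _ _).symm
      congr 1
      conv_rhs => rw [← transport_self hp (ExteriorAlgebra.ι ℝ (diffAt a p)), transport_ι]
      rw [Finset.sum_mul, map_sum]
      refine Finset.sum_congr rfl fun b _ => ?_
      rw [smul_mul_assoc, map_smul, smul_eq_mul, Coords.D_apply]
      refine congrArg _ ((frameCoeff_apply (μ ∘ₗ mulDX c p b) l p).trans ?_)
      rw [transport_self hp]
      rfl
  · rintro s t ⟨K, hK, hK'⟩ ⟨L, hL, hL'⟩
    refine ⟨K + L, fun b => ?_, ?_⟩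
    · convert add_mem (hK b) (hL b) using 1
      exact Prod.ext (funext fun x => map_add _ _ _) rfl
    · refine Finset.sum_add_distrib.trans ?_
      rw [hK', hL']
      exact (map_add _ _ _).symm

/-- The differential modulo `𝔪^k` only depends on the family modulo `𝔪^(k+1)`. -/
lemma jetGraph_mem_fil {t : (∀ x : M, FormFibre E x ⊗[ℝ] Fun E M) ×
    (∀ x : M, FormFibre E x ⊗[ℝ] Fun E M)} (ht : t ∈ jetGraph E M) {k : ℕ} {p : M}
    (h : ∀ᶠ x in 𝓝 p, emb E (jetFamily E M) x (t.1 x) ∈ fil (k + 1) x) :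
    emb E (jetFamily E M) p (t.2 p) ∈ fil k p := by
  obtain ⟨c, hp⟩ := exists_coords (E := E) p
  obtain ⟨S, hS, hSo, hpS⟩ := eventually_nhds_iff.1 h
  refine emb_mem_fil_iff.2 fun μ => ?_
  obtain ⟨K', hK', hsum⟩ := jetGraph_slice hp ht μ
  rw [← hsum]
  refine sum_mem fun b _ => ?_
  refine directionGraph_mem_pow (hSo.inter c.dom.isOpen) Set.inter_subset_right (hK' b) ?_ p
    ⟨hpS, hp⟩
  intro x hx
  exact emb_mem_fil_iff.1 (hS x hx.1) _

end JetDifferential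


/-! ### The de Rham complex of jets -/

section JetComplex

variable {E : Type*} [NormedAddCommGroup E] [NormedSpace ℝ E] [FiniteDimensional ℝ E]
variable {M : Type*} [TopologicalSpace M] [ChartedSpace E M] [IsManifold 𝓘(ℝ, E) ∞ M] [T2Space M]
variable {U W : Opens M}

lemma eventually_of_subtype {p : U} {P : M → Prop} (h : ∀ᶠ x : U in 𝓝 p, P x.1) :
    ∀ᶠ x in 𝓝 p.1, P x := by
  rw [← U.isOpen.isOpenEmbedding_subtypeVal.map_nhds_eq p]
  exact h

lemma exists_jet_approx (s : JetForms E U) (k : ℕ) (p : U) : ∃ t ∈ jetGraph E M,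
    ∀ᶠ x in 𝓝 p, s.1 x - emb E (jetFamily E M) x.1 (t.1 x.1) ∈ fil k x.1 := by
  obtain ⟨t, ht, h⟩ := CoeffForms.approx s k p
  obtain ⟨t', ht'⟩ := exists_jetGraph ht
  exact ⟨_, ht', h⟩

lemma jetGraph_sub_mem_fil {s : JetForms E U} {k : ℕ} {p : U}
    {t t' : (∀ x : M, FormFibre E x ⊗[ℝ] Fun E M) × (∀ x : M, FormFibre E x ⊗[ℝ] Fun E M)}
    (ht : t ∈ jetGraph E M) (ht' : t' ∈ jetGraph E M)
    (h : ∀ᶠ x in 𝓝 p, s.1 x - emb E (jetFamily E M) x.1 (t.1 x.1) ∈ fil (k + 1) x.1)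
    (h' : ∀ᶠ x in 𝓝 p, s.1 x - emb E (jetFamily E M) x.1 (t'.1 x.1) ∈ fil (k + 1) x.1) :
    emb E (jetFamily E M) p.1 (t.2 p.1) - emb E (jetFamily E M) p.1 (t'.2 p.1) ∈ fil k p.1 := by
  rw [← map_sub]
  refine jetGraph_mem_fil (sub_mem ht ht') (eventually_of_subtype ?_)
  filter_upwards [h, h'] with x hx hx'
  have := sub_mem hx' hx
  rwa [sub_sub_sub_cancel_left, ← map_sub] at this

/-- The value is the limit of the differentials of approximations modulo ever higher powers. They
form a Cauchy sequence, and the limit is independent of choices, because two approximations of order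
`k + 1` have differentials agreeing to order `k`. -/
lemma exists_jetFib (s : JetForms E U) (p : U) :
    ∃ z : CoeffFibre E (jetFamily E M) p.1, ∀ k, ∀ t ∈ jetGraph E M,
      (∀ᶠ x in 𝓝 p, s.1 x - emb E (jetFamily E M) x.1 (t.1 x.1) ∈ fil (k + 1) x.1) →
      z - emb E (jetFamily E M) p.1 (t.2 p.1) ∈ fil k p.1 := by
  choose t ht h using fun k => exists_jet_approx s (k + 1) p
  obtain ⟨z, hz⟩ := exists_limit (fun k => emb E (jetFamily E M) p.1 ((t k).2 p.1)) fun k => by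
    refine jetGraph_sub_mem_fil (ht (k + 1)) (ht k) ?_ (h k)
    filter_upwards [h (k + 1)] with x hx
    exact fil_anti (by omega) hx
  refine ⟨z, fun k t' ht' h' => ?_⟩
  have := add_mem (hz k) (jetGraph_sub_mem_fil (ht k) ht' (h k) h')
  rwa [sub_add_sub_cancel] at this

/-- The value at a point of the differential of a section. -/
def jetFib (s : JetForms E U) (p : U) : CoeffFibre E (jetFamily E M) p.1 :=
  (exists_jetFib s p).choose

lemma jetFib_sub_mem {s : JetForms E U} {p : U} {k : ℕ}
    {t : (∀ x : M, FormFibre E x ⊗[ℝ] Fun E M) × (∀ x : M, FormFibre E x ⊗[ℝ] Fun E M)}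
    (ht : t ∈ jetGraph E M)
    (h : ∀ᶠ x in 𝓝 p, s.1 x - emb E (jetFamily E M) x.1 (t.1 x.1) ∈ fil (k + 1) x.1) :
    jetFib s p - emb E (jetFamily E M) p.1 (t.2 p.1) ∈ fil k p.1 :=
  (exists_jetFib s p).choose_spec k t ht h

/-- One approximation for each `k` suffices to recognize the differential. Linearity, the Leibniz
rule and `d² = 0` are thus inherited from polynomial families. -/
lemma eq_jetFib {s : JetForms E U} {p : U} {z : CoeffFibre E (jetFamily E M) p.1}
    (h : ∀ k, ∃ t ∈ jetGraph E M,
      (∀ᶠ x in 𝓝 p, s.1 x - emb E (jetFamily E M) x.1 (t.1 x.1) ∈ fil (k + 1) x.1) ∧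
      z - emb E (jetFamily E M) p.1 (t.2 p.1) ∈ fil k p.1) : z = jetFib s p := by
  refine sub_eq_zero.1 (eq_zero_of_mem_fil fun k => ?_)
  obtain ⟨t, ht, h1, h2⟩ := h k
  have := sub_mem h2 (jetFib_sub_mem ht h1)
  rwa [sub_sub_sub_cancel_right] at this

/-- The differential of the de Rham complex of jets. -/
def jetD : JetForms E U →ₗ[ℝ] JetForms E U where
  toFun s := ⟨fun x => jetFib s x, mem_coeff_iff.2 fun k p => by
    obtain ⟨t, ht, h⟩ := exists_jet_approx s (k + 1) p
    refine ⟨t.2, jetGraph_snd ht, ?_⟩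
    filter_upwards [eventually_eventually_nhds.2 h] with x hx
    exact jetFib_sub_mem ht hx⟩
  map_add' s t := CoeffForms.ext fun x => (eq_jetFib fun k => by
    obtain ⟨u, hu, h⟩ := exists_jet_approx s (k + 1) x
    obtain ⟨v, hv, h'⟩ := exists_jet_approx t (k + 1) x
    refine ⟨u + v, add_mem hu hv, ?_, ?_⟩
    · filter_upwards [h, h'] with y hy hy'
      have := add_mem hy hy'
      rw [sub_add_sub_comm, ← map_add] at this
      exact this
    · have := add_mem (jetFib_sub_mem hu h) (jetFib_sub_mem hv h')
      rw [sub_add_sub_comm, ← map_add] at this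
      exact this).symm
  map_smul' r s := CoeffForms.ext fun x => (eq_jetFib fun k => by
    obtain ⟨u, hu, h⟩ := exists_jet_approx s (k + 1) x
    refine ⟨r • u, Submodule.smul_mem _ r hu, ?_, ?_⟩
    · filter_upwards [h] with y hy
      have := Submodule.smul_of_tower_mem (fil (k + 1) y.1) r hy
      rw [smul_sub, ← map_smul] at this
      exact this
    · have := Submodule.smul_of_tower_mem (fil k x.1) r (jetFib_sub_mem hu h)
      rw [smul_sub, ← map_smul] at this
      exact this).symm

lemma isJetDifferential_jetD (s : JetForms E U) : IsJetDifferential E s (jetD s) := by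
  intro k p
  obtain ⟨t, ht, h⟩ := exists_jet_approx s (k + 1) p
  refine ⟨t, ht, ?_⟩
  filter_upwards [eventually_eventually_nhds.2 h] with x hx
  exact ⟨agreeMod_iff.2 hx.self_of_nhds, agreeMod_iff.2 (jetFib_sub_mem ht hx)⟩

lemma IsJetDifferential.eq_jetD {s s' : JetForms E U} (h : IsJetDifferential E s s') :
    s' = jetD s := by
  refine CoeffForms.ext fun x => eq_jetFib fun k => ?_
  obtain ⟨t, ht, h⟩ := h k x
  exact ⟨t, ht, h.mono fun y hy => agreeMod_iff.1 hy.1, agreeMod_iff.1 h.self_of_nhds.2⟩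

lemma jetD_res (h : W ≤ U) (s : JetForms E U) :
    CoeffForms.res h (jetD s) = jetD (CoeffForms.res h s) := by
  refine IsJetDifferential.eq_jetD fun k p => ?_
  obtain ⟨t, ht, hs⟩ := isJetDifferential_jetD s k ⟨p.1, h p.2⟩
  have hc : Continuous fun x : W => (⟨x.1, h x.2⟩ : U) := by fun_prop
  exact ⟨t, ht, (hc.tendsto p).eventually hs⟩

lemma jetD_mul (s t : JetForms E U) :
    jetD (s * t) = jetD s * t + (parityOp E M).act s * jetD t := by
  refine CoeffForms.ext fun x => (eq_jetFib fun k => ?_).symm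
  obtain ⟨u, hu, h⟩ := exists_jet_approx s (k + 1) x
  obtain ⟨v, hv, h'⟩ := exists_jet_approx t (k + 1) x
  have key : ∀ {j : ℕ} {y : M} {a b a' b' : CoeffFibre E (jetFamily E M) y},
      a - a' ∈ fil j y → b - b' ∈ fil j y → a * b - a' * b' ∈ fil j y := by
    intro j y a b a' b' ha hb
    have : a * b - a' * b' = (a - a') * b + a' * (b - b') := by noncomm_ring
    rw [this]
    exact add_mem (fil_mul_right _ ha) (Ideal.mul_mem_left _ _ hb)
  refine ⟨_, jetGraph_mul hu hv, ?_, ?_⟩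
  · filter_upwards [h, h'] with y hy hy'
    change _ - emb E (jetFamily E M) y.1 (u.1 y.1 * v.1 y.1) ∈ _
    rw [map_mul]
    exact key hy hy'
  · change (jetFib s x * t.1 x + (parityOp E M).fib _ x.1 (s.1 x) * jetFib t x) - _ ∈ _
    rw [map_add, map_mul, map_mul, add_sub_add_comm]
    refine add_mem (key (jetFib_sub_mem hu h) (fil_anti (by omega) h'.self_of_nhds))
      (key ?_ (jetFib_sub_mem hv h'))
    have := (parityOp E M).fib_mem_fil (fil_anti (Nat.le_succ k) h.self_of_nhds)
    rw [map_sub, FormOp.fib_emb] at this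
    exact this

lemma jetD_jetD (s : JetForms E U) : jetD (jetD s) = 0 := by
  refine CoeffForms.ext fun x => (eq_jetFib fun k => ?_).symm
  -- Two applications of the differential cost two orders.
  obtain ⟨u, hu, h⟩ := exists_jet_approx s (k + 2) x
  refine ⟨_, jetGraph_sq hu, ?_, ?_⟩
  · filter_upwards [eventually_eventually_nhds.2 h] with y hy
    exact jetFib_sub_mem hu hy
  · change (0 : CoeffFibre E (jetFamily E M) x.1) - emb E (jetFamily E M) x.1 0 ∈ _
    rw [map_zero, sub_zero]
    exact zero_mem _

lemma jetD_degOp (q : ℕ) (s : JetForms E U) :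
    jetD ((degOp E M q).act s) = (degOp E M (q + 1)).act (jetD s) := by
  refine CoeffForms.ext fun x => (eq_jetFib fun k => ?_).symm
  obtain ⟨u, hu, h⟩ := exists_jet_approx s (k + 1) x
  refine ⟨_, jetGraph_degProj q hu, ?_, ?_⟩
  · filter_upwards [h] with y hy
    have := (degOp E M q).fib_mem_fil hy
    rw [map_sub, FormOp.fib_emb] at this
    exact this
  · have := (degOp E M (q + 1)).fib_mem_fil (jetFib_sub_mem hu h)
    rw [map_sub, FormOp.fib_emb] at this
    exact this

lemma CoeffForms.mem_deg_iff {A : AugFamily M} {q : ℕ} {s : CoeffForms E A U} :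
    s ∈ CoeffForms.deg E A U q ↔ (degOp E M q).act s = s := by
  refine ⟨fun h => CoeffForms.ext fun x => FormalGeometry.mem_deg_iff.1 (h x), fun h x => ?_⟩
  rw [← h]
  exact degOp_fib_mem q _

lemma jetD_mem_deg {q : ℕ} {s : JetForms E U} (hs : s ∈ CoeffForms.deg E (jetFamily E M) U q) :
    jetD s ∈ CoeffForms.deg E (jetFamily E M) U (q + 1) := by
  rw [CoeffForms.mem_deg_iff, ← jetD_degOp, CoeffForms.mem_deg_iff.1 hs]

lemma jetD_ofForms {w z : Forms E U} (h : IsExteriorDerivative E w z) :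
    jetD (ofForms E (jetFamily E M) U w) = ofForms E (jetFamily E M) U z := by
  refine (IsJetDifferential.eq_jetD fun k p => ?_).symm
  obtain ⟨t, ht, h⟩ := h p
  refine ⟨_, Submodule.subset_span ⟨t, ht, 1, rfl⟩, ?_⟩
  filter_upwards [h] with x hx
  constructor
  · change AgreeMod E (A := jetFamily E M) (k + 1) (.tmul (w.1 x) 1) (t.1 x.1 ⊗ₜ[ℝ] 1)
    rw [hx.1]
    exact agreeMod_tmul E (A := jetFamily E M) (x := x.1) _ _ 1 1 (by rw [map_one, map_one])
  · change AgreeMod E (A := jetFamily E M) k (.tmul (z.1 x) 1) (t.2 x.1 ⊗ₜ[ℝ] 1)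
    rw [hx.2]
    exact agreeMod_tmul E (A := jetFamily E M) (x := x.1) _ _ 1 1 (by rw [map_one, map_one])

/-- The differential lowers the order of vanishing by at most one. -/
lemma jetD_mem_fil {s : JetForms E U} {k : ℕ} {p : U} (h : ∀ᶠ x in 𝓝 p, s.1 x ∈ fil (k + 1) x.1) :
    (jetD s).1 p ∈ fil k p.1 := by
  have := jetFib_sub_mem (s := s) (zero_mem (jetGraph E M)) (p := p) (k := k) (by
    filter_upwards [h] with x hx
    change _ - emb E (jetFamily E M) x.1 0 ∈ _
    rwa [map_zero, sub_zero])
  change _ - emb E (jetFamily E M) p.1 0 ∈ _ at this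
  rwa [map_zero, sub_zero] at this

end JetComplex


/-! ### The filtration on sections -/

section Filtration

variable {E : Type*} [NormedAddCommGroup E] [NormedSpace ℝ E]
variable {M : Type*} [TopologicalSpace M] [ChartedSpace E M]
variable {A : AugFamily M} {U W : Opens M}

/-- Evaluation of sections at a point. -/
def CoeffForms.ev (x : U) : CoeffForms E A U →ₐ[ℝ] CoeffFibre E A x.1 where
  toFun s := s.1 x
  map_one' := rfl
  map_mul' _ _ := rfl
  map_zero' := rfl
  map_add' _ _ := rfl
  commutes' _ := rfl

lemma CoeffForms.sum_apply {κ : Type*} (s : Finset κ) (f : κ → CoeffForms E A U) (x : U) :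
    (∑ i ∈ s, f i).1 x = ∑ i ∈ s, (f i).1 x := map_sum (CoeffForms.ev x) f s

variable (E A U) in
/-- Sections of order at least `k`. -/
def CoeffForms.filtration (k : ℕ) : Submodule ℝ (CoeffForms E A U) where
  carrier := {s | ∀ x : U, s.1 x ∈ fil k x.1}
  add_mem' := fun ha hb x => add_mem (ha x) (hb x)
  zero_mem' := fun _ => zero_mem _
  smul_mem' := fun r _ ha x => Submodule.smul_of_tower_mem (fil k x.1) r (ha x)

lemma CoeffForms.filtration_anti {j k : ℕ} (h : j ≤ k) :
    CoeffForms.filtration E A U k ≤ CoeffForms.filtration E A U j := fun _ hs x =>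
  fil_anti h (hs x)

lemma CoeffForms.mem_filtration_zero (s : CoeffForms E A U) :
    s ∈ CoeffForms.filtration E A U 0 := fun x => by
  rw [fil_zero]
  trivial

lemma CoeffForms.eq_zero_of_mem_filtration {s : CoeffForms E A U}
    (h : ∀ k, s ∈ CoeffForms.filtration E A U k) : s = 0 :=
  CoeffForms.ext fun x => eq_zero_of_mem_fil fun k => h k x

lemma CoeffForms.res_mem_filtration (h : W ≤ U) {k : ℕ} {s : CoeffForms E A U}
    (hs : s ∈ CoeffForms.filtration E A U k) :
    CoeffForms.res h s ∈ CoeffForms.filtration E A W k := fun x => hs ⟨x.1, h x.2⟩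

lemma CoeffForms.res_mem_deg (h : W ≤ U) {q : ℕ} {s : CoeffForms E A U}
    (hs : s ∈ CoeffForms.deg E A U q) :
    CoeffForms.res h s ∈ CoeffForms.deg E A W q := fun x => hs ⟨x.1, h x.2⟩

lemma one_tmul_comm {x : M} (b : A.Completed x) (z : CoeffFibre E A x) :
    CoeffFibre.tmul 1 b * z = z * CoeffFibre.tmul 1 b := by
  induction z using coeff_induction with
  | h0 => rw [mul_zero, zero_mul]
  | ht a c => rw [tmul_mul_tmul, tmul_mul_tmul, one_mul, mul_one, mul_comm]
  | ha y z hy hz => rw [mul_add, add_mul, hy, hz]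

lemma FormOp.fib_one_tmul_mul (T : FormOp E M) {x : M} (b : A.Completed x)
    (z : CoeffFibre E A x) :
    T.fib A x (CoeffFibre.tmul 1 b * z) = CoeffFibre.tmul 1 b * T.fib A x z := by
  induction z using coeff_induction with
  | h0 => rw [mul_zero, map_zero, mul_zero]
  | ht a c => rw [tmul_mul_tmul, one_mul, FormOp.fib_tmul, FormOp.fib_tmul, tmul_mul_tmul, one_mul]
  | ha y z hy hz => rw [mul_add, map_add, map_add, mul_add, hy, hz]

lemma parity_parity_fib {x : M} (z : CoeffFibre E A x) :
    (parityOp E M).fib A x ((parityOp E M).fib A x z) = z := by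
  induction z using coeff_induction with
  | h0 => simp
  | ht a c =>
    rw [FormOp.fib_tmul, FormOp.fib_tmul]
    exact congrArg (CoeffFibre.tmul · c) (CliffordAlgebra.involute_involute _)
  | ha y z hy hz => rw [map_add, map_add, hy, hz]

lemma parity_contract_fib [IsManifold 𝓘(ℝ, E) ∞ M] (v : VectorFields E M) {x : M}
    (z : CoeffFibre E A x) : (parityOp E M).fib A x ((contractOp v).fib A x z) =
      -(contractOp v).fib A x ((parityOp E M).fib A x z) := by
  induction z using coeff_induction with
  | h0 => simp
  | ht a c =>
    simp only [FormOp.fib_tmul]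
    refine (congrArg (CoeffFibre.tmul · c) (parity_contract _ a)).trans ?_
    exact TensorProduct.neg_tmul _ _
  | ha y z hy hz => simp only [map_add, hy, hz, neg_add]

lemma contractOp_op_eq_sum [IsManifold 𝓘(ℝ, E) ∞ M] {κ : Type*} [Fintype κ] {x : M}
    {v : VectorFields E M} {u : κ → VectorFields E M} {r : κ → ℝ}
    (h : v x = ∑ b, r b • u b x) :
    (contractOp v).op x = ∑ b, r b • (contractOp (u b)).op x := by
  let ev : TangentSpace 𝓘(ℝ, E) x → Module.Dual ℝ (Cotangent E x) := fun w =>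
    { toFun := fun ξ => ξ w, map_add' := fun _ _ => rfl, map_smul' := fun _ _ => rfl }
  have h1 : ev (v x) = ∑ b, r b • ev (u b x) := by
    ext ξ
    rw [h]
    change ξ (∑ b, r b • u b x) = _
    rw [map_sum, LinearMap.sum_apply]
    exact Finset.sum_congr rfl fun b _ => map_smul ξ _ _
  change CliffordAlgebra.contractLeft (Q := (0 : QuadraticForm ℝ (Cotangent E x))) (ev (v x)) = _
  rw [h1, map_sum]
  exact Finset.sum_congr rfl fun b _ => map_smul _ _ _

variable [FiniteDimensional ℝ E]

lemma CoeffForms.sum_degOp (s : CoeffForms E A U) :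
    ∑ q ∈ Finset.range (Module.finrank ℝ E + 1), (degOp E M q).act s = s :=
  CoeffForms.ext fun x => (CoeffForms.sum_apply _ _ x).trans (sum_degOp_fib _)

lemma CoeffForms.degOp_mem_deg (q : ℕ) (s : CoeffForms E A U) :
    (degOp E M q).act s ∈ CoeffForms.deg E A U q := fun _ => degOp_fib_mem q _

lemma CoeffForms.homogeneous_induction {P : CoeffForms E A U → Prop}
    (hd : ∀ q, ∀ s ∈ CoeffForms.deg E A U q, P s) (ha : ∀ s t, P s → P t → P (s + t))
    (s : CoeffForms E A U) : P s := by
  rw [← CoeffForms.sum_degOp s]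
  exact Finset.sum_induction _ P ha (hd 0 _ (zero_mem _)) fun q _ =>
    hd q _ (CoeffForms.degOp_mem_deg q s)

lemma CoeffForms.filtration_mul {i j : ℕ} {s t : CoeffForms E A U}
    (hs : s ∈ CoeffForms.filtration E A U i) (ht : t ∈ CoeffForms.filtration E A U j) :
    s * t ∈ CoeffForms.filtration E A U (i + j) := fun x => fil_mul_fil (hs x) (ht x)

/-- Sections are complete for the filtration. -/
lemma CoeffForms.exists_limit (u : ℕ → CoeffForms E A U)
    (hu : ∀ k, u (k + 1) - u k ∈ CoeffForms.filtration E A U k) :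
    ∃ s, ∀ k, s - u k ∈ CoeffForms.filtration E A U k := by
  choose z hz using fun x : U => FormalGeometry.exists_limit (fun k => (u k).1 x) fun k => hu k x
  refine ⟨⟨z, mem_coeff_of_approx fun k p => ⟨U, p.2, u k, fun x hU _ => hz ⟨x, hU⟩ k⟩⟩,
    fun k x => hz x k⟩

end Filtration

/-! ### The contracting homotopy defined by a splitting -/

section Homotopy

variable {E : Type*} [NormedAddCommGroup E] [NormedSpace ℝ E] [FiniteDimensional ℝ E]
variable {M : Type*} [TopologicalSpace M] [ChartedSpace E M] [IsManifold 𝓘(ℝ, E) ∞ M] [T2Space M]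
variable {U W : Opens M}

lemma jetD_parity (s : JetForms E U) :
    jetD ((parityOp E M).act s) = -(parityOp E M).act (jetD s) := by
  have hp : ∀ q : ℕ, ∀ s ∈ CoeffForms.deg E (jetFamily E M) U q,
      (parityOp E M).act s = (-1 : ℝ) ^ q • s := fun q s hs => CoeffForms.ext fun x => by
    refine (parity_fib_of_deg (hs x)).trans ?_
    change _ = (-1 : ℝ) ^ q • s.1 x
    rw [Algebra.smul_def, map_pow, map_neg, map_one]
  refine CoeffForms.homogeneous_induction (P := fun s => jetD ((parityOp E M).act s) =
    -(parityOp E M).act (jetD s)) (fun q s hs => ?_) (fun s t hs ht => ?_) s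
  · rw [hp q s hs, hp (q + 1) _ (jetD_mem_deg hs), map_smul, pow_succ, mul_neg_one, neg_smul,
      neg_neg]
  · rw [map_add, map_add, map_add, map_add, hs, ht, neg_add]

/-- The differential of a function, as a one-form. -/
def dForm (f : Fun E M) : OneForms E M := ⟨fun x => diffAt f x, fun v => contMDiff_diffAt_apply f v⟩

/-- The section of jets that `σ` associates with a one-form. -/
def JetSplitting.sec (σ : JetSplitting E M) (l : OneForms E M) (U : Opens M) : JetForms E U :=
  CoeffForms.res le_top (⟨_, σ.smooth l⟩ : JetForms E (⊤ : Opens M))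

variable (σ : JetSplitting E M)

/-- A representative of `σ (df)` and the function `f - f x` have the same value and the same
differential at `x`, so they agree modulo `𝔪ₓ²`. -/
lemma JetSplitting.sub_mem_fil (f : Fun E M) (x : M) :
    (CoeffFibre.tmul 1 (σ.toFun x (diffAt f x)) : CoeffFibre E (jetFamily E M) x) -
      emb E (jetFamily E M) x (1 ⊗ₜ[ℝ] (f - algebraMap ℝ (Fun E M) (f x))) ∈ fil 2 x := by
  obtain ⟨g, hg⟩ := Ideal.Quotient.mk_surjective
    (AdicCompletion.evalₐ ((jetFamily E M).ideal x) 2 (σ.toFun x (diffAt f x)))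
  obtain ⟨h0, h1⟩ := σ.split x _ g hg.symm
  refine agreeMod_iff.1 (agreeMod_tmul E (jetFamily E M) 2 _ _ _ ?_)
  rw [← hg]
  refine Ideal.Quotient.eq.2 (mem_sq_of_diffAt_eq_zero ?_ ?_)
  · change g x - (f x - f x) = 0
    rw [h0, sub_self, sub_self]
  · have h2 : diffAt (f - algebraMap ℝ (Fun E M) (f x)) x = diffAt f x := by
      have := diffAt_add (f - algebraMap ℝ (Fun E M) (f x)) (algebraMap ℝ _ (f x)) x
      rw [diffAt_algebraMap, add_zero, sub_add_cancel] at this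
      exact this.symm
    have h3 := diffAt_add (g - (f - algebraMap ℝ (Fun E M) (f x)))
      (f - algebraMap ℝ (Fun E M) (f x)) x
    rw [sub_add_cancel, h1, h2] at h3
    exact (left_eq_add.1 (h3.trans (add_comm _ _)))

lemma JetSplitting.mem_fil_one (x : M) (ξ : Cotangent E x) :
    (CoeffFibre.tmul 1 (σ.toFun x ξ) : CoeffFibre E (jetFamily E M) x) ∈ fil 1 x := by
  obtain ⟨g, hg⟩ := Ideal.Quotient.mk_surjective
    (AdicCompletion.evalₐ ((jetFamily E M).ideal x) 2 (σ.toFun x ξ))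
  obtain ⟨h0, -⟩ := σ.split x _ g hg.symm
  refine tmul_mem_fil _ ?_
  rw [← evalₐ_factor _ one_le_two, ← hg, Ideal.Quotient.factor_mk, Ideal.Quotient.eq_zero_iff_mem,
    pow_one]
  exact h0

/-- The contracting homotopy on a fibre. -/
def homotopyFib (x : M) : CoeffFibre E (jetFamily E M) x →ₗ[ℝ] CoeffFibre E (jetFamily E M) x :=
  ∑ a, LinearMap.mulLeft ℝ (CoeffFibre.tmul 1
      (σ.toFun x (diffAt ((exists_coords (E := E) x).choose.X a) x))) ∘ₗ
    (contractOp ((exists_coords (E := E) x).choose.v a)).fib _ x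

/-- The sum pairs `σ` with contraction through dual frames, so it does not depend on the frame.
Hence the homotopy, defined with a choice of coordinates at each point, is given near every point by
one coordinate system and is smooth. -/
lemma sum_sigma_contract {c c' : Coords E M} {x : M} (hx : x ∈ c.dom) (hx' : x ∈ c'.dom)
    (z : CoeffFibre E (jetFamily E M) x) :
    ∑ a, CoeffFibre.tmul 1 (σ.toFun x (diffAt (c.X a) x)) * (contractOp (c.v a)).fib _ x z =
    ∑ a, CoeffFibre.tmul 1 (σ.toFun x (diffAt (c'.X a) x)) * (contractOp (c'.v a)).fib _ x z := by
  induction z using coeff_induction with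
  | h0 => simp
  | ha y z hy hz => simp only [map_add, mul_add, Finset.sum_add_distrib, hy, hz]
  | ht w b =>
    have h1 : ∀ a, CoeffFibre.tmul 1 (σ.toFun x (diffAt (c.X a) x)) *
        (contractOp (c.v a)).fib (jetFamily E M) x (CoeffFibre.tmul w b) =
        ∑ d, CoeffFibre.tmul 1 (diffAt (c'.X d) x (c.v a x) • σ.toFun x (diffAt (c.X a) x)) *
          (contractOp (c'.v d)).fib (jetFamily E M) x (CoeffFibre.tmul w b) := by
      intro a
      simp only [FormOp.fib_tmul]
      rw [contractOp_op_eq_sum (Coords.sum_v hx' (c.v a x)).symm, LinearMap.sum_apply]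
      have h2 : (CoeffFibre.tmul (∑ d, (diffAt (c'.X d) x (c.v a x) • (contractOp (c'.v d)).op x) w)
          b : CoeffFibre E (jetFamily E M) x) =
          ∑ d, CoeffFibre.tmul ((diffAt (c'.X d) x (c.v a x) • (contractOp (c'.v d)).op x) w) b :=
        TensorProduct.sum_tmul _ _ _
      rw [h2, Finset.mul_sum]
      refine Finset.sum_congr rfl fun d _ => ?_
      rw [tmul_mul_tmul, tmul_mul_tmul, one_mul, one_mul, LinearMap.smul_apply,
        smul_mul_assoc]
      exact TensorProduct.smul_tmul _ _ _
    simp_rw [h1]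
    rw [Finset.sum_comm]
    refine Finset.sum_congr rfl fun d _ => ?_
    rw [← Finset.sum_mul]
    congr 1
    refine (TensorProduct.tmul_sum _ _ _).symm.trans ?_
    refine congrArg (CoeffFibre.tmul (A := jetFamily E M) 1) ?_
    simp_rw [← map_smul, ← map_sum]
    exact congrArg _ (Coords.sum_dX hx _)

lemma homotopyFib_eq {c : Coords E M} {x : M} (hx : x ∈ c.dom)
    (z : CoeffFibre E (jetFamily E M) x) : homotopyFib σ x z =
      ∑ a, CoeffFibre.tmul 1 (σ.toFun x (diffAt (c.X a) x)) * (contractOp (c.v a)).fib _ x z := by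
  rw [← sum_sigma_contract σ (exists_coords (E := E) x).choose_spec hx z, homotopyFib,
    LinearMap.sum_apply]
  rfl

/-- The contracting homotopy. -/
def homotopy : JetForms E U →ₗ[ℝ] JetForms E U where
  toFun s := ⟨fun x => homotopyFib σ x.1 (s.1 x), mem_coeff_of_local fun p => by
    obtain ⟨c, hp⟩ := exists_coords (E := E) p.1
    refine ⟨c.dom ⊓ U, ⟨hp, p.2⟩, ∑ a, σ.sec (dForm (c.X a)) _ *
      (contractOp (c.v a)).act (CoeffForms.res inf_le_right s), fun x hU hW => ?_⟩
    rw [CoeffForms.sum_apply]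
    exact homotopyFib_eq σ hW.1 _⟩
  map_add' s t := CoeffForms.ext fun x => map_add (homotopyFib σ x.1) _ _
  map_smul' r s := CoeffForms.ext fun x => map_smul (homotopyFib σ x.1) r (s.1 x)

lemma homotopy_eq {c : Coords E M} (hU : U ≤ c.dom) (s : JetForms E U) :
    homotopy σ s = ∑ a, σ.sec (dForm (c.X a)) _ * (contractOp (c.v a)).act s :=
  CoeffForms.ext fun x => by
    rw [CoeffForms.sum_apply]
    exact homotopyFib_eq σ (hU x.2) _

lemma homotopy_res (h : W ≤ U) (s : JetForms E U) :
    CoeffForms.res h (homotopy σ s) = homotopy σ (CoeffForms.res h s) := rfl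

lemma homotopyFib_mem_fil {k : ℕ} {x : M} {z : CoeffFibre E (jetFamily E M) x} (hz : z ∈ fil k x) :
    homotopyFib σ x z ∈ fil (k + 1) x := by
  obtain ⟨c, hx⟩ := exists_coords (E := E) x
  rw [homotopyFib_eq σ hx]
  refine sum_mem fun a _ => ?_
  rw [add_comm]
  exact fil_mul_fil (σ.mem_fil_one x _) (FormOp.fib_mem_fil _ hz)

lemma homotopyFib_mul {x : M} (y z : CoeffFibre E (jetFamily E M) x) :
    homotopyFib σ x (y * z) = homotopyFib σ x y * z +
      (parityOp E M).fib _ x y * homotopyFib σ x z := by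
  obtain ⟨c, hx⟩ := exists_coords (E := E) x
  simp only [homotopyFib_eq σ hx, contract_fib_mul, mul_add, Finset.sum_add_distrib,
    Finset.sum_mul, Finset.mul_sum]
  congr 1
  · exact Finset.sum_congr rfl fun a _ => (mul_assoc _ _ _).symm
  · refine Finset.sum_congr rfl fun a _ => ?_
    rw [← mul_assoc, one_tmul_comm, mul_assoc]

lemma homotopyFib_parity {x : M} (z : CoeffFibre E (jetFamily E M) x) :
    homotopyFib σ x ((parityOp E M).fib _ x z) = -(parityOp E M).fib _ x (homotopyFib σ x z) := by
  obtain ⟨c, hx⟩ := exists_coords (E := E) x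
  simp only [homotopyFib_eq σ hx, map_sum, FormOp.fib_one_tmul_mul, parity_contract_fib, mul_neg,
    Finset.sum_neg_distrib, neg_neg]

lemma homotopyFib_mem_deg {x : M} {q : ℕ} {z : CoeffFibre E (jetFamily E M) x}
    (hz : z ∈ CoeffFibre.deg E _ x (q + 1)) :
    homotopyFib σ x z ∈ CoeffFibre.deg E (jetFamily E M) x q := by
  obtain ⟨c, hx⟩ := exists_coords (E := E) x
  rw [homotopyFib_eq σ hx]
  refine sum_mem fun a _ => ?_
  have := mul_mem_deg (one_tmul_mem_deg (E := E) (A := jetFamily E M)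
    (σ.toFun x (diffAt (c.X a) x))) (contract_fib_mem_deg (c.v a) hz)
  rwa [zero_add] at this

lemma homotopyFib_of_deg_zero {x : M} {z : CoeffFibre E (jetFamily E M) x}
    (hz : z ∈ CoeffFibre.deg E _ x 0) : homotopyFib σ x z = 0 := by
  obtain ⟨c, hx⟩ := exists_coords (E := E) x
  rw [homotopyFib_eq σ hx]
  exact Finset.sum_eq_zero fun a _ => by rw [contract_fib_of_deg_zero _ hz, mul_zero]

lemma homotopyFib_ι (x : M) (ξ : Cotangent E x) :
    homotopyFib σ x (CoeffFibre.tmul (ExteriorAlgebra.ι ℝ ξ) 1) =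
      CoeffFibre.tmul 1 (σ.toFun x ξ) := by
  obtain ⟨c, hx⟩ := exists_coords (E := E) x
  rw [homotopyFib_eq σ hx]
  have h1 : ∀ a, CoeffFibre.tmul 1 (σ.toFun x (diffAt (c.X a) x)) *
      (contractOp (c.v a)).fib (jetFamily E M) x (CoeffFibre.tmul (ExteriorAlgebra.ι ℝ ξ) 1) =
      CoeffFibre.tmul 1 (ξ (c.v a x) • σ.toFun x (diffAt (c.X a) x)) := by
    intro a
    rw [FormOp.fib_tmul]
    have h2 : (contractOp (c.v a)).op x (ExteriorAlgebra.ι ℝ ξ) = ξ (c.v a x) • 1 :=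
      (contract_ι _ ξ).trans (Algebra.algebraMap_eq_smul_one _)
    rw [h2, tmul_mul_tmul, one_mul, mul_one]
    exact TensorProduct.smul_tmul _ _ _
  simp_rw [h1]
  refine (TensorProduct.tmul_sum _ _ _).symm.trans ?_
  refine congrArg (CoeffFibre.tmul (A := jetFamily E M) 1) ?_
  simp_rw [← map_smul, ← map_sum]
  exact congrArg _ (Coords.sum_dX hx _)

end Homotopy


/-! ### The anticommutator of differential and homotopy -/

section Laplacian

variable {E : Type*} [NormedAddCommGroup E] [NormedSpace ℝ E] [FiniteDimensional ℝ E]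
variable {M : Type*} [TopologicalSpace M] [ChartedSpace E M] [IsManifold 𝓘(ℝ, E) ∞ M] [T2Space M]
variable {U W : Opens M} (σ : JetSplitting E M)

/-- The anticommutator of the differential and the homotopy. -/
def laplacian : JetForms E U →ₗ[ℝ] JetForms E U := homotopy σ ∘ₗ jetD + jetD ∘ₗ homotopy σ

lemma laplacian_eq (s : JetForms E U) :
    laplacian σ s = homotopy σ (jetD s) + jetD (homotopy σ s) := rfl

lemma laplacian_res (h : W ≤ U) (s : JetForms E U) :
    CoeffForms.res h (laplacian σ s) = laplacian σ (CoeffForms.res h s) := by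
  rw [laplacian_eq, laplacian_eq, map_add, homotopy_res, jetD_res, jetD_res, homotopy_res]

lemma laplacian_jetD (s : JetForms E U) : laplacian σ (jetD s) = jetD (laplacian σ s) := by
  rw [laplacian_eq, laplacian_eq, map_add, jetD_jetD, jetD_jetD, map_zero, zero_add, add_zero]

lemma homotopy_mul (s t : JetForms E U) : homotopy σ (s * t) = homotopy σ s * t +
    (parityOp E M).act s * homotopy σ t := CoeffForms.ext fun _ => homotopyFib_mul σ _ _

lemma homotopy_parity (s : JetForms E U) :
    homotopy σ ((parityOp E M).act s) = -(parityOp E M).act (homotopy σ s) :=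
  CoeffForms.ext fun _ => homotopyFib_parity σ _

lemma parity_parity (s : JetForms E U) :
    (parityOp E M).act ((parityOp E M).act s) = s := CoeffForms.ext fun _ => parity_parity_fib _

/-- Both the differential and the homotopy are odd derivations, so their anticommutator is an even
one. Its leading part is therefore determined by its effect on generators. -/
lemma laplacian_mul (s t : JetForms E U) :
    laplacian σ (s * t) = laplacian σ s * t + s * laplacian σ t := by
  simp only [laplacian_eq, jetD_mul, homotopy_mul, map_add, homotopy_parity, jetD_parity,
    parity_parity]
  noncomm_ring

lemma homotopy_mem_deg {q : ℕ} {s : JetForms E U}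
    (hs : s ∈ CoeffForms.deg E (jetFamily E M) U (q + 1)) :
    homotopy σ s ∈ CoeffForms.deg E (jetFamily E M) U q := fun x => homotopyFib_mem_deg σ (hs x)

lemma homotopy_of_deg_zero {s : JetForms E U}
    (hs : s ∈ CoeffForms.deg E (jetFamily E M) U 0) : homotopy σ s = 0 :=
  CoeffForms.ext fun x => homotopyFib_of_deg_zero σ (hs x)

lemma homotopy_mem_filtration {k : ℕ} {s : JetForms E U}
    (hs : s ∈ CoeffForms.filtration E (jetFamily E M) U k) :
    homotopy σ s ∈ CoeffForms.filtration E (jetFamily E M) U (k + 1) := fun x =>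
  homotopyFib_mem_fil σ (hs x)

lemma jetD_mem_filtration {k : ℕ} {s : JetForms E U}
    (hs : s ∈ CoeffForms.filtration E (jetFamily E M) U (k + 1)) :
    jetD s ∈ CoeffForms.filtration E (jetFamily E M) U k := fun _ =>
  jetD_mem_fil (Filter.Eventually.of_forall hs)

lemma laplacian_mem_deg {q : ℕ} {s : JetForms E U}
    (hs : s ∈ CoeffForms.deg E (jetFamily E M) U q) :
    laplacian σ s ∈ CoeffForms.deg E (jetFamily E M) U q := by
  refine add_mem (homotopy_mem_deg σ (jetD_mem_deg hs)) ?_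
  cases q with
  | zero =>
    change jetD (homotopy σ s) ∈ _
    rw [homotopy_of_deg_zero σ hs, map_zero]
    exact zero_mem _
  | succ q => exact jetD_mem_deg (homotopy_mem_deg σ hs)

lemma JetSplitting.sec_mem_deg (l : OneForms E M) :
    σ.sec l U ∈ CoeffForms.deg E (jetFamily E M) U 0 := fun _ => one_tmul_mem_deg _

lemma JetSplitting.sec_mem_filtration (l : OneForms E M) :
    σ.sec l U ∈ CoeffForms.filtration E (jetFamily E M) U 1 := fun _ => σ.mem_fil_one _ _

lemma parity_sec (l : OneForms E M) : (parityOp E M).act (σ.sec l U) = σ.sec l U :=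
  CoeffForms.ext fun x => by
    refine (parity_fib_of_deg (σ.sec_mem_deg l x)).trans ?_
    rw [pow_zero, one_mul]

/-- To second order `σ (df)` is the jet of `f` minus the function `f`. The first is horizontal and
the second has differential `df`, which gives `-df` up to order one. -/
lemma jetD_sec (f : Fun E M) (x : U) : (jetD (σ.sec (dForm f) U)).1 x +
    CoeffFibre.tmul (ExteriorAlgebra.ι ℝ (diffAt f x.1)) 1 ∈ fil 1 x.1 := by
  have h := jetFib_sub_mem (s := σ.sec (dForm f) U) (p := x) (k := 1)
    (sub_mem (jetPair_mem 1 [] f) (jetPair_mem f [] 1)) (Filter.Eventually.of_forall fun y => by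
      have h1 := σ.sub_mem_fil f y.1
      have h2 : (jetPair 1 [] f - jetPair f [] 1).1 y.1 =
          (1 : FormFibre E y.1) ⊗ₜ[ℝ] (f - algebraMap ℝ (Fun E M) (f y.1)) := by
        change ((1 : ℝ) • (1 : FormFibre E y.1)) ⊗ₜ[ℝ] f - (f y.1 • (1 : FormFibre E y.1)) ⊗ₜ[ℝ] 1 = _
        rw [one_smul, TensorProduct.smul_tmul, TensorProduct.tmul_sub,
          Algebra.algebraMap_eq_smul_one]
      rw [h2]
      exact h1)
  have h3 : (jetPair 1 [] f - jetPair f [] 1).2 x.1 =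
      -((ExteriorAlgebra.ι ℝ (diffAt f x.1)) ⊗ₜ[ℝ] (1 : Fun E M)) := by
    change (ExteriorAlgebra.ι ℝ (diffAt (1 : Fun E M) x.1) * 1) ⊗ₜ[ℝ] f -
      (ExteriorAlgebra.ι ℝ (diffAt f x.1) * 1) ⊗ₜ[ℝ] 1 = _
    have : diffAt (1 : Fun E M) x.1 = 0 := by
      rw [← map_one (algebraMap ℝ (Fun E M)), diffAt_algebraMap]
    rw [this, map_zero, zero_mul, TensorProduct.zero_tmul, zero_sub, mul_one]
  rw [h3, map_neg, sub_neg_eq_add] at h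
  exact h

/-- The generators have weight `-1`: the differential gives `-df` to leading order, and the homotopy
turns `df` into `σ (df)`. -/
lemma laplacian_sec (f : Fun E M) (x : U) :
    (laplacian σ (σ.sec (dForm f) U)).1 x + (σ.sec (dForm f) U).1 x ∈ fil 2 x.1 := by
  have h := homotopyFib_mem_fil σ (jetD_sec σ f x)
  rw [map_add, homotopyFib_ι] at h
  rw [laplacian_eq, homotopy_of_deg_zero σ (σ.sec_mem_deg _), map_zero, add_zero]
  exact h

lemma laplacian_eq_of_coords {c : Coords E M} (hU : U ≤ c.dom) (s : JetForms E U) :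
    laplacian σ s = homotopy σ (jetD s) +
      ∑ a, (jetD (σ.sec (dForm (c.X a)) U) * (contractOp (c.v a)).act s +
        σ.sec (dForm (c.X a)) U * jetD ((contractOp (c.v a)).act s)) := by
  rw [laplacian_eq, homotopy_eq σ hU s, map_sum]
  congr 1
  exact Finset.sum_congr rfl fun a _ => by rw [jetD_mul, parity_sec]

lemma laplacian_mem_filtration {k : ℕ} {s : JetForms E U}
    (hs : s ∈ CoeffForms.filtration E (jetFamily E M) U k) :
    laplacian σ s ∈ CoeffForms.filtration E (jetFamily E M) U k := by
  cases k with
  | zero => exact CoeffForms.mem_filtration_zero _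
  | succ k =>
    intro x
    obtain ⟨c, hx⟩ := exists_coords (E := E) x.1
    have h1 := CoeffForms.res_mem_filtration (inf_le_right : c.dom ⊓ U ≤ U) hs
    have h2 : laplacian σ (CoeffForms.res (inf_le_right : c.dom ⊓ U ≤ U) s) ∈
        CoeffForms.filtration E (jetFamily E M) _ (k + 1) := by
      rw [laplacian_eq_of_coords σ inf_le_left]
      have hc : ∀ a, (contractOp (c.v a)).act (CoeffForms.res (inf_le_right : c.dom ⊓ U ≤ U) s) ∈
          CoeffForms.filtration E (jetFamily E M) _ (k + 1) := fun a y =>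
        FormOp.fib_mem_fil _ (h1 y)
      refine add_mem (homotopy_mem_filtration σ (jetD_mem_filtration h1))
        (sum_mem fun a _ => add_mem ?_ ?_)
      · have := CoeffForms.filtration_mul (CoeffForms.mem_filtration_zero
          (jetD (σ.sec (dForm (c.X a)) (c.dom ⊓ U)))) (hc a)
        rwa [zero_add] at this
      · have := CoeffForms.filtration_mul (σ.sec_mem_filtration (U := c.dom ⊓ U) (dForm (c.X a)))
          (jetD_mem_filtration (hc a))
        rwa [add_comm] at this
    rw [← laplacian_res] at h2
    exact h2 ⟨x.1, hx, x.2⟩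

lemma laplacian_apply_of_coords {c : Coords E M} (hU : U ≤ c.dom) (s : JetForms E U) (x : U) :
    (laplacian σ s).1 x = homotopyFib σ x.1 ((jetD s).1 x) +
      ∑ a, ((jetD (σ.sec (dForm (c.X a)) U)).1 x * (contractOp (c.v a)).fib _ x.1 (s.1 x) +
        (σ.sec (dForm (c.X a)) U).1 x * (jetD ((contractOp (c.v a)).act s)).1 x) := by
  rw [laplacian_eq_of_coords σ hU]
  exact congrArg (homotopyFib σ x.1 ((jetD s).1 x) + ·) (CoeffForms.sum_apply _ _ x)

/-- Modulo order one, only the terms survive in which the differential falls on `σ (dX_a)`. They are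
`-dX_a ∧ ι_a s`, and `euler_fib` sums them to `-q • s`. -/
lemma laplacian_weight_zero_of_coords {c : Coords E M} (hU : U ≤ c.dom) {q : ℕ}
    {s : JetForms E U} (hs : s ∈ CoeffForms.deg E (jetFamily E M) U q) (x : U) :
    (laplacian σ s).1 x + (q : ℝ) • s.1 x ∈ fil 1 x.1 := by
  have h0 : ∀ z : CoeffFibre E (jetFamily E M) x.1, z ∈ fil 0 x.1 := fun z => by
    rw [fil_zero]
    exact Submodule.mem_top
  have hring : ∀ d e f z w : CoeffFibre E (jetFamily E M) x.1, d * z + f * w + e * z =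
      (d + e) * z + f * w := fun d e f z w => by
    rw [add_mul, add_right_comm]
  have h1 : ∀ a, (jetD (σ.sec (dForm (c.X a)) U)).1 x * (contractOp (c.v a)).fib _ x.1 (s.1 x) +
        (σ.sec (dForm (c.X a)) U).1 x * (jetD ((contractOp (c.v a)).act s)).1 x +
        CoeffFibre.tmul (ExteriorAlgebra.ι ℝ (diffAt (c.X a) x.1)) 1 *
          (contractOp (c.v a)).fib _ x.1 (s.1 x) ∈ fil 1 x.1 := fun a => by
    rw [hring]
    exact add_mem (fil_mul_right _ (jetD_sec σ (c.X a) x))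
      (fil_mul_right _ (σ.mem_fil_one _ _))
  have h2 := add_mem (homotopyFib_mem_fil σ (h0 ((jetD s).1 x)))
    (sum_mem fun (a : Fin (Module.finrank ℝ E)) (_ : a ∈ Finset.univ) => h1 a)
  rw [Finset.sum_add_distrib, ← add_assoc, euler_fib c (hU x.2) (hs x),
    ← laplacian_apply_of_coords σ hU] at h2
  exact h2

lemma laplacian_weight_zero {q : ℕ} {s : JetForms E U}
    (hs : s ∈ CoeffForms.deg E (jetFamily E M) U q) :
    laplacian σ s + (q : ℝ) • s ∈ CoeffForms.filtration E (jetFamily E M) U 1 := by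
  intro x
  obtain ⟨c, hx⟩ := exists_coords (E := E) x.1
  have h1 := laplacian_weight_zero_of_coords σ (inf_le_left : c.dom ⊓ U ≤ c.dom)
    (CoeffForms.res_mem_deg inf_le_right hs) ⟨x.1, hx, x.2⟩
  rw [← laplacian_res] at h1
  exact h1

end Laplacian

/-! ### Division by generators and the eigenvalues of the laplacian -/

section Euler

variable {E : Type*} [NormedAddCommGroup E] [NormedSpace ℝ E] [FiniteDimensional ℝ E]
variable {M : Type*} [TopologicalSpace M] [ChartedSpace E M] [IsManifold 𝓘(ℝ, E) ∞ M] [T2Space M]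
variable {U W : Opens M} (σ : JetSplitting E M)

lemma map_derivation_mem_polySections (D : Derivation ℝ (Fun E M) (Fun E M))
    {t : ∀ x : M, FormFibre E x ⊗[ℝ] Fun E M} (ht : t ∈ polySections E (jetFamily E M)) :
    (fun x => TensorProduct.map LinearMap.id D.toLinearMap (t x)) ∈
      polySections E (jetFamily E M) := by
  refine jet_polySections_induction (P := fun t => (fun x => TensorProduct.map LinearMap.id
    D.toLinearMap (t x)) ∈ polySections E (jetFamily E M)) (fun a l f => ?_)
    (fun s t hs ht => ?_) ht
  · exact jetGraph_fst (jetPair_mem a l (D f))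
  · convert add_mem hs ht using 1
    exact funext fun x => map_add _ _ _

/-- Euler's identity: to leading order, a section of order `k` is a combination of the sections
`σ (dX_a)` with coefficients of order `k - 1`. -/
lemma exists_euler {k : ℕ} {s : JetForms E U}
    (hs : s ∈ CoeffForms.filtration E (jetFamily E M) U (k + 1)) (p : U) :
    ∃ (c : Coords E M) (W : Opens M) (_ : p.1 ∈ W) (hWU : W ≤ U) (_ : W ≤ c.dom)
      (r : Fin (Module.finrank ℝ E) → JetForms E W),
      (∀ a, r a ∈ CoeffForms.filtration E (jetFamily E M) W k) ∧
      ((k + 1 : ℕ) : ℝ) • CoeffForms.res hWU s - ∑ a, σ.sec (dForm (c.X a)) W * r a ∈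
        CoeffForms.filtration E (jetFamily E M) W (k + 2) := by
  obtain ⟨c, hp⟩ := exists_coords (E := E) p.1
  obtain ⟨t, ht, h⟩ := CoeffForms.approx s (k + 2) p
  obtain ⟨W, hpW, hWU, hW⟩ := exists_opens_of_eventually h
  let r : Fin (Module.finrank ℝ E) → polySections E (jetFamily E M) := fun a =>
    ⟨_, map_derivation_mem_polySections (c.D a) ht⟩
  have h1 : ∀ x (hx : x ∈ W), emb E (jetFamily E M) x (t x) ∈ fil (k + 1) x := fun x hx => by
    have := sub_mem (hs ⟨x, hWU hx⟩) (fil_anti (Nat.le_succ (k + 1)) (hW x hx))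
    rwa [sub_sub_cancel] at this
  have h2 : ∀ x (_ : x ∈ W) a, emb E (jetFamily E M) x ((r a).1 x) ∈ fil k x :=
    fun x hx a => emb_mem_fil_iff.2 fun μ => by
      have := derivation_mem_pow _ (c.D a) (emb_mem_fil_iff.1 (h1 x hx) μ)
      have h3 : slice μ ((r a).1 x) = c.D a (slice μ (t x)) :=
        slice_lTensor μ (c.D a).toLinearMap (t x)
      rw [h3]
      exact this
  refine ⟨c, c.dom ⊓ W, ⟨hp, hpW⟩, inf_le_right.trans hWU, inf_le_left,
    fun a => ofPoly (r a) _, fun a x => h2 x.1 x.2.2 a, fun x => ?_⟩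
  have h4 : ((k + 1 : ℕ) : ℝ) • emb E (jetFamily E M) x.1 (t x.1) -
      ∑ a, emb E (jetFamily E M) x.1 (1 ⊗ₜ[ℝ] c.X₀ x.1 a) *
        emb E (jetFamily E M) x.1 ((r a).1 x.1) ∈ fil (k + 2) x.1 := by
    simp_rw [← map_mul, ← map_sum, ← map_smul, ← map_sub]
    refine emb_mem_fil_iff.2 fun μ => ?_
    have h5 := (Coords.isFrame (c := c) x.2.1).euler (emb_mem_fil_iff.1 (h1 x.1 x.2.2) μ)
    have h6 : ∀ (X : Fun E M) (z : FormFibre E x.1 ⊗[ℝ] Fun E M),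
        slice μ ((1 ⊗ₜ[ℝ] X) * z) = X * slice μ z := by
      intro X z
      induction z using TensorProduct.induction_on with
      | zero => simp
      | tmul a b => simp
      | add y z hy hz => rw [mul_add, map_add, map_add, mul_add, hy, hz]
    rw [← neg_mem_iff, neg_sub] at h5
    convert h5 using 1
    refine (map_sub (slice μ) _ _).trans ?_
    congr 1
    · exact map_smul _ _ _
    · refine (map_sum (slice μ) _ _).trans (Finset.sum_congr rfl fun a _ => ?_)
      refine (h6 _ _).trans ?_
      congr 1
      exact slice_lTensor μ (c.D a).toLinearMap (t x.1)
  -- The error has three parts: the approximation error of `s`, the remainder of Euler's identity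
  -- for the functions `X₀`, and the exchange of `X₀` for `σ (dX_a)`. The last is of order two,
  -- multiplied by coefficients of order `k`.
  have h7 : (((k + 1 : ℕ) : ℝ) • CoeffForms.res (inf_le_right.trans hWU) s -
      ∑ a, σ.sec (dForm (c.X a)) (c.dom ⊓ W) * ofPoly (r a) _).1 x =
      ((k + 1 : ℕ) : ℝ) • (s.1 ⟨x.1, hWU x.2.2⟩ - emb E (jetFamily E M) x.1 (t x.1)) +
      (((k + 1 : ℕ) : ℝ) • emb E (jetFamily E M) x.1 (t x.1) -
      ∑ a, emb E (jetFamily E M) x.1 (1 ⊗ₜ[ℝ] c.X₀ x.1 a) *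
        emb E (jetFamily E M) x.1 ((r a).1 x.1)) -
      ∑ a, (CoeffFibre.tmul 1 (σ.toFun x.1 (diffAt (c.X a) x.1)) -
        emb E (jetFamily E M) x.1 (1 ⊗ₜ[ℝ] c.X₀ x.1 a)) *
        emb E (jetFamily E M) x.1 ((r a).1 x.1) := by
    change ((k + 1 : ℕ) : ℝ) • s.1 ⟨x.1, _⟩ - (∑ a, _ : JetForms E (c.dom ⊓ W)).1 x = _
    rw [CoeffForms.sum_apply]
    simp_rw [sub_mul]
    rw [Finset.sum_sub_distrib, smul_sub]
    change _ - ∑ a, CoeffFibre.tmul 1 (σ.toFun x.1 (diffAt (c.X a) x.1)) *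
      emb E (jetFamily E M) x.1 ((r a).1 x.1) = _
    abel
  rw [h7]
  refine sub_mem (add_mem (Submodule.smul_of_tower_mem _ _ (hW x.1 x.2.2)) h4)
    (sum_mem fun a _ => ?_)
  rw [add_comm]
  exact fil_mul_fil (σ.sub_mem_fil (c.X a) x.1) (h2 x.1 x.2.2 a)

lemma exists_euler_deg {k q : ℕ} {s : JetForms E U}
    (hs : s ∈ CoeffForms.filtration E (jetFamily E M) U (k + 1))
    (hq : s ∈ CoeffForms.deg E (jetFamily E M) U q) (p : U) :
    ∃ (c : Coords E M) (W : Opens M) (_ : p.1 ∈ W) (hWU : W ≤ U) (_ : W ≤ c.dom)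
      (r : Fin (Module.finrank ℝ E) → JetForms E W),
      (∀ a, r a ∈ CoeffForms.filtration E (jetFamily E M) W k) ∧
      (∀ a, r a ∈ CoeffForms.deg E (jetFamily E M) W q) ∧
      ((k + 1 : ℕ) : ℝ) • CoeffForms.res hWU s - ∑ a, σ.sec (dForm (c.X a)) W * r a ∈
        CoeffForms.filtration E (jetFamily E M) W (k + 2) := by
  obtain ⟨c, W, hpW, hWU, hc, r, hr, h⟩ := exists_euler σ hs p
  refine ⟨c, W, hpW, hWU, hc, fun a => (degOp E M q).act (r a),
    fun a x => FormOp.fib_mem_fil _ (hr a x), fun a => CoeffForms.degOp_mem_deg q _, ?_⟩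
  have h1 : ((k + 1 : ℕ) : ℝ) • CoeffForms.res hWU s - ∑ a, σ.sec (dForm (c.X a)) W *
      (degOp E M q).act (r a) = (degOp E M q).act
        (((k + 1 : ℕ) : ℝ) • CoeffForms.res hWU s - ∑ a, σ.sec (dForm (c.X a)) W * r a) := by
    rw [map_sub, map_smul, map_sum, CoeffForms.mem_deg_iff.1 (CoeffForms.res_mem_deg hWU hq)]
    congr 1
    refine Finset.sum_congr rfl fun a _ => CoeffForms.ext fun x => ?_
    exact (FormOp.fib_one_tmul_mul _ _ _).symm
  rw [h1]
  exact fun x => FormOp.fib_mem_fil _ (h x)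

/-- On the graded pieces of the filtration, the laplacian is multiplication by a scalar. -/
lemma laplacian_weight {k q : ℕ} {s : JetForms E U}
    (hs : s ∈ CoeffForms.filtration E (jetFamily E M) U k)
    (hq : s ∈ CoeffForms.deg E (jetFamily E M) U q) :
    laplacian σ s + ((k + q : ℕ) : ℝ) • s ∈ CoeffForms.filtration E (jetFamily E M) U (k + 1) := by
  induction k generalizing U with
  | zero =>
    rw [Nat.zero_add q]
    exact laplacian_weight_zero σ hq
  | succ k ih =>
    intro p
    obtain ⟨c, W, hpW, hWU, hc, r, hr, hrq, h⟩ := exists_euler_deg σ hs hq p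
    let S := CoeffForms.res hWU s
    -- Up to the remainder `R` of higher order, `(k + 1) s` is a combination of products `σ (dX_a) *
    -- r a`. By the Leibniz rule weights add: `-1` for the first factor and `-(k + q)` for the
    -- second by induction.
    let R := ((k + 1 : ℕ) : ℝ) • S - ∑ a, σ.sec (dForm (c.X a)) W * r a
    have h1 : ((k + 1 : ℕ) : ℝ) • (laplacian σ S + ((k + 1 + q : ℕ) : ℝ) • S) =
        laplacian σ R + ((k + 1 + q : ℕ) : ℝ) • R +
        ∑ a, ((laplacian σ (σ.sec (dForm (c.X a)) W) + σ.sec (dForm (c.X a)) W) * r a +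
          σ.sec (dForm (c.X a)) W * (laplacian σ (r a) + ((k + q : ℕ) : ℝ) • r a)) := by
      have h2 : ((k + 1 : ℕ) : ℝ) • S = R + ∑ a, σ.sec (dForm (c.X a)) W * r a :=
        (sub_add_cancel _ _).symm
      rw [smul_add, smul_comm, ← map_smul, h2, map_add, map_sum]
      simp_rw [laplacian_mul]
      have h3 : ∀ a, (laplacian σ (σ.sec (dForm (c.X a)) W) + σ.sec (dForm (c.X a)) W) * r a +
          σ.sec (dForm (c.X a)) W * (laplacian σ (r a) + ((k + q : ℕ) : ℝ) • r a) =
          (laplacian σ (σ.sec (dForm (c.X a)) W) * r a +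
            σ.sec (dForm (c.X a)) W * laplacian σ (r a)) +
          ((k + 1 + q : ℕ) : ℝ) • (σ.sec (dForm (c.X a)) W * r a) := by
        intro a
        have h4 : ((k + 1 + q : ℕ) : ℝ) = 1 + ((k + q : ℕ) : ℝ) := by push_cast; ring
        rw [h4, add_smul, one_smul, add_mul, mul_add, mul_smul_comm]
        abel
      have h4 : ∀ (P Q : Fin (Module.finrank ℝ E) → JetForms E W) (b : ℝ),
          ∑ a, (P a + b • Q a) = ∑ a, P a + b • ∑ a, Q a := fun P Q b => by
        rw [Finset.sum_add_distrib, Finset.smul_sum]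
      simp_rw [h3]
      rw [h4, smul_add]
      abel
    have h5 : ((k + 1 : ℕ) : ℝ) • (laplacian σ S + ((k + 1 + q : ℕ) : ℝ) • S) ∈
        CoeffForms.filtration E (jetFamily E M) W (k + 1 + 1) := by
      rw [h1]
      refine add_mem (add_mem (laplacian_mem_filtration σ h) (Submodule.smul_mem _ _ h))
        (sum_mem fun a _ => add_mem ?_ ?_)
      · have := CoeffForms.filtration_mul (i := 2)
          (s := laplacian σ (σ.sec (dForm (c.X a)) W) + σ.sec (dForm (c.X a)) W)
          (fun x => laplacian_sec σ (c.X a) x) (hr a)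
        rwa [add_comm] at this
      · have := CoeffForms.filtration_mul (σ.sec_mem_filtration (U := W) (dForm (c.X a)))
          (ih (hr a) (hrq a))
        rwa [add_comm] at this
    have h6 := Submodule.smul_mem _ (((k + 1 : ℕ) : ℝ)⁻¹) h5
    rw [smul_smul, inv_mul_cancel₀ (by positivity), one_smul, ← laplacian_res] at h6
    exact h6 ⟨p.1, hpW⟩

end Euler


/-! ### Inverting the laplacian; exactness of the jet complex -/

section Exactness

variable {E : Type*} [NormedAddCommGroup E] [NormedSpace ℝ E] [FiniteDimensional ℝ E]
variable {M : Type*} [TopologicalSpace M] [ChartedSpace E M] [IsManifold 𝓘(ℝ, E) ∞ M] [T2Space M]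
variable {U W : Opens M}

/-- The eigenvalue on each graded piece is non-zero, so an element of the kernel gains one order
again and again; the filtration is separated. -/
lemma laplacian_injective (σ : JetSplitting E M) {k q : ℕ} (hkq : 0 < k + q) {s : JetForms E U}
    (hs : s ∈ CoeffForms.filtration E (jetFamily E M) U k)
    (hq : s ∈ CoeffForms.deg E (jetFamily E M) U q) (h : laplacian σ s = 0) : s = 0 := by
  have key : ∀ n, s ∈ CoeffForms.filtration E (jetFamily E M) U (k + n) := by
    intro n
    induction n with
    | zero => exact hs
    | succ n ih =>
      have h1 := laplacian_weight σ ih hq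
      rw [h, zero_add] at h1
      have h2 := Submodule.smul_mem _ (((k + n + q : ℕ) : ℝ)⁻¹) h1
      have h3 : ((k + n + q : ℕ) : ℝ) ≠ 0 := Nat.cast_ne_zero.2 (by omega)
      rwa [smul_smul, inv_mul_cancel₀ h3, one_smul] at h2
  exact CoeffForms.eq_zero_of_mem_filtration fun n =>
    CoeffForms.filtration_anti (Nat.le_add_left n k) (key n)

/-- Successive approximation: dividing the current error by the eigenvalue corrects its leading
term, and completeness provides the limit of the corrections. -/
lemma laplacian_surjective (σ : JetSplitting E M) {k q : ℕ} (hkq : 0 < k + q) {s : JetForms E U}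
    (hs : s ∈ CoeffForms.filtration E (jetFamily E M) U k)
    (hq : s ∈ CoeffForms.deg E (jetFamily E M) U q) :
    ∃ t ∈ CoeffForms.filtration E (jetFamily E M) U k,
      t ∈ CoeffForms.deg E (jetFamily E M) U q ∧ laplacian σ t = s := by
  let F := fun n => CoeffForms.filtration E (jetFamily E M) U n
  let c : ℕ → ℝ := fun n => ((k + n + q : ℕ) : ℝ)
  have hc : ∀ n, c n ≠ 0 := fun n => Nat.cast_ne_zero.2 (by omega)
  -- Here `z n` is the error `s - laplacian σ (Y n)` left after `n` corrections, and `-z n / c n` is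
  -- the next correction.
  let z : ℕ → JetForms E U := fun n =>
    Nat.rec s (fun n z => z + (c n)⁻¹ • laplacian σ z) n
  have hz : ∀ n, z (n + 1) = z n + (c n)⁻¹ • laplacian σ (z n) := fun n => rfl
  have hzq : ∀ n, z n ∈ CoeffForms.deg E (jetFamily E M) U q := by
    intro n
    induction n with
    | zero => exact hq
    | succ n ih =>
      rw [hz]
      exact add_mem ih (Submodule.smul_mem _ _ (laplacian_mem_deg σ ih))
  have hzF : ∀ n, z n ∈ F (k + n) := by
    intro n
    induction n with
    | zero => exact hs
    | succ n ih =>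
      have h1 := Submodule.smul_mem _ ((c n)⁻¹) (laplacian_weight σ ih (hzq n))
      rw [smul_add, smul_smul, inv_mul_cancel₀ (hc n), one_smul, add_comm (_ • laplacian σ (z n))] at h1
      exact h1
  let Y : ℕ → JetForms E U := fun n => ∑ i ∈ Finset.range n, -(c i)⁻¹ • z i
  have hYs : ∀ n, Y (n + 1) = Y n + -(c n)⁻¹ • z n := fun n => Finset.sum_range_succ _ _
  have hYq : ∀ n, Y n ∈ CoeffForms.deg E (jetFamily E M) U q := fun n =>
    sum_mem fun i _ => Submodule.smul_mem _ _ (hzq i)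
  have hYF : ∀ n, Y n ∈ F k := fun n => sum_mem fun i _ => Submodule.smul_mem _ _
    (CoeffForms.filtration_anti (Nat.le_add_right k i) (hzF i))
  have hYz : ∀ n, laplacian σ (Y n) = s - z n := by
    intro n
    induction n with
    | zero => exact (map_zero _).trans (sub_self s).symm
    | succ n ih =>
      rw [hYs, map_add, ih, map_smul, hz, neg_smul]
      abel
  obtain ⟨t, ht⟩ := CoeffForms.exists_limit Y fun n => by
    rw [hYs, add_sub_cancel_left]
    exact Submodule.smul_mem _ _ (CoeffForms.filtration_anti (Nat.le_add_left n k) (hzF n))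
  refine ⟨t, ?_, ?_, ?_⟩
  · have := add_mem (ht k) (hYF k)
    rwa [sub_add_cancel] at this
  · rw [CoeffForms.mem_deg_iff]
    refine sub_eq_zero.1 (CoeffForms.eq_zero_of_mem_filtration fun n => ?_)
    have h1 : (degOp E M q).act t - t = (degOp E M q).act (t - Y n) - (t - Y n) := by
      rw [map_sub, CoeffForms.mem_deg_iff.1 (hYq n)]
      abel
    rw [h1]
    exact sub_mem (fun x => FormOp.fib_mem_fil _ (ht n x)) (ht n)
  · refine sub_eq_zero.1 (CoeffForms.eq_zero_of_mem_filtration fun n => ?_)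
    have h1 : laplacian σ t - s = laplacian σ (t - Y n) - z n := by
      rw [map_sub, hYz]
      abel
    rw [h1]
    exact sub_mem (laplacian_mem_filtration σ (ht n))
      (CoeffForms.filtration_anti (Nat.le_add_left n k) (hzF n))

/-- The de Rham complex of jets is exact in positive degrees. -/
lemma exists_jetD_eq (σ : JetSplitting E M) {q : ℕ} {s : JetForms E U}
    (hq : s ∈ CoeffForms.deg E (jetFamily E M) U (q + 1)) (h : jetD s = 0) :
    ∃ t ∈ CoeffForms.deg E (jetFamily E M) U q,
      t ∈ CoeffForms.filtration E (jetFamily E M) U 1 ∧ jetD t = s := by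
  -- With `s = laplacian σ y`, the closed section `s` forces `jetD y` into the kernel of the
  -- laplacian in positive degree. Hence `y` is closed, and `s` is the differential of `homotopy σ
  -- y`.
  obtain ⟨y, -, hy, hys⟩ := laplacian_surjective σ (k := 0) (by omega)
    (CoeffForms.mem_filtration_zero s) hq
  have h1 : jetD y = 0 := laplacian_injective σ (k := 0) (q := q + 1 + 1) (by omega)
    (CoeffForms.mem_filtration_zero _) (jetD_mem_deg hy) (by rw [laplacian_jetD, hys, h])
  refine ⟨homotopy σ y, homotopy_mem_deg σ hy,
    homotopy_mem_filtration σ (CoeffForms.mem_filtration_zero y), ?_⟩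
  rw [laplacian_eq, h1, map_zero, zero_add] at hys
  exact hys

/-- A horizontal section of degree zero and positive order vanishes. -/
lemma eq_zero_of_jetD_eq_zero (σ : JetSplitting E M) {s : JetForms E U}
    (hq : s ∈ CoeffForms.deg E (jetFamily E M) U 0)
    (hs : s ∈ CoeffForms.filtration E (jetFamily E M) U 1) (h : jetD s = 0) : s = 0 :=
  laplacian_injective σ (k := 1) (by omega) hs hq (by
    rw [laplacian_eq, h, homotopy_of_deg_zero σ hq, map_zero, map_zero, add_zero])

/-- Sections of degree zero and order `k + 1` are combinations of the sections `σ (dX_a)`, with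
coefficients of order `k`. -/
lemma exists_division (σ : JetSplitting E M) {k : ℕ} {s : JetForms E U}
    (hs : s ∈ CoeffForms.filtration E (jetFamily E M) U (k + 1))
    (hq : s ∈ CoeffForms.deg E (jetFamily E M) U 0) {c : Coords E M} (hU : U ≤ c.dom) :
    ∃ r : Fin (Module.finrank ℝ E) → JetForms E U,
      (∀ a, r a ∈ CoeffForms.filtration E (jetFamily E M) U k) ∧
      (∀ a, r a ∈ CoeffForms.deg E (jetFamily E M) U 0) ∧
      s = ∑ a, σ.sec (dForm (c.X a)) U * r a := by
  -- In degree zero the laplacian of `y` is `homotopy σ (jetD y)`, which is visibly a combination of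
  -- the `σ (dX_a)`; the coefficients are the contractions of `jetD y`.
  obtain ⟨y, hy, hyq, hys⟩ := laplacian_surjective σ (by omega) hs hq
  refine ⟨fun a => (contractOp (c.v a)).act (jetD y),
    fun a x => FormOp.fib_mem_fil _ (jetD_mem_filtration hy x),
    fun a x => contract_fib_mem_deg _ (jetD_mem_deg hyq x), ?_⟩
  rw [← hys, laplacian_eq, homotopy_of_deg_zero σ hyq, map_zero, add_zero, homotopy_eq σ hU]

end Exactness


/-! ### The frame of the symmetric algebra -/

section SymmetricFrame

variable {V : Type*} [AddCommGroup V] [Module ℝ V]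

lemma exists_symmetric_derivation [FiniteDimensional ℝ V] (d : Module.Dual ℝ V) :
    ∃ D : Derivation ℝ (SymmetricAlgebra ℝ V) (SymmetricAlgebra ℝ V),
      ∀ v, D (SymmetricAlgebra.ι ℝ V v) = algebraMap ℝ _ (d v) := by
  let b := Module.finBasis ℝ V
  let e := SymmetricAlgebra.equivMvPolynomial b
  let D₀ := MvPolynomial.mkDerivation ℝ (A := MvPolynomial (Fin (Module.finrank ℝ V)) ℝ)
    (fun i => algebraMap ℝ (MvPolynomial (Fin (Module.finrank ℝ V)) ℝ) (d (b i)))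
  let D := Derivation.mk' (e.symm.toLinearMap ∘ₗ D₀.toLinearMap ∘ₗ e.toLinearMap) fun f g => by
    change e.symm (D₀ (e (f * g))) = f * e.symm (D₀ (e g)) + g * e.symm (D₀ (e f))
    rw [map_mul, Derivation.leibniz, map_add, smul_eq_mul, smul_eq_mul, map_mul, map_mul,
      AlgEquiv.symm_apply_apply, AlgEquiv.symm_apply_apply]
  have h : D.toLinearMap ∘ₗ SymmetricAlgebra.ι ℝ V =
      (Algebra.linearMap ℝ (SymmetricAlgebra ℝ V)) ∘ₗ d := by
    refine b.ext fun i => ?_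
    change e.symm (D₀ (e (SymmetricAlgebra.ι ℝ V (b i)))) = algebraMap ℝ _ (d (b i))
    rw [SymmetricAlgebra.equivMvPolynomial_ι_apply, MvPolynomial.mkDerivation_X, AlgEquiv.commutes]
  exact ⟨D, fun v => LinearMap.congr_fun h v⟩

/-- This is the first-order Taylor expansion at the origin, by induction over the algebra. For a
product the new remainder is `(P - ε P) * (Q - ε Q)`, which lies in the square of the augmentation
ideal. -/
lemma isFrame_symmetric {κ : Type*} [Fintype κ] {e : κ → V} {d : κ → Module.Dual ℝ V}
    (h : ∀ v, ∑ a, d a v • e a = v)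
    {D : κ → Derivation ℝ (SymmetricAlgebra ℝ V) (SymmetricAlgebra ℝ V)}
    (hD : ∀ a v, D a (SymmetricAlgebra.ι ℝ V v) = algebraMap ℝ _ (d a v)) :
    IsFrame SymmetricAlgebra.algebraMapInv (fun a => SymmetricAlgebra.ι ℝ V (e a)) D := by
  let ε : SymmetricAlgebra ℝ V →ₐ[ℝ] ℝ := SymmetricAlgebra.algebraMapInv
  have hε : ∀ P, P - algebraMap ℝ _ (ε P) ∈ RingHom.ker ε := fun P => sub_algebraMap_mem_ker ε P
  have key : ∀ P, P - algebraMap ℝ _ (ε P) - ∑ a, ε (D a P) • SymmetricAlgebra.ι ℝ V (e a) ∈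
      RingHom.ker ε ^ 2 := by
    intro P
    induction P using SymmetricAlgebra.induction with
    | algebraMap r =>
      simp [ε]
    | ι v =>
      have h1 : ε (SymmetricAlgebra.ι ℝ V v) = 0 := SymmetricAlgebra.algebraMapInv_ι v
      have h2 : ∑ a, ε (D a (SymmetricAlgebra.ι ℝ V v)) • SymmetricAlgebra.ι ℝ V (e a) =
          SymmetricAlgebra.ι ℝ V v := by
        conv_rhs => rw [← h v]
        rw [map_sum]
        refine Finset.sum_congr rfl fun a _ => ?_
        rw [hD, AlgHom.commutes, map_smul]
        rfl
      rw [h1, h2, map_zero, sub_zero, sub_self]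
      exact zero_mem _
    | add P Q hP hQ =>
      convert add_mem hP hQ using 1
      simp only [map_add, add_smul, Finset.sum_add_distrib]
      abel
    | mul P Q hP hQ =>
      have h1 : P * Q - algebraMap ℝ _ (ε (P * Q)) -
          ∑ a, ε (D a (P * Q)) • SymmetricAlgebra.ι ℝ V (e a) =
          (P - algebraMap ℝ _ (ε P)) * (Q - algebraMap ℝ _ (ε Q)) +
          algebraMap ℝ _ (ε P) * (Q - algebraMap ℝ _ (ε Q) -
            ∑ a, ε (D a Q) • SymmetricAlgebra.ι ℝ V (e a)) +
          algebraMap ℝ _ (ε Q) * (P - algebraMap ℝ _ (ε P) -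
            ∑ a, ε (D a P) • SymmetricAlgebra.ι ℝ V (e a)) := by
        have h2 : ∑ a, ε (D a (P * Q)) • SymmetricAlgebra.ι ℝ V (e a) =
            algebraMap ℝ _ (ε P) * ∑ a, ε (D a Q) • SymmetricAlgebra.ι ℝ V (e a) +
            algebraMap ℝ _ (ε Q) * ∑ a, ε (D a P) • SymmetricAlgebra.ι ℝ V (e a) := by
          rw [Finset.mul_sum, Finset.mul_sum, ← Finset.sum_add_distrib]
          refine Finset.sum_congr rfl fun a _ => ?_
          rw [Derivation.leibniz, map_add, smul_eq_mul, smul_eq_mul, map_mul, map_mul, add_smul,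
            mul_smul, mul_smul, Algebra.smul_def (ε P), Algebra.smul_def (ε Q)]
        rw [h2, map_mul, map_mul]
        ring
      rw [h1]
      refine add_mem (add_mem ?_ (Ideal.mul_mem_left _ _ hQ)) (Ideal.mul_mem_left _ _ hP)
      rw [pow_two]
      exact Ideal.mul_mem_mul (hε P) (hε Q)
  refine ⟨fun a => SymmetricAlgebra.algebraMapInv_ι (e a), fun P hP => ?_⟩
  have h1 := key P
  rw [show ε P = 0 from hP, map_zero, sub_zero] at h1
  exact h1

end SymmetricFrame

/-! ### From the completed symmetric algebra to jets, at a point -/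

section FibreIso

variable {E : Type*} [NormedAddCommGroup E] [NormedSpace ℝ E] [FiniteDimensional ℝ E]
variable {M : Type*} [TopologicalSpace M] [ChartedSpace E M] [IsManifold 𝓘(ℝ, E) ∞ M] [T2Space M]
variable (σ : JetSplitting E M) {x : M}

/-- The derivations with constant coefficients on polynomials correspond under `φ`, to first order
at `x`, to the coordinate derivations of functions. So `IsFrame.mem_pow_of_map` applies: a
polynomial has at least the order of the function it defines. -/
lemma mem_pow_of_representative {φ : SymmetricAlgebra ℝ (Cotangent E x) →ₐ[ℝ] Fun E M}
    (h : ∀ ξ, φ (SymmetricAlgebra.ι ℝ _ ξ) x = 0 ∧ diffAt (φ (SymmetricAlgebra.ι ℝ _ ξ)) x = ξ)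
    {k : ℕ} {P : SymmetricAlgebra ℝ (Cotangent E x)}
    (hP : φ P ∈ RingHom.ker (evalAt (E := E) x) ^ k) :
    P ∈ RingHom.ker (SymmetricAlgebra.algebraMapInv (R := ℝ) (M := Cotangent E x)) ^ k := by
  obtain ⟨c, hx⟩ := exists_coords (E := E) x
  choose D hD using fun a => exists_symmetric_derivation (V := Cotangent E x)
    { toFun := fun ξ => ξ (c.v a x), map_add' := fun _ _ => rfl, map_smul' := fun _ _ => rfl }
  have hF := isFrame_symmetric (fun ξ => Coords.sum_dX hx ξ) hD
  have hε : ∀ P, evalAt x (φ P) = SymmetricAlgebra.algebraMapInv P := by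
    have : (evalAt x).comp φ = SymmetricAlgebra.algebraMapInv :=
      SymmetricAlgebra.algHom_ext (LinearMap.ext fun ξ =>
        ((h ξ).1.trans (SymmetricAlgebra.algebraMapInv_ι ξ).symm))
    exact fun P => AlgHom.congr_fun this P
  refine hF.mem_pow_of_map (D' := c.D) hε (fun a P => ?_) hP
  rw [RingHom.mem_ker, map_sub, sub_eq_zero]
  induction P using SymmetricAlgebra.induction with
  | algebraMap r => rw [AlgHom.commutes, Derivation.map_algebraMap, Derivation.map_algebraMap,
      map_zero, map_zero, map_zero]
  | ι ξ =>
    rw [hD, AlgHom.commutes, AlgHom.commutes]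
    change diffAt (φ (SymmetricAlgebra.ι ℝ _ ξ)) x (c.v a x) = ξ (c.v a x)
    rw [(h ξ).2]
  | mul P Q hP hQ => simp only [map_mul, Derivation.leibniz, map_add, smul_eq_mul, hP, hQ]
  | add P Q hP hQ => simp only [map_add, hP, hQ]

variable (E M) in
/-- The symmetric algebras of the cotangent spaces. -/
abbrev cotangentFamily : AugFamily M := symFamily E E (Tangent E M)

/-- The homomorphism from the symmetric algebra to jets defined by a splitting. -/
def symToJet (σ : JetSplitting E M) (x : M) : (cotangentFamily E M).Alg x →ₐ[ℝ] Jet E x :=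
  SymmetricAlgebra.lift (σ.toFun x)

lemma symToJet_ι (ξ : Cotangent E x) :
    symToJet σ x (SymmetricAlgebra.ι ℝ _ ξ) = σ.toFun x ξ := SymmetricAlgebra.lift_ι_apply _ _

lemma evalₐ_symToJet_eq_zero {k : ℕ} {P : (cotangentFamily E M).Alg x}
    (hP : P ∈ (cotangentFamily E M).ideal x ^ k) :
    AdicCompletion.evalₐ ((jetFamily E M).ideal x) k (symToJet σ x P) = 0 := by
  induction k generalizing P with
  | zero =>
    refine (one_tmul_mem_fil_iff (E := E)).1 ?_
    rw [fil_zero]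
    exact Submodule.mem_top
  | succ k ih =>
    rw [pow_succ] at hP
    induction hP using Submodule.mul_induction_on' with
    | mem_mul_mem P hP Q hQ =>
      rw [map_mul]
      refine evalₐ_mul_eq_zero _ (ih hP) ?_
      have h : ((AdicCompletion.evalₐ ((jetFamily E M).ideal x) 1).restrictScalars ℝ).comp
          (symToJet σ x) = (Algebra.ofId ℝ _).comp SymmetricAlgebra.algebraMapInv := by
        refine SymmetricAlgebra.algHom_ext (LinearMap.ext fun ξ => ?_)
        change AdicCompletion.evalₐ ((jetFamily E M).ideal x) 1
          (symToJet σ x (SymmetricAlgebra.ι ℝ _ ξ)) =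
          algebraMap ℝ _ (SymmetricAlgebra.algebraMapInv (SymmetricAlgebra.ι ℝ _ ξ))
        rw [SymmetricAlgebra.algebraMapInv_ι, map_zero, symToJet_ι]
        exact one_tmul_mem_fil_iff.1 (σ.mem_fil_one x ξ)
      have h1 := AlgHom.congr_fun h Q
      refine h1.trans ?_
      change algebraMap ℝ _ (SymmetricAlgebra.algebraMapInv Q) = _
      rw [show SymmetricAlgebra.algebraMapInv Q = (0 : ℝ) from hQ, map_zero]
    | add P _ Q _ hP hQ => rw [map_add, map_add, hP, hQ, add_zero]

/-- The linear map `σ` modulo `𝔪^k` lifts to functions because vector spaces are projective, and the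
lift extends to the free algebra `Sym`. The comparison of orders can then take place before
completion. -/
lemma exists_representative (k : ℕ) (x : M) :
    ∃ φ : (cotangentFamily E M).Alg x →ₐ[ℝ] Fun E M, ∀ P,
      AdicCompletion.evalₐ ((jetFamily E M).ideal x) k (symToJet σ x P) =
        Ideal.Quotient.mk _ (φ P) := by
  let ev := (AdicCompletion.evalₐ ((jetFamily E M).ideal x) k).restrictScalars ℝ
  let mk := Ideal.Quotient.mkₐ ℝ ((jetFamily E M).ideal x ^ k)
  obtain ⟨f, hf⟩ := Module.projective_lifting_property mk.toLinearMap
    (ev.toLinearMap ∘ₗ σ.toFun x) (Ideal.Quotient.mkₐ_surjective ℝ _)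
  refine ⟨SymmetricAlgebra.lift f, fun P => ?_⟩
  have h : ev.comp (symToJet σ x) = mk.comp (SymmetricAlgebra.lift f) := by
    refine SymmetricAlgebra.algHom_ext (LinearMap.ext fun ξ => ?_)
    change ev (symToJet σ x (SymmetricAlgebra.ι ℝ _ ξ)) =
      mk (SymmetricAlgebra.lift f (SymmetricAlgebra.ι ℝ _ ξ))
    rw [symToJet_ι, SymmetricAlgebra.lift_ι_apply]
    exact (LinearMap.congr_fun hf ξ).symm
  exact AlgHom.congr_fun h P

lemma evalₐ_symToJet_eq_zero_iff {k : ℕ} {P : (cotangentFamily E M).Alg x} :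
    AdicCompletion.evalₐ ((jetFamily E M).ideal x) k (symToJet σ x P) = 0 ↔
      P ∈ (cotangentFamily E M).ideal x ^ k := by
  refine ⟨fun hP => ?_, evalₐ_symToJet_eq_zero σ⟩
  -- Level `k + 2` is high enough both for order `k` and for level `2`, at which the condition
  -- `split` is stated.
  obtain ⟨φ, hφ⟩ := exists_representative σ (k + 2) x
  have hle : ∀ j ≤ k + 2, ∀ P, AdicCompletion.evalₐ ((jetFamily E M).ideal x) j
      (symToJet σ x P) = Ideal.Quotient.mk _ (φ P) := fun j hj P => by
    rw [← evalₐ_factor _ hj, hφ, Ideal.Quotient.factor_mk]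
  have h2 : ∀ ξ, φ (SymmetricAlgebra.ι ℝ _ ξ) x = 0 ∧
      diffAt (φ (SymmetricAlgebra.ι ℝ _ ξ)) x = ξ := fun ξ => σ.split x ξ _
    ((congrArg _ (symToJet_ι σ ξ)).symm.trans (hle 2 (by omega) _))
  rw [hle k (by omega), Ideal.Quotient.eq_zero_iff_mem] at hP
  exact mem_pow_of_representative h2 hP

/-- The homomorphism `Sym / I^k → C^∞(M) / 𝔪^k`. -/
def levelMap (k : ℕ) (x : M) :
    (cotangentFamily E M).Alg x ⧸ (cotangentFamily E M).ideal x ^ k →ₐ[ℝ]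
      Fun E M ⧸ (jetFamily E M).ideal x ^ k :=
  Ideal.Quotient.liftₐ _ (((AdicCompletion.evalₐ ((jetFamily E M).ideal x) k).restrictScalars
    ℝ).comp (symToJet σ x)) fun _ hP => evalₐ_symToJet_eq_zero σ hP

lemma levelMap_mk (k : ℕ) (P : (cotangentFamily E M).Alg x) :
    levelMap σ k x (Ideal.Quotient.mk _ P) =
      AdicCompletion.evalₐ ((jetFamily E M).ideal x) k (symToJet σ x P) := rfl

lemma levelMap_compat {m n : ℕ} (hle : m ≤ n) :
    (Ideal.Quotient.factorₐ ℝ (Ideal.pow_le_pow_right hle)).comp ((levelMap σ n x).comp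
      ((AdicCompletion.evalₐ ((cotangentFamily E M).ideal x) n).restrictScalars ℝ)) =
    (levelMap σ m x).comp
      ((AdicCompletion.evalₐ ((cotangentFamily E M).ideal x) m).restrictScalars ℝ) :=
  AlgHom.ext fun z => by
    change Ideal.Quotient.factor (Ideal.pow_le_pow_right hle)
      (levelMap σ n x (AdicCompletion.evalₐ _ n z)) = levelMap σ m x (AdicCompletion.evalₐ _ m z)
    obtain ⟨P, hP⟩ := Ideal.Quotient.mk_surjective
      (AdicCompletion.evalₐ ((cotangentFamily E M).ideal x) n z)
    rw [← evalₐ_factor _ hle z, ← hP, levelMap_mk, evalₐ_factor _ hle, Ideal.Quotient.factor_mk,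
      levelMap_mk]

/-- The homomorphism from the completed symmetric algebra to jets. -/
def completedToJet (x : M) : (cotangentFamily E M).Completed x →ₐ[ℝ] Jet E x :=
  AdicCompletion.liftAlgHom _ (fun k => (levelMap σ k x).comp
    ((AdicCompletion.evalₐ ((cotangentFamily E M).ideal x) k).restrictScalars ℝ))
    (levelMap_compat σ)

lemma evalₐ_completedToJet (k : ℕ) (z : (cotangentFamily E M).Completed x) :
    AdicCompletion.evalₐ ((jetFamily E M).ideal x) k (completedToJet σ x z) =
      levelMap σ k x (AdicCompletion.evalₐ _ k z) :=
  AdicCompletion.evalₐ_liftAlgHom _ _ (levelMap_compat σ) k z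

lemma completedToJet_of (P : (cotangentFamily E M).Alg x) :
    completedToJet σ x (AdicCompletion.of _ _ P) = symToJet σ x P :=
  AdicCompletion.ext_evalₐ fun k => by
    rw [evalₐ_completedToJet, AdicCompletion.evalₐ_of, levelMap_mk]

lemma evalₐ_completedToJet_eq_zero_iff {k : ℕ} {z : (cotangentFamily E M).Completed x} :
    AdicCompletion.evalₐ ((jetFamily E M).ideal x) k (completedToJet σ x z) = 0 ↔
      AdicCompletion.evalₐ ((cotangentFamily E M).ideal x) k z = 0 := by
  obtain ⟨P, hP⟩ := Ideal.Quotient.mk_surjective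
    (AdicCompletion.evalₐ ((cotangentFamily E M).ideal x) k z)
  rw [evalₐ_completedToJet, ← hP, levelMap_mk, evalₐ_symToJet_eq_zero_iff,
    Ideal.Quotient.eq_zero_iff_mem]

/-- The homomorphism of fibres of the Chevalley-Eilenberg complex and of the de Rham complex of
jets. -/
def ceToJetFib (x : M) : CoeffFibre E (cotangentFamily E M) x →ₐ[ℝ]
    CoeffFibre E (jetFamily E M) x :=
  Algebra.TensorProduct.map (AlgHom.id ℝ (FormFibre E x)) (completedToJet σ x)

lemma ceToJetFib_tmul (a : FormFibre E x) (b : (cotangentFamily E M).Completed x) :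
    ceToJetFib σ x (CoeffFibre.tmul a b) = CoeffFibre.tmul a (completedToJet σ x b) := rfl

lemma comp_ceToJetFib (μ : Module.Dual ℝ (FormFibre E x))
    (z : CoeffFibre E (cotangentFamily E M) x) :
    comp μ (ceToJetFib σ x z) = completedToJet σ x (comp μ z) :=
  slice_lTensor μ (completedToJet σ x).toLinearMap z

lemma ceToJetFib_mem_fil_iff {k : ℕ} {z : CoeffFibre E (cotangentFamily E M) x} :
    ceToJetFib σ x z ∈ fil k x ↔ z ∈ fil k x := by
  rw [mem_fil_iff, mem_fil_iff]
  refine forall_congr' fun μ => ?_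
  rw [comp_ceToJetFib, evalₐ_completedToJet_eq_zero_iff]

lemma ceToJetFib_injective (x : M) : Function.Injective (ceToJetFib σ x) :=
  (injective_iff_map_eq_zero _).2 fun z hz => eq_zero_of_mem_fil fun k => by
    rw [← ceToJetFib_mem_fil_iff σ, hz]
    exact zero_mem _

lemma fib_ceToJetFib (T : FormOp E M) (z : CoeffFibre E (cotangentFamily E M) x) :
    T.fib _ x (ceToJetFib σ x z) = ceToJetFib σ x (T.fib _ x z) := by
  induction z using coeff_induction with
  | h0 => simp
  | ht a b => rfl
  | ha y z hy hz => rw [map_add, map_add, map_add, map_add, hy, hz]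

end FibreIso


/-! ### The isomorphism of sheaves of graded algebras -/

section SheafIso

variable {E : Type*} [NormedAddCommGroup E] [NormedSpace ℝ E] [FiniteDimensional ℝ E]
variable {M : Type*} [TopologicalSpace M] [ChartedSpace E M] [IsManifold 𝓘(ℝ, E) ∞ M] [T2Space M]
variable {U W : Opens M}

lemma mem_of_eq_of_mem {α S : Type*} [Membership α S] {s : S} {a b : α} (h : a = b) (hb : b ∈ s) :
    a ∈ s := h ▸ hb

lemma ofForms_apply {A : AugFamily M} (w : Forms E U) (x : U) :
    (ofForms E A U w).1 x = CoeffFibre.tmul (w.1 x) 1 := rfl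

lemma restrict_mem_forms {t : ∀ x : M, FormFibre E x} (ht : t ∈ polyForms E M) :
    (fun x : U => t x.1) ∈ Forms E U := fun _ => ⟨t, ht, Filter.Eventually.of_forall fun _ => rfl⟩

lemma ceToJetFib_linear (σ : JetSplitting E M) {x : M} (ξ : Cotangent E x) :
    ceToJetFib σ x (emb E _ x (TensorProduct.tmul (N := (cotangentFamily E M).Alg x) ℝ 1
      (SymmetricAlgebra.ι ℝ (Cotangent E x) ξ))) = CoeffFibre.tmul 1 (σ.toFun x ξ) :=
  (congrArg _ (emb_tmul _ _)).trans ((ceToJetFib_tmul σ _ _).trans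
    (congrArg _ ((completedToJet_of σ _).trans (symToJet_ι σ _))))

lemma ceToJetFib_poly_mem (σ : JetSplitting E M)
    {t : ∀ x : M, FormFibre E x ⊗[ℝ] (cotangentFamily E M).Alg x}
    (ht : t ∈ polySections E (cotangentFamily E M)) :
    (fun x : U => ceToJetFib σ x.1 (emb E _ x.1 (t x.1))) ∈ coeffSubalgebra E (jetFamily E M) U := by
  induction ht using Algebra.adjoin_induction with
  | mem t ht =>
    rcases ht with ⟨w, hw, rfl⟩ | ⟨g, ⟨l, hl, rfl⟩, rfl⟩
    · refine mem_of_eq_of_mem (funext fun x => ?_) (ofForms E (jetFamily E M) U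
        ⟨_, restrict_mem_forms (Algebra.subset_adjoin hw)⟩).2
      rw [emb_tmul, ceToJetFib_tmul, ofForms_apply]
      exact congrArg _ (map_one (completedToJet σ x.1))
    · refine mem_of_eq_of_mem (funext fun x => ?_) (σ.sec ⟨l, hl⟩ U).2
      exact ceToJetFib_linear σ (l x.1)
  | algebraMap r =>
    convert Subalgebra.algebraMap_mem (coeffSubalgebra E (jetFamily E M) U) r using 1
    funext x
    exact (congrArg _ ((emb E _ x.1).commutes r)).trans ((ceToJetFib σ x.1).commutes r)
  | add s t _ _ hs ht =>
    convert add_mem hs ht using 1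
    funext x
    exact (congrArg _ (map_add (emb E _ x.1) _ _)).trans (map_add (ceToJetFib σ x.1) _ _)
  | mul s t _ _ hs ht =>
    convert mul_mem hs ht using 1
    funext x
    exact (congrArg _ (map_mul (emb E _ x.1) _ _)).trans (map_mul (ceToJetFib σ x.1) _ _)

/-- The homomorphism from the completed symmetric algebra over forms to forms with values in
jets. -/
def ceToJet (σ : JetSplitting E M) (U : Opens M) : CE E E (Tangent E M) U →ₐ[ℝ] JetForms E U where
  toFun s := ⟨fun x => ceToJetFib σ x.1 (s.1 x), mem_coeff_of_approx fun k p => by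
    obtain ⟨t, ht, h⟩ := CoeffForms.approx s k p
    obtain ⟨W, hp, hWU, hW⟩ := exists_opens_of_eventually h
    refine ⟨W, hp, ⟨_, ceToJetFib_poly_mem σ ht⟩, fun x hU hxW => ?_⟩
    have := (ceToJetFib_mem_fil_iff σ).2 (hW x hxW)
    rwa [map_sub] at this⟩
  map_one' := CoeffForms.ext fun x => map_one (ceToJetFib σ x.1)
  map_mul' _ _ := CoeffForms.ext fun x => map_mul (ceToJetFib σ x.1) _ _
  map_zero' := CoeffForms.ext fun x => map_zero (ceToJetFib σ x.1)
  map_add' _ _ := CoeffForms.ext fun x => map_add (ceToJetFib σ x.1) _ _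
  commutes' r := CoeffForms.ext fun x => (ceToJetFib σ x.1).commutes r

lemma ceToJet_injective (σ : JetSplitting E M) : Function.Injective (ceToJet σ U) := fun _ _ h =>
  CoeffForms.ext fun x => ceToJetFib_injective σ x.1 (congrArg (fun u : JetForms E U => u.1 x) h)

/-- To order one the jet of `f` at `x` is the number `f x`, so the representative `a ⊗ f` may be
replaced by the function `a * f`. This starts the approximation of jets by polynomials in `σ`. -/
lemma exists_form_approx {t : ∀ x : M, FormFibre E x ⊗[ℝ] Fun E M}
    (ht : t ∈ polySections E (jetFamily E M)) : ∃ w ∈ polyForms E M, ∀ x,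
      emb E (jetFamily E M) x (t x) - CoeffFibre.tmul (w x) 1 ∈ fil 1 x := by
  refine jet_polySections_induction (P := fun t => ∃ w ∈ polyForms E M, ∀ x,
      emb E (jetFamily E M) x (t x) - CoeffFibre.tmul (w x) 1 ∈ fil 1 x) (fun a l f => ?_) ?_ ht
  · refine ⟨_, smul_mem_polyForms (a * f) (wedge_mem_polyForms l), fun x => ?_⟩
    have h1 : emb E (jetFamily E M) x ((a x • wedge l x) ⊗ₜ f) -
        CoeffFibre.tmul ((a * f) x • wedge l x) 1 =
        emb E (jetFamily E M) x ((a x • wedge l x) ⊗ₜ (f - algebraMap ℝ (Fun E M) (f x))) := by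
      rw [TensorProduct.tmul_sub, map_sub]
      congr 1
      rw [Algebra.algebraMap_eq_smul_one, ← TensorProduct.smul_tmul, smul_smul, mul_comm (f x)]
      rfl
    rw [h1, emb_tmul]
    refine tmul_mem_fil _ ?_
    rw [AdicCompletion.evalₐ_of, Ideal.Quotient.eq_zero_iff_mem, pow_one]
    exact sub_algebraMap_mem_ker (evalAt x) f
  · rintro s t ⟨w, hw, h⟩ ⟨z, hz, h'⟩
    refine ⟨w + z, add_mem hw hz, fun x => ?_⟩
    have := add_mem (h x) (h' x)
    rw [sub_add_sub_comm, ← map_add] at this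
    refine mem_of_eq_of_mem ?_ this
    exact congrArg _ (TensorProduct.add_tmul _ _ _)

lemma eventually_forall_mem {p : U} {P : U → Prop} (h : ∀ᶠ x in 𝓝 p, P x) :
    ∀ᶠ x in 𝓝 p.1, ∀ hx : x ∈ U, P ⟨x, hx⟩ := by
  obtain ⟨W, hp, hWU, hW⟩ := exists_opens_of_eventually h
  filter_upwards [W.isOpen.mem_nhds hp] with x hx _
  exact hW x hx

/-- The differential of a function, as a family of linear elements of the symmetric algebras. -/
def symDiff (f : Fun E M) (x : M) : FormFibre E x ⊗[ℝ] (cotangentFamily E M).Alg x :=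
  TensorProduct.tmul (N := (cotangentFamily E M).Alg x) ℝ 1
    (SymmetricAlgebra.ι ℝ (Cotangent E x) (diffAt f x))

lemma symDiff_mem (f : Fun E M) : symDiff f ∈ polySections E (cotangentFamily E M) :=
  Algebra.subset_adjoin (Or.inr ⟨_, ⟨_, (dForm f).2, rfl⟩, rfl⟩)

lemma ceToJetFib_symDiff (σ : JetSplitting E M) (f : Fun E M) (x : M) :
    ceToJetFib σ x (emb E _ x (symDiff f x)) =
      CoeffFibre.tmul 1 (σ.toFun x (diffAt f x)) := by
  exact ceToJetFib_linear σ _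

lemma ceToJetFib_euler {ι : Type*} [Fintype ι] (σ : JetSplitting E M) (X : ι → Fun E M) (r : ℝ)
    (t₀ : ∀ x : M, FormFibre E x ⊗[ℝ] (cotangentFamily E M).Alg x)
    (t : ι → ∀ x : M, FormFibre E x ⊗[ℝ] (cotangentFamily E M).Alg x) (x : M) :
    ceToJetFib σ x (emb E _ x ((t₀ + r • ∑ a, symDiff (X a) * t a) x)) =
      ceToJetFib σ x (emb E _ x (t₀ x)) + r • ∑ a,
        CoeffFibre.tmul 1 (σ.toFun x (diffAt (X a) x)) * ceToJetFib σ x (emb E _ x (t a x)) := by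
  have h1 : (t₀ + r • ∑ a, symDiff (X a) * t a) x =
      t₀ x + r • ∑ a, symDiff (X a) x * t a x := by
    rw [Pi.add_apply, Pi.smul_apply, Finset.sum_apply]
    rfl
  rw [h1, map_add, map_add, map_smul, map_smul, map_sum, map_sum]
  congr 2
  refine Finset.sum_congr rfl fun a _ => ?_
  rw [map_mul, map_mul, ceToJetFib_symDiff]

/-- Modulo each power of the maximal ideal, sections of jets are locally polynomials in the
splitting. -/
lemma exists_ce_approx (σ : JetSplitting E M) (k : ℕ) (s : JetForms E U) (p : U) :
    ∃ t ∈ polySections E (cotangentFamily E M), ∀ᶠ x in 𝓝 p.1, ∀ hx : x ∈ U,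
      s.1 ⟨x, hx⟩ - ceToJetFib σ x (emb E _ x (t x)) ∈ fil k x := by
  induction k generalizing U with
  | zero =>
    refine ⟨0, zero_mem _, Filter.Eventually.of_forall fun x hx => ?_⟩
    rw [fil_zero]
    exact Submodule.mem_top
  | succ k ih =>
    -- Passing to order `1` uses `exists_form_approx`; Euler's identity requires an error of
    -- positive order, by which it divides.
    rcases k with - | j
    · obtain ⟨t, ht, h⟩ := CoeffForms.approx s 1 p
      obtain ⟨w, hw, hwt⟩ := exists_form_approx ht
      refine ⟨_, tmul_one_mem_polySections E (cotangentFamily E M) w hw, ?_⟩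
      filter_upwards [eventually_forall_mem h] with x hx hU
      have := add_mem (hx hU) (hwt x)
      rw [sub_add_sub_cancel] at this
      rw [emb_tmul, ceToJetFib_tmul]
      exact mem_of_eq_of_mem (congrArg (fun z => s.1 ⟨x, hU⟩ - CoeffFibre.tmul (w x) z)
        (map_one (completedToJet σ x))) this
    · obtain ⟨t₀, ht₀, h₀⟩ := ih s p
      obtain ⟨N, hN, hNo, hpN⟩ := eventually_nhds_iff.1 h₀
      let V : Opens M := ⟨N, hNo⟩ ⊓ U
      let r : JetForms E V := CoeffForms.res inf_le_right s - ⟨_, ceToJetFib_poly_mem σ ht₀⟩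
      have hr : r ∈ CoeffForms.filtration E (jetFamily E M) V (j + 1) := fun x =>
        hN x.1 x.2.1 x.2.2
      -- The error of the previous approximation is a combination of the `σ (dX_a)` up to higher
      -- order. Approximating its coefficients to the previous order suffices, since `σ (dX_a)`
      -- supplies one more.
      obtain ⟨c, W, hpW, hWV, hc, ra, -, hE⟩ := exists_euler σ hr ⟨p.1, hpN, p.2⟩
      choose ta hta ha using fun a => ih (ra a) ⟨p.1, hpW⟩
      refine ⟨t₀ + ((j + 1 : ℕ) : ℝ)⁻¹ • ∑ a, symDiff (c.X a) * ta a,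
        add_mem ht₀ (Subalgebra.smul_mem _ (sum_mem fun a _ =>
          mul_mem (symDiff_mem _) (hta a)) _), ?_⟩
      filter_upwards [Filter.eventually_all.2 ha, W.isOpen.mem_nhds hpW] with x hx hxW hU
      rw [ceToJetFib_euler]
      have hcj : ((j + 1 : ℕ) : ℝ) ≠ 0 := Nat.cast_ne_zero.2 (by omega)
      have h3 := hE ⟨x, hxW⟩
      have h4 : (((j + 1 : ℕ) : ℝ) • CoeffForms.res hWV r -
            ∑ a, σ.sec (dForm (c.X a)) W * ra a).1 ⟨x, hxW⟩ =
            ((j + 1 : ℕ) : ℝ) • (s.1 ⟨x, hU⟩ - ceToJetFib σ x (emb E _ x (t₀ x))) -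
            ∑ a, CoeffFibre.tmul 1 (σ.toFun x (diffAt (c.X a) x)) * (ra a).1 ⟨x, hxW⟩ := by
        change _ - (∑ a, _ : JetForms E W).1 ⟨x, hxW⟩ = _
        rw [CoeffForms.sum_apply]
        rfl
      rw [h4] at h3
      have h5 : ∀ a, CoeffFibre.tmul 1 (σ.toFun x (diffAt (c.X a) x)) * ((ra a).1 ⟨x, hxW⟩ -
          ceToJetFib σ x (emb E _ x (ta a x))) ∈ fil (j + 1 + 1) x := fun a => by
        have := fil_mul_fil (σ.mem_fil_one x (diffAt (c.X a) x)) (hx a hxW)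
        rwa [add_comm] at this
      have h6 := Submodule.smul_of_tower_mem (fil (A := jetFamily E M) (j + 1 + 1) x)
        ((j + 1 : ℕ) : ℝ)⁻¹ (add_mem h3 (sum_mem (t := Finset.univ) fun a _ => h5 a))
      refine mem_of_eq_of_mem ?_ h6
      simp_rw [mul_sub]
      rw [Finset.sum_sub_distrib, sub_add_sub_cancel, smul_sub, smul_smul,
        inv_mul_cancel₀ hcj, one_smul, sub_sub]

/-- At each point the approximating polynomials form a Cauchy sequence, because the fibre map
reflects the filtration; their limit is the preimage. The preimages form a smooth section because
the same polynomials approximate them near every point. -/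
lemma ceToJet_surjective (σ : JetSplitting E M) : Function.Surjective (ceToJet σ U) := by
  intro s
  have key : ∀ p : U, ∃ z : CoeffFibre E (cotangentFamily E M) p.1,
      ceToJetFib σ p.1 z = s.1 p := by
    intro p
    choose t ht h using fun k => exists_ce_approx σ k s p
    obtain ⟨z, hz⟩ := exists_limit (fun k => emb E (cotangentFamily E M) p.1 (t k p.1)) fun k => by
      rw [← ceToJetFib_mem_fil_iff σ, map_sub]
      have := sub_mem ((h k).self_of_nhds p.2) (fil_anti (Nat.le_succ k)
        ((h (k + 1)).self_of_nhds p.2))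
      rwa [sub_sub_sub_cancel_left] at this
    refine ⟨z, sub_eq_zero.1 (eq_zero_of_mem_fil fun k => ?_)⟩
    have := sub_mem ((ceToJetFib_mem_fil_iff σ).2 (hz k)) ((h k).self_of_nhds p.2)
    rwa [map_sub, sub_sub_sub_cancel_right] at this
  choose z hz using key
  refine ⟨⟨z, mem_coeff_iff.2 fun k p => ?_⟩, CoeffForms.ext hz⟩
  obtain ⟨t, ht, h⟩ := exists_ce_approx σ k s p
  refine ⟨t, ht, ?_⟩
  filter_upwards [eventually_subtype h] with x hx
  rw [← ceToJetFib_mem_fil_iff σ, map_sub, hz]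
  exact hx x.2

/-- The isomorphism defined by a splitting. -/
def ceEquiv (σ : JetSplitting E M) (U : Opens M) : CE E E (Tangent E M) U ≃ₐ[ℝ] JetForms E U :=
  AlgEquiv.ofBijective (ceToJet σ U) ⟨ceToJet_injective σ, ceToJet_surjective σ⟩

lemma ceEquiv_apply (σ : JetSplitting E M) (s : CE E E (Tangent E M) U) (x : U) :
    (ceEquiv σ U s).1 x = ceToJetFib σ x.1 (s.1 x) := rfl

lemma ceEquiv_res (σ : JetSplitting E M) (h : W ≤ U) (s : CE E E (Tangent E M) U) :
    CoeffForms.res h (ceEquiv σ U s) = ceEquiv σ W (CoeffForms.res h s) := rfl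

lemma ceEquiv_symm_res (σ : JetSplitting E M) (h : W ≤ U) (s : JetForms E U) :
    CoeffForms.res h ((ceEquiv σ U).symm s) = (ceEquiv σ W).symm (CoeffForms.res h s) := by
  apply (ceEquiv σ W).injective
  rw [← ceEquiv_res, AlgEquiv.apply_symm_apply, AlgEquiv.apply_symm_apply]

lemma ceEquiv_mem_deg_iff (σ : JetSplitting E M) {q : ℕ} {s : CE E E (Tangent E M) U} :
    ceEquiv σ U s ∈ CoeffForms.deg E (jetFamily E M) U q ↔ s ∈ CoeffForms.deg E _ U q := by
  rw [CoeffForms.mem_deg_iff, CoeffForms.mem_deg_iff]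
  have h : (degOp E M q).act (ceEquiv σ U s) = ceEquiv σ U ((degOp E M q).act s) :=
    CoeffForms.ext fun x => fib_ceToJetFib σ _ _
  rw [h, (ceEquiv σ U).injective.eq_iff]

lemma ceEquiv_ofForms (σ : JetSplitting E M) (w : Forms E U) :
    ceEquiv σ U (ofForms E _ U w) = ofForms E _ U w := CoeffForms.ext fun x => by
  rw [ceEquiv_apply, ofForms_apply, ofForms_apply, ceToJetFib_tmul, map_one]

lemma ceEquiv_gen (σ : JetSplitting E M) (l : OneForms E M) :
    ceEquiv σ U (CE.gen E E (Tangent E M) U l) = σ.sec l U := CoeffForms.ext fun x => by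
  refine (ceToJetFib_tmul σ _ _).trans ?_
  rw [completedToJet_of]
  exact congrArg _ (symToJet_ι σ _)

end SheafIso


/-! ### Transport of the differential: the curved structure -/

section Curved

variable {E : Type*} [NormedAddCommGroup E] [NormedSpace ℝ E] [FiniteDimensional ℝ E]
variable {M : Type*} [TopologicalSpace M] [ChartedSpace E M] [IsManifold 𝓘(ℝ, E) ∞ M] [T2Space M]
variable {U W : Opens M} {A : AugFamily M}

lemma CoeffForms.parity_of_mem_deg {q : ℕ} {s : CoeffForms E A U}
    (hs : s ∈ CoeffForms.deg E A U q) : (parityOp E M).act s = (-1) ^ q * s :=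
  CoeffForms.ext fun x => (parity_fib_of_deg (hs x)).trans
    (((map_mul (CoeffForms.ev x) ((-1) ^ q) s).trans (by
      rw [map_pow, map_neg, map_one]; rfl)).symm)

lemma ι_tmul_mul {x : M} (ξ : Cotangent E x) (z : CoeffFibre E A x) :
    CoeffFibre.tmul (ExteriorAlgebra.ι ℝ ξ) 1 * z =
      (parityOp E M).fib A x z * CoeffFibre.tmul (ExteriorAlgebra.ι ℝ ξ) 1 := by
  induction z using coeff_induction with
  | h0 => rw [mul_zero, map_zero, zero_mul]
  | ht a b =>
    rw [FormOp.fib_tmul, tmul_mul_tmul, tmul_mul_tmul, mul_comm b]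
    exact congrArg (CoeffFibre.tmul · (1 * b)) (ι_mul_eq_parity_mul ξ a)
  | ha y z hy hz => rw [mul_add, map_add, add_mul, hy, hz]

/-- The differential of a function, as a differential form. -/
def exactForm (f : Fun E M) (U : Opens M) : Forms E U :=
  ⟨fun x => ExteriorAlgebra.ι ℝ (diffAt f x.1), restrict_mem_forms (ι_mem_polyForms f)⟩

lemma exactForm_mem_deg (f : Fun E M) : exactForm f U ∈ Forms.deg E U 1 := fun x => by
  have h := wedge_mem [f] x.1
  rwa [wedge_cons, wedge_nil, mul_one] at h

lemma euler_section (c : Coords E M) (hU : U ≤ c.dom) {q : ℕ} {s : CoeffForms E A U}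
    (hs : s ∈ CoeffForms.deg E A U q) :
    ∑ a, ofForms E A U (exactForm (c.X a) U) * (contractOp (c.v a)).act s = (q : ℝ) • s :=
  CoeffForms.ext fun x => (CoeffForms.sum_apply _ _ x).trans (euler_fib c (hU x.2) (hs x))

/-- Dividing Euler's identity by the degree expresses `s` through the forms `dX_a`. An `Ideal` here
is a left ideal, so `dX_a` is first moved to the right, at the cost of a parity. -/
lemma mem_posIdeal_of_mem_deg (c : Coords E M) (hU : U ≤ c.dom) {q : ℕ}
    {s : CE E E (Tangent E M) U} (hs : s ∈ CoeffForms.deg E _ U (q + 1)) :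
    s ∈ CE.posIdeal E E (Tangent E M) U := by
  have hq : ((q + 1 : ℕ) : ℝ) ≠ 0 := Nat.cast_ne_zero.2 q.succ_ne_zero
  have h := congrArg (fun t => ((q + 1 : ℕ) : ℝ)⁻¹ • t) (euler_section c hU hs)
  simp only [smul_smul, inv_mul_cancel₀ hq, one_smul] at h
  rw [← h]
  refine Submodule.smul_of_tower_mem _ _ (sum_mem fun a _ => ?_)
  have h1 : ofForms E (cotangentFamily E M) U (exactForm (c.X a) U) * (contractOp (c.v a)).act s =
      (parityOp E M).act ((contractOp (c.v a)).act s) *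
        ofForms E (cotangentFamily E M) U (exactForm (c.X a) U) :=
    CoeffForms.ext fun x => ι_tmul_mul _ _
  rw [h1]
  exact Ideal.mul_mem_left _ _ (Ideal.subset_span ⟨1, one_pos, _, exactForm_mem_deg _, rfl⟩)

variable (σ : JetSplitting E M)

/-- The differential of the de Rham complex of jets, transported by a splitting. -/
def ceD (U : Opens M) : CE E E (Tangent E M) U →ₗ[ℝ] CE E E (Tangent E M) U :=
  (ceEquiv σ U).symm.toLinearMap ∘ₗ jetD ∘ₗ (ceEquiv σ U).toLinearMap

lemma ceEquiv_ceD (s : CE E E (Tangent E M) U) :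
    ceEquiv σ U (ceD σ U s) = jetD (ceEquiv σ U s) := AlgEquiv.apply_symm_apply _ _

lemma ceD_res (h : W ≤ U) (s : CE E E (Tangent E M) U) :
    CoeffForms.res h (ceD σ U s) = ceD σ W (CoeffForms.res h s) := by
  apply (ceEquiv σ W).injective
  rw [← ceEquiv_res, ceEquiv_ceD, ceEquiv_ceD, jetD_res, ceEquiv_res]

lemma ceD_mem_deg {q : ℕ} {s : CE E E (Tangent E M) U} (hs : s ∈ CoeffForms.deg E _ U q) :
    ceD σ U s ∈ CoeffForms.deg E _ U (q + 1) := by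
  rw [← ceEquiv_mem_deg_iff σ, ceEquiv_ceD]
  exact jetD_mem_deg ((ceEquiv_mem_deg_iff σ).2 hs)

/-- The curved L∞ algebra defined by a splitting. -/
def JetSplitting.curvedLInfinity : CurvedLInfinity E E (Tangent E M) where
  d := ceD σ
  d_res _ _ h s := ceD_res σ h s
  d_deg _ _ _ hs := ceD_mem_deg σ hs
  d_mul U q s hs t := by
    apply (ceEquiv σ U).injective
    rw [ceEquiv_ceD, map_mul, jetD_mul,
      CoeffForms.parity_of_mem_deg ((ceEquiv_mem_deg_iff σ).2 hs), map_add, map_mul, map_mul,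
      map_mul, ceEquiv_ceD, ceEquiv_ceD, map_pow, map_neg, map_one, mul_assoc]
  d_d U s := by
    apply (ceEquiv σ U).injective
    rw [ceEquiv_ceD, ceEquiv_ceD, jetD_jetD, map_zero]
  d_forms U w z h := by
    apply (ceEquiv σ U).injective
    rw [ceEquiv_ceD, ceEquiv_ofForms, ceEquiv_ofForms, jetD_ofForms h]
  d_ideal U s _ p hp := by
    obtain ⟨c, hc⟩ := exists_coords (E := E) p
    -- The differential raises the form degree, so its values already lie in the ideal generated by
    -- `Ω^{>0}`.
    refine ⟨c.dom ⊓ U, ⟨hc, hp⟩, inf_le_right, Submodule.mem_sup_right ?_⟩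
    refine CoeffForms.homogeneous_induction (P := fun s =>
      CoeffForms.res inf_le_right (ceD σ U s) ∈ CE.posIdeal E E (Tangent E M) (c.dom ⊓ U))
      (fun q s hs => mem_posIdeal_of_mem_deg c inf_le_left
        (CoeffForms.res_mem_deg _ (ceD_mem_deg σ hs)))
      (fun s t hs ht => ?_) s
    rw [map_add, map_add]
    exact add_mem hs ht

/-- The isomorphism of the Chevalley-Eilenberg complex with the de Rham complex of jets. -/
def JetSplitting.ceIso : CEIso σ.curvedLInfinity σ where
  iso := ceEquiv σ
  iso_res _ _ h s := ceEquiv_res σ h s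
  iso_deg _ _ _ := ceEquiv_mem_deg_iff σ
  iso_forms _ w := ceEquiv_ofForms σ w
  iso_d U s := by
    have h := isJetDifferential_jetD (ceEquiv σ U s)
    rwa [← ceEquiv_ceD] at h
  iso_gen U l x := by rw [ceEquiv_gen]; rfl

end Curved


/-! ### The augmentation -/

section Augmentation

variable {E : Type*} [NormedAddCommGroup E] [NormedSpace ℝ E]
variable {M : Type*} [TopologicalSpace M] [ChartedSpace E M]
variable {A : AugFamily M} {x : M}

lemma completedAug_eq {b : A.Completed x} {g : A.Alg x}
    (h : AdicCompletion.evalₐ (A.ideal x) 1 b = Ideal.Quotient.mk _ g) :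
    completedAug A x b = A.ε x g := by
  have h1 : AdicCompletion.evalOneₐ (A.ideal x) b = Ideal.Quotient.mk _ g := by
    rw [← AdicCompletion.factorₐ_evalₐ_one, h]
    rfl
  exact congrArg (Ideal.Quotient.liftₐ (A.ideal x) (A.ε x) fun _ ha => ha) h1

lemma completedAug_eq_zero_iff {b : A.Completed x} :
    completedAug A x b = 0 ↔ AdicCompletion.evalₐ (A.ideal x) 1 b = 0 := by
  obtain ⟨g, hg⟩ := Ideal.Quotient.mk_surjective (AdicCompletion.evalₐ (A.ideal x) 1 b)
  rw [completedAug_eq hg.symm, ← hg, Ideal.Quotient.eq_zero_iff_mem, pow_one, RingHom.mem_ker]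

lemma aug_tmul (a : FormFibre E x) (b : A.Completed x) :
    aug E A x (CoeffFibre.tmul a b) = ExteriorAlgebra.algebraMapInv a * completedAug A x b :=
  Algebra.TensorProduct.lift_tmul _ _ _ _ _

lemma aug_eq (z : CoeffFibre E A x) :
    aug E A x z = completedAug A x (comp ExteriorAlgebra.algebraMapInv.toLinearMap z) := by
  induction z using coeff_induction with
  | h0 => rw [map_zero, map_zero, map_zero]
  | ht a b =>
    rw [aug_tmul, comp_tmul, map_smul, smul_eq_mul, AlgHom.toLinearMap_apply]
  | ha y z hy hz => rw [map_add, hy, hz, map_add, map_add]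

lemma aug_eq_zero_of_mem_fil {z : CoeffFibre E A x} (hz : z ∈ fil 1 x) : aug E A x z = 0 := by
  rw [aug_eq, completedAug_eq_zero_iff]
  exact mem_fil_iff.1 hz _

lemma mem_fil_one_of_aug_eq_zero {z : CoeffFibre E A x} (hz : z ∈ CoeffFibre.deg E A x 0)
    (h : aug E A x z = 0) : z ∈ fil 1 x := by
  obtain ⟨b, rfl⟩ := mem_deg_zero_iff.1 hz
  rw [aug_tmul, map_one, one_mul, completedAug_eq_zero_iff] at h
  exact one_tmul_mem_fil_iff.2 h

lemma algebraMapInv_of_mem {q : ℕ} {a : FormFibre E x} (ha : a ∈ ⋀[ℝ]^(q + 1) (Cotangent E x)) :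
    ExteriorAlgebra.algebraMapInv a = 0 := by
  have h : LinearMap.range (ExteriorAlgebra.ι ℝ (M := Cotangent E x)) ^ (q + 1) ≤
      LinearMap.ker (ExteriorAlgebra.algebraMapInv (R := ℝ) (M := Cotangent E x)).toLinearMap := by
    rw [pow_succ, Submodule.mul_le]
    rintro a - _ ⟨v, rfl⟩
    rw [LinearMap.mem_ker, AlgHom.toLinearMap_apply, map_mul]
    refine mul_eq_zero_of_right _ ?_
    simp [ExteriorAlgebra.algebraMapInv]
  exact h ha

lemma aug_eq_zero_of_mem_deg {q : ℕ} {z : CoeffFibre E A x}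
    (hz : z ∈ CoeffFibre.deg E A x (q + 1)) : aug E A x z = 0 := by
  refine deg_induction (P := fun z => aug E A x z = 0) (map_zero _) (fun a ha b => ?_)
    (fun y z hy hz => by rw [map_add, hy, hz, add_zero]) hz
  rw [aug_tmul, algebraMapInv_of_mem ha, zero_mul]

end Augmentation

/-! ### The augmentation is a quasi-isomorphism -/

section QuasiIso

variable {E : Type*} [NormedAddCommGroup E] [NormedSpace ℝ E] [FiniteDimensional ℝ E]
variable {M : Type*} [TopologicalSpace M] [ChartedSpace E M] [IsManifold 𝓘(ℝ, E) ∞ M] [T2Space M]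
variable {U : Opens M}

/-- The augmentation kills differentials and linear generators, so of a monomial only a pure
function `a` can survive. -/
lemma exists_aug_eq {t : ∀ x : M, FormFibre E x ⊗[ℝ] (cotangentFamily E M).Alg x}
    (ht : t ∈ polySections E (cotangentFamily E M)) :
    ∃ f : Fun E M, ∀ x, aug E (cotangentFamily E M) x (emb E _ x (t x)) = f x := by
  refine polySections_induction (P := fun t => ∃ f : Fun E M, ∀ x,
    aug E (cotangentFamily E M) x (emb E _ x (t x)) = f x) (fun a l g => ?_) ?_ ht
  · rcases l with - | ⟨b, l⟩
    · rcases g with - | ⟨⟨_, u, hu, rfl⟩, g⟩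
      · refine ⟨a, fun x => ?_⟩
        rw [emb_tmul, aug_tmul, wedge_nil, map_smul, map_one]
        refine (congrArg (fun y => (a x • (1 : ℝ)) * y)
          (map_one (completedAug (cotangentFamily E M) x))).trans ?_
        simp
      · refine ⟨0, fun x => ?_⟩
        rw [emb_tmul, aug_tmul]
        refine mul_eq_zero_of_right _ ?_
        refine (completedAug_eq (AdicCompletion.evalₐ_of _ _ _)).trans ?_
        rw [List.map_cons, List.prod_cons, map_mul]
        refine mul_eq_zero_of_left ?_ _
        exact SymmetricAlgebra.lift_ι_apply ..
    · refine ⟨0, fun x => ?_⟩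
      rw [emb_tmul]
      exact aug_eq_zero_of_mem_deg (q := l.length)
        (tmul_mem_deg (Submodule.smul_mem _ _ (wedge_mem (b :: l) x)) _)
  · rintro s t ⟨f, hf⟩ ⟨g, hg⟩
    exact ⟨f + g, fun x => by
      refine (congrArg _ (map_add (emb E (cotangentFamily E M) x) _ _)).trans ?_
      rw [map_add, hf, hg]; rfl⟩

lemma contMDiff_aug (s : CE E E (Tangent E M) U) :
    ContMDiff 𝓘(ℝ, E) 𝓘(ℝ, ℝ) ∞ fun x : U => aug E _ x.1 (s.1 x) := by
  intro p
  obtain ⟨t, ht, h⟩ := CoeffForms.approx s 1 p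
  obtain ⟨f, hf⟩ := exists_aug_eq ht
  have h1 : ContMDiffAt 𝓘(ℝ, E) 𝓘(ℝ, ℝ) ∞ (fun x : U => f x.1) p :=
    f.contMDiff.contMDiffAt.comp p contMDiff_subtype_val.contMDiffAt
  refine h1.congr_of_eventuallyEq ?_
  filter_upwards [h] with x hx
  have := aug_eq_zero_of_mem_fil hx
  rwa [map_sub, sub_eq_zero, hf] at this

/-- A smooth function, as a differential form. -/
def funForm (f : C^∞⟮𝓘(ℝ, E), U; ℝ⟯) : Forms E U :=
  ⟨fun x => algebraMap ℝ (FormFibre E x.1) (f x), fun p => by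
    obtain ⟨F, hF⟩ := exists_extend_fun f p
    refine ⟨_, fun_mem_polyForms F, ?_⟩
    filter_upwards [hF] with x hx
    rw [hx]⟩

lemma ofForms_funForm_mem_deg {A : AugFamily M} (f : C^∞⟮𝓘(ℝ, E), U; ℝ⟯) :
    ofForms E A U (funForm f) ∈ CoeffForms.deg E A U 0 := fun _ =>
  tmul_mem_deg (SetLike.algebraMap_mem_graded (fun i : ℕ => ⋀[ℝ]^i _) _) _

lemma aug_ofForms_funForm {A : AugFamily M} (f : C^∞⟮𝓘(ℝ, E), U; ℝ⟯) (x : U) :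
    aug E A x.1 ((ofForms E A U (funForm f)).1 x) = f x := by
  rw [ofForms_apply, aug_tmul, map_one, mul_one]
  exact ExteriorAlgebra.algebraMap_leftInverse _ _

lemma aug_ceEquiv_symm (σ : JetSplitting E M) {s : JetForms E U}
    (hs : s ∈ CoeffForms.filtration E (jetFamily E M) U 1) (x : U) :
    aug E _ x.1 (((ceEquiv σ U).symm s).1 x) = 0 := by
  refine aug_eq_zero_of_mem_fil ((ceToJetFib_mem_fil_iff σ).1 ?_)
  rw [← ceEquiv_apply, AlgEquiv.apply_symm_apply]
  exact hs x

/-- Through `ceEquiv` everything is a statement about jets. Exactness in positive degrees gives the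
vanishing of higher cohomology and corrects `f` to a closed section. Two closed lifts of `f` in
degree zero differ by a horizontal section of positive order, which vanishes. -/
lemma augIsQuasiIso (σ : JetSplitting E M) : σ.curvedLInfinity.AugIsQuasiIso := by
  intro U
  refine ⟨contMDiff_aug, fun s x => ?_, fun f => ?_, fun q s hs h => ?_⟩
  · refine CoeffForms.homogeneous_induction (P := fun s =>
      aug E (cotangentFamily E M) x.1 ((ceD σ U s).1 x) = 0)
      (fun q s hs => aug_eq_zero_of_mem_deg (ceD_mem_deg σ hs x)) (fun s t hs ht => ?_) s
    rw [map_add]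
    exact (map_add (aug E (cotangentFamily E M) x.1) _ _).trans (by rw [hs, ht, add_zero])
  · have h0 : ofForms E (jetFamily E M) U (funForm f) ∈ CoeffForms.deg E _ U 0 :=
      ofForms_funForm_mem_deg f
    -- The correction `y` can be taken of order at least one, so subtracting it makes `f` closed
    -- without changing its augmentation.
    obtain ⟨y, hy, hy1, hyd⟩ := exists_jetD_eq σ (jetD_mem_deg h0) (jetD_jetD _)
    refine ⟨ofForms E _ U (funForm f) - (ceEquiv σ U).symm y, ⟨sub_mem
      (ofForms_funForm_mem_deg f) ?_, ?_, fun x => ?_⟩, ?_⟩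
    · rwa [← ceEquiv_mem_deg_iff σ, AlgEquiv.apply_symm_apply]
    · apply (ceEquiv σ U).injective
      refine (ceEquiv_ceD σ _).trans ?_
      rw [map_sub, AlgEquiv.apply_symm_apply, ceEquiv_ofForms, map_sub, hyd, sub_self, map_zero]
    · refine (map_sub (aug E (cotangentFamily E M) x.1) _ _).trans ?_
      rw [aug_ofForms_funForm, aug_ceEquiv_symm σ hy1, sub_zero]
    · rintro t ⟨ht, htd, hta⟩
      rw [eq_sub_iff_add_eq]
      apply (ceEquiv σ U).injective
      rw [map_add, AlgEquiv.apply_symm_apply, ceEquiv_ofForms, ← sub_eq_zero]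
      have ht' : ceEquiv σ U t - ofForms E _ U (funForm f) ∈
          CoeffForms.filtration E (jetFamily E M) U 1 := fun x => by
        have h1 : ceEquiv σ U (t - ofForms E _ U (funForm f)) =
          ceEquiv σ U t - ofForms E _ U (funForm f) := by rw [map_sub, ceEquiv_ofForms]
        rw [← h1, ceEquiv_apply, ceToJetFib_mem_fil_iff]
        refine mem_fil_one_of_aug_eq_zero (sub_mem (ht x) (ofForms_funForm_mem_deg f x)) ?_
        refine (map_sub (aug E (cotangentFamily E M) x.1) _ _).trans ?_
        rw [hta, aug_ofForms_funForm, sub_self]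
      refine eq_zero_of_jetD_eq_zero σ
        (sub_mem (add_mem ((ceEquiv_mem_deg_iff σ).2 ht) hy) h0) ?_ ?_
      · rw [add_sub_right_comm]
        exact add_mem ht' hy1
      · have h2 : jetD (ceEquiv σ U t) = 0 := by
          rw [← ceEquiv_ceD, show ceD σ U t = 0 from htd, map_zero]
        rw [map_sub, map_add, h2, hyd, zero_add, sub_self]
  · have h1 : jetD (ceEquiv σ U s) = 0 := by
      rw [← ceEquiv_ceD, show ceD σ U s = 0 from h, map_zero]
    obtain ⟨t, ht, -, htd⟩ := exists_jetD_eq σ ((ceEquiv_mem_deg_iff σ).2 hs) h1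
    refine ⟨(ceEquiv σ U).symm t, ?_, ?_⟩
    · rwa [← ceEquiv_mem_deg_iff σ, AlgEquiv.apply_symm_apply]
    · apply (ceEquiv σ U).injective
      refine (ceEquiv_ceD σ _).trans ?_
      rw [AlgEquiv.apply_symm_apply, htd]

end QuasiIso


/-! ### Uniqueness of the isomorphism and of the structure -/

section Uniqueness

variable {E : Type*} [NormedAddCommGroup E] [NormedSpace ℝ E] [FiniteDimensional ℝ E]
variable {M : Type*} [TopologicalSpace M] [ChartedSpace E M] [IsManifold 𝓘(ℝ, E) ∞ M] [T2Space M]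
variable {U W : Opens M}

/-- Endomorphisms of the sheaf of graded algebras of forms with values in jets, over the sheaf of
forms, that fix a splitting. -/
structure JetEnd (σ : JetSplitting E M) where
  toFun : ∀ U : Opens M, JetForms E U →ₐ[ℝ] JetForms E U
  res : ∀ (U W : Opens M) (h : W ≤ U) (s : JetForms E U),
    CoeffForms.res h (toFun U s) = toFun W (CoeffForms.res h s)
  forms : ∀ (U : Opens M) (w : Forms E U), toFun U (ofForms E _ U w) = ofForms E _ U w
  sec : ∀ (U : Opens M) (l : OneForms E M), toFun U (σ.sec l U) = σ.sec l U

namespace JetEnd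

variable {σ : JetSplitting E M} (ψ : JetEnd σ)

/-- Continuity comes for free: locally a section of order `k + 1` is a combination of the `σ
(dX_a)`, which `ψ` fixes, with coefficients of order `k`. -/
lemma mem_filtration_of_deg_zero {k : ℕ} {s : JetForms E U}
    (hs : s ∈ CoeffForms.filtration E (jetFamily E M) U k)
    (hq : s ∈ CoeffForms.deg E (jetFamily E M) U 0) :
    ψ.toFun U s ∈ CoeffForms.filtration E (jetFamily E M) U k := by
  induction k generalizing U with
  | zero => exact CoeffForms.mem_filtration_zero _
  | succ k ih =>
    intro x
    obtain ⟨c, hc⟩ := exists_coords (E := E) x.1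
    obtain ⟨r, hr, hr0, he⟩ := exists_division σ (U := c.dom ⊓ U) (s := CoeffForms.res inf_le_right s)
      (CoeffForms.res_mem_filtration _ hs) (CoeffForms.res_mem_deg _ hq) (c := c) inf_le_left
    have h1 : CoeffForms.res inf_le_right (ψ.toFun U s) =
        ∑ a, σ.sec (dForm (c.X a)) (c.dom ⊓ U) * ψ.toFun _ (r a) := by
      rw [ψ.res, he, map_sum]
      exact Finset.sum_congr rfl fun a _ => by rw [map_mul, ψ.sec]
    have h2 : CoeffForms.res inf_le_right (ψ.toFun U s) ∈
        CoeffForms.filtration E (jetFamily E M) (c.dom ⊓ U) (1 + k) := by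
      rw [h1]
      exact sum_mem fun a _ => CoeffForms.filtration_mul (σ.sec_mem_filtration _)
        (ih (hr a) (hr0 a))
    rw [add_comm] at h2
    exact h2 ⟨x.1, hc, x.2⟩

/-- Euler's identity writes a section of positive degree through the fixed forms `dX_a` and its
contractions, which have lower degree and the same order. -/
lemma mem_filtration_of_deg {k q : ℕ} {s : JetForms E U}
    (hs : s ∈ CoeffForms.filtration E (jetFamily E M) U k)
    (hq : s ∈ CoeffForms.deg E (jetFamily E M) U q) :
    ψ.toFun U s ∈ CoeffForms.filtration E (jetFamily E M) U k := by
  induction q generalizing U with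
  | zero => exact ψ.mem_filtration_of_deg_zero hs hq
  | succ q ih =>
    intro x
    obtain ⟨c, hc⟩ := exists_coords (E := E) x.1
    have h0 : ((q + 1 : ℕ) : ℝ) ≠ 0 := Nat.cast_ne_zero.2 q.succ_ne_zero
    let s' : JetForms E (c.dom ⊓ U) := CoeffForms.res inf_le_right s
    have hs' : s' ∈ CoeffForms.filtration E (jetFamily E M) _ k :=
      CoeffForms.res_mem_filtration _ hs
    have hq' : s' ∈ CoeffForms.deg E (jetFamily E M) _ (q + 1) := CoeffForms.res_mem_deg _ hq
    have h1 : ((q + 1 : ℕ) : ℝ) • CoeffForms.res inf_le_right (ψ.toFun U s) =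
        ∑ a, ofForms E (jetFamily E M) _ (exactForm (c.X a) (c.dom ⊓ U)) *
          ψ.toFun _ ((contractOp (c.v a)).act s') := by
      rw [ψ.res, ← map_smul, ← euler_section c inf_le_left hq', map_sum]
      exact Finset.sum_congr rfl fun a _ => by rw [map_mul, ψ.forms]
    have h2 : ((q + 1 : ℕ) : ℝ) • CoeffForms.res inf_le_right (ψ.toFun U s) ∈
        CoeffForms.filtration E (jetFamily E M) (c.dom ⊓ U) k := by
      rw [h1]
      exact sum_mem fun a _ => fun y => Ideal.mul_mem_left _ _
        (ih (s := (contractOp (c.v a)).act s') (fun y => FormOp.fib_mem_fil _ (hs' y))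
          (fun y => contract_fib_mem_deg _ (hq' y)) y)
    exact (Submodule.smul_mem_iff _ h0).1 h2 ⟨x.1, hc, x.2⟩

lemma mem_filtration {k : ℕ} {s : JetForms E U}
    (hs : s ∈ CoeffForms.filtration E (jetFamily E M) U k) :
    ψ.toFun U s ∈ CoeffForms.filtration E (jetFamily E M) U k := by
  rw [← CoeffForms.sum_degOp s, map_sum]
  exact sum_mem fun q _ => ψ.mem_filtration_of_deg (s := (degOp E M q).act s)
    (fun y => FormOp.fib_mem_fil _ (hs y)) (CoeffForms.degOp_mem_deg q s)

lemma exists_fixed {t : ∀ x : M, FormFibre E x ⊗[ℝ] (cotangentFamily E M).Alg x}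
    (ht : t ∈ polySections E (cotangentFamily E M)) (U : Opens M) :
    ∃ s : JetForms E U, ψ.toFun U s = s ∧ ∀ x : U, s.1 x = ceToJetFib σ x.1 (emb E _ x.1 (t x.1)) := by
  induction ht using Algebra.adjoin_induction with
  | mem t ht =>
    rcases ht with ⟨w, hw, rfl⟩ | ⟨g, ⟨l, hl, rfl⟩, rfl⟩
    · refine ⟨ofForms E _ U ⟨_, restrict_mem_forms (Algebra.subset_adjoin hw)⟩, ψ.forms _ _,
        fun x => ?_⟩
      rw [emb_tmul, ceToJetFib_tmul, ofForms_apply]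
      exact congrArg _ (map_one (completedToJet σ x.1)).symm
    · exact ⟨σ.sec ⟨l, hl⟩ U, ψ.sec _ _, fun x => (ceToJetFib_linear σ (l x.1)).symm⟩
  | algebraMap r =>
    exact ⟨algebraMap ℝ _ r, AlgHom.commutes _ r, fun x =>
      ((congrArg _ ((emb E _ x.1).commutes r)).trans ((ceToJetFib σ x.1).commutes r)).symm⟩
  | add s t _ _ hs ht =>
    obtain ⟨y, hy, hys⟩ := hs
    obtain ⟨z, hz, hzt⟩ := ht
    refine ⟨y + z, by rw [map_add, hy, hz], fun x => ?_⟩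
    exact (congrArg₂ (· + ·) (hys x) (hzt x)).trans ((congrArg _ (map_add (emb E _ x.1) _ _)).trans
      (map_add (ceToJetFib σ x.1) _ _)).symm
  | mul s t _ _ hs ht =>
    obtain ⟨y, hy, hys⟩ := hs
    obtain ⟨z, hz, hzt⟩ := ht
    refine ⟨y * z, by rw [map_mul, hy, hz], fun x => ?_⟩
    exact (congrArg₂ (· * ·) (hys x) (hzt x)).trans ((congrArg _ (map_mul (emb E _ x.1) _ _)).trans
      (map_mul (ceToJetFib σ x.1) _ _)).symm

/-- Polynomials in forms and `σ` are fixed and approximate every section to any order; since `ψ`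
preserves the filtration, it is the identity. -/
lemma toFun_eq (s : JetForms E U) : ψ.toFun U s = s := by
  refine CoeffForms.ext fun x => sub_eq_zero.1 (eq_zero_of_mem_fil fun k => ?_)
  obtain ⟨t, ht, h⟩ := exists_ce_approx σ k s x
  obtain ⟨N, hN, hNo, hx⟩ := eventually_nhds_iff.1 h
  let W : Opens M := ⟨N, hNo⟩ ⊓ U
  obtain ⟨y, hy, hyt⟩ := ψ.exists_fixed ht W
  have h1 : CoeffForms.res inf_le_right s - y ∈ CoeffForms.filtration E (jetFamily E M) W k :=
    fun z => by
      change s.1 ⟨z.1, z.2.2⟩ - y.1 z ∈ _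
      rw [hyt]
      exact hN z.1 z.2.1 z.2.2
  have h2 := sub_mem (ψ.mem_filtration h1) h1
  rw [map_sub, hy, sub_sub_sub_cancel_right, ← ψ.res] at h2
  exact h2 ⟨x.1, hx, x.2⟩

end JetEnd

lemma CEIso.iso_eq {σ : JetSplitting E M} {g : CurvedLInfinity E E (Tangent E M)}
    (φ : CEIso g σ) (s : CE E E (Tangent E M) U) : φ.iso U s = ceEquiv σ U s := by
  let ψ : JetEnd σ :=
    { toFun := fun U => (φ.iso U).toAlgHom.comp (ceEquiv σ U).symm.toAlgHom
      res := fun U W h s => (φ.iso_res U W h _).trans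
        (congrArg (φ.iso W) (ceEquiv_symm_res σ h s))
      forms := fun U w => (congrArg (φ.iso U) ((AlgEquiv.symm_apply_eq _).2
        (ceEquiv_ofForms σ w).symm)).trans (φ.iso_forms U w)
      sec := fun U l => (congrArg (φ.iso U) ((AlgEquiv.symm_apply_eq _).2
        (ceEquiv_gen σ l).symm)).trans (CoeffForms.ext fun x => φ.iso_gen U l x) }
  have h := ψ.toFun_eq (ceEquiv σ U s)
  rw [← h]
  exact congrArg (φ.iso U) ((ceEquiv σ U).symm_apply_apply s).symm

lemma CEIso.eq_curvedLInfinity {σ : JetSplitting E M} {g : CurvedLInfinity E E (Tangent E M)}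
    (φ : CEIso g σ) : g = σ.curvedLInfinity := by
  have h : g.d = ceD σ := by
    funext U
    refine LinearMap.ext fun s => (ceEquiv σ U).injective ?_
    rw [← φ.iso_eq, (φ.iso_d U s).eq_jetD, ceEquiv_ceD, φ.iso_eq]
  obtain ⟨d⟩ := g
  subst h
  rfl

end Uniqueness

/-! ### Nilpotency of the ideal of forms of positive degree -/

section Nilpotency

variable {E : Type*} [NormedAddCommGroup E] [NormedSpace ℝ E] [FiniteDimensional ℝ E]
variable {M : Type*} [TopologicalSpace M] [ChartedSpace E M]

lemma forms_prod_eq_zero {U : Opens M} (w : Fin (Module.finrank ℝ E + 1) → Forms E U)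
    (hw : ∀ i, ∃ q : ℕ, 0 < q ∧ w i ∈ Forms.deg E U q) : (List.ofFn w).prod = 0 := by
  refine Subtype.ext (funext fun x => ?_)
  let ev : Forms E U →ₐ[ℝ] FormFibre E x.1 :=
    (Pi.evalAlgHom ℝ (fun y : U => FormFibre E y.1) x).comp (Forms E U).val
  change ev (List.ofFn w).prod = 0
  rw [map_list_prod]
  refine exterior_list_prod_eq_zero _ (fun a ha => ?_) (by
    rw [List.length_map, List.length_ofFn, finrank_cotangent]; exact Nat.lt_succ_self _)
  obtain ⟨y, hy, rfl⟩ := List.mem_map.1 ha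
  obtain ⟨i, rfl⟩ := (List.mem_ofFn' _ _).1 hy
  obtain ⟨q, hq, h⟩ := hw i
  exact ⟨q, hq, h x⟩

end Nilpotency


/-! ### Existence of splittings -/

section ExistsSplitting

variable {E : Type*} [NormedAddCommGroup E] [NormedSpace ℝ E]
variable {M : Type*} [TopologicalSpace M] [ChartedSpace E M]

/-- The differential at a point, as a linear map. -/
def diffAtₗ (x : M) : Fun E M →ₗ[ℝ] Cotangent E x where
  toFun f := diffAt f x
  map_add' f g := diffAt_add f g x
  map_smul' r f := diffAt_smul r f x

lemma diffAt_eq_zero_of_mem_sq {x : M} {f : Fun E M}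
    (hf : f ∈ RingHom.ker (evalAt (E := E) x) ^ 2) : diffAt f x = 0 := by
  rw [pow_two] at hf
  induction hf using Submodule.mul_induction_on' with
  | mem_mul_mem a ha b hb =>
    rw [diffAt_mul, show a x = 0 from ha, show b x = 0 from hb, zero_smul, zero_smul,
      add_zero]
  | add f _ g _ hf hg => rw [diffAt_add, hf, hg, add_zero]

variable [IsManifold 𝓘(ℝ, E) ∞ M]

/-- Value and differential only depend on the class modulo `𝔪ₓ²`, so the splitting condition may be
checked on one representative. -/
lemma split_of_repr {x : M} {ξ : Cotangent E x} {b : Jet E x} {g : Fun E M} (h0 : g x = 0)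
    (h1 : diffAt g x = ξ)
    (hb : AdicCompletion.evalₐ ((jetFamily E M).ideal x) 2 b = Ideal.Quotient.mk _ g) (f : Fun E M)
    (hf : AdicCompletion.evalₐ ((jetFamily E M).ideal x) 2 b = Ideal.Quotient.mk _ f) :
    f x = 0 ∧ diffAt f x = ξ := by
  have h2 : f - g ∈ RingHom.ker (evalAt (E := E) x) ^ 2 :=
    Ideal.Quotient.eq.1 (hf.symm.trans hb)
  have h3 : f x - g x = 0 := Ideal.pow_le_self two_ne_zero h2
  refine ⟨by rw [← h3, h0, sub_zero], ?_⟩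
  have h4 := (map_sub (diffAtₗ x) f g).symm.trans (diffAt_eq_zero_of_mem_sq h2)
  rw [← h1]
  exact sub_eq_zero.1 h4

/-- The splitting given by the affine functions of local coordinates. -/
def Coords.affine (c : Coords E M) (x : M) : Cotangent E x →ₗ[ℝ] Fun E M where
  toFun ξ := ∑ b, ξ (c.v b x) • c.X₀ x b
  map_add' ξ η := by
    rw [← Finset.sum_add_distrib]
    exact Finset.sum_congr rfl fun b _ => add_smul _ _ _
  map_smul' r ξ := by
    rw [RingHom.id_apply, Finset.smul_sum]
    exact Finset.sum_congr rfl fun b _ => mul_smul _ _ _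

lemma Coords.affine_apply (c : Coords E M) (x : M) (ξ : Cotangent E x) :
    c.affine x ξ = ∑ b, ξ (c.v b x) • c.X₀ x b := rfl

lemma Coords.evalAt_affine (c : Coords E M) (x : M) (ξ : Cotangent E x) :
    evalAt x (c.affine x ξ) = 0 := by
  rw [affine_apply, map_sum]
  refine Finset.sum_eq_zero fun b _ => ?_
  rw [map_smul, show evalAt x (c.X₀ x b) = 0 from sub_algebraMap_mem_ker (evalAt x) (c.X b),
    smul_zero]

variable [FiniteDimensional ℝ E]

lemma Coords.diffAt_affine {c : Coords E M} {x : M} (hx : x ∈ c.dom) (ξ : Cotangent E x) :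
    diffAtₗ x (c.affine x ξ) = ξ := by
  rw [affine_apply, map_sum]
  conv_rhs => rw [← sum_dX hx ξ]
  refine Finset.sum_congr rfl fun b _ => ?_
  rw [map_smul]
  exact congrArg _ (diffAt_X₀ b)

/-- The product of a smooth function and the pairing of a one-form with a vector field. -/
def pairing (ρ : Fun E M) (l : OneForms E M) (v : VectorFields E M) : Fun E M :=
  ρ * ⟨fun x => l.1 x (v x), l.2 v⟩

/-- Expanding `X₀ x b = X b - X b x` and moving functions of `x` to the form factor exhibits the
local splitting as a polynomial family, hence as smooth. -/
lemma one_tmul_affine (c : Coords E M) (ρ : Fun E M) (l : OneForms E M) (x : M) :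
    (1 : FormFibre E x) ⊗ₜ[ℝ] (ρ x • c.affine x (l.1 x)) =
      ∑ b, ((jetPair (pairing ρ l (c.v b)) [] (c.X b)).1 x -
        (jetPair (pairing ρ l (c.v b) * c.X b) [] 1).1 x) := by
  rw [Coords.affine_apply, Finset.smul_sum, TensorProduct.tmul_sum]
  refine Finset.sum_congr rfl fun b _ => ?_
  rw [smul_smul, Coords.X₀, smul_sub, TensorProduct.tmul_sub]
  refine congrArg₂ (· - ·) ?_ ?_
  · exact (TensorProduct.smul_tmul _ _ _).symm
  · rw [Algebra.algebraMap_eq_smul_one, smul_smul]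
    exact (TensorProduct.smul_tmul _ _ _).symm

/-- The splitting condition is affine, so a partition of unity glues the splittings given by affine
functions of local coordinates. -/
instance [T2Space M] [SigmaCompactSpace M] : Nonempty (JetSplitting E M) := by
  choose c hc using fun p : M => exists_coords (E := E) p
  obtain ⟨ρ, hρ⟩ := SmoothPartitionOfUnity.exists_isSubordinate 𝓘(ℝ, E) isClosed_univ
    (fun p => ((c p).dom : Set M)) (fun p => (c p).dom.isOpen)
    (fun p _ => Set.mem_iUnion.2 ⟨p, hc p⟩)
  let τ : ∀ x : M, Cotangent E x →ₗ[ℝ] Fun E M := fun x =>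
    ∑ i ∈ ρ.finsupport x, ρ i x • (c i).affine x
  have hτ : ∀ x ξ, τ x ξ = ∑ i ∈ ρ.finsupport x, ρ i x • (c i).affine x ξ := fun x ξ => by
    simp only [τ, LinearMap.sum_apply, LinearMap.smul_apply]
  refine ⟨⟨fun x => (IsScalarTower.toAlgHom ℝ (Fun E M) (Jet E x)).toLinearMap ∘ₗ τ x,
    fun l => mem_coeff_iff.2 fun k p => ?_, fun x ξ => ?_⟩⟩
  · refine ⟨∑ i ∈ ρ.fintsupport p.1, ∑ b, ((jetPair (pairing (ρ i) l ((c i).v b)) []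
      ((c i).X b)).1 - (jetPair (pairing (ρ i) l ((c i).v b) * (c i).X b) [] 1).1),
      sum_mem fun i _ => sum_mem fun b _ => sub_mem (jetGraph_fst (jetPair_mem _ _ _))
        (jetGraph_fst (jetPair_mem _ _ _)), ?_⟩
    filter_upwards [eventually_subtype (ρ.eventually_finsupport_subset p.1)] with x hx
    have h1 : τ x.1 (l.1 x.1) = ∑ i ∈ ρ.fintsupport p.1, ρ i x.1 • (c i).affine x.1 (l.1 x.1) := by
      rw [hτ]
      refine Finset.sum_subset hx fun i _ hi => ?_
      rw [ρ.mem_finsupport, Function.notMem_support] at hi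
      rw [hi, zero_smul]
    have h2 : (∑ i ∈ ρ.fintsupport p.1, ∑ b, ((jetPair (pairing (ρ i) l ((c i).v b)) []
      ((c i).X b)).1 - (jetPair (pairing (ρ i) l ((c i).v b) * (c i).X b) [] 1).1)) x.1 =
        (1 : FormFibre E x.1) ⊗ₜ[ℝ] τ x.1 (l.1 x.1) := by
      rw [h1, TensorProduct.tmul_sum, Finset.sum_apply]
      refine Finset.sum_congr rfl fun i _ => ?_
      rw [one_tmul_affine, Finset.sum_apply]
      rfl
    rw [h2]
    refine mem_of_eq_of_mem ?_ (zero_mem (fil (E := E) (A := jetFamily E M) k x.1))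
    exact sub_self _
  · refine split_of_repr (g := τ x ξ) ?_ ?_ (AdicCompletion.evalₐ_of _ _ _)
    · change evalAt x (τ x ξ) = 0
      rw [hτ, map_sum]
      exact Finset.sum_eq_zero fun i _ => by rw [map_smul, Coords.evalAt_affine, smul_zero]
    · change diffAtₗ x (τ x ξ) = ξ
      rw [hτ, map_sum]
      refine (Finset.sum_congr rfl (g := fun i => ρ i x • ξ) fun i hi => ?_).trans ?_
      · rw [map_smul, Coords.diffAt_affine (hρ i (subset_tsupport _ ((ρ.mem_finsupport x).1 hi)))]
      · rw [← Finset.sum_smul, ρ.sum_finsupport x (Set.mem_univ x), one_smul]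

end ExistsSplitting


/-! ### Contractibility of the space of splittings -/

section Contractible

variable {E : Type*} [NormedAddCommGroup E] [NormedSpace ℝ E]
variable {M : Type*} [TopologicalSpace M] [ChartedSpace E M] [IsManifold 𝓘(ℝ, E) ∞ M]
variable {p : M} {y : E} {j : ℕ}

lemma contDiffAt_chart (f : Fun E M) (hy : y ∈ (extChartAt 𝓘(ℝ, E) p).target) :
    ContDiffAt ℝ ∞ (f ∘ (extChartAt 𝓘(ℝ, E) p).symm) y := by
  have h : ContMDiffOn 𝓘(ℝ, E) 𝓘(ℝ, ℝ) ∞ (f ∘ (extChartAt 𝓘(ℝ, E) p).symm)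
      (extChartAt 𝓘(ℝ, E) p).target := f.contMDiff.comp_contMDiffOn (contMDiffOn_extChartAt_symm p)
  exact h.contDiffOn.contDiffAt ((isOpen_extChartAt_target p).mem_nhds hy)

lemma contDiffAt_iteratedFDeriv_chart (f : Fun E M) (hy : y ∈ (extChartAt 𝓘(ℝ, E) p).target) :
    ContDiffAt ℝ ∞ (iteratedFDeriv ℝ j (f ∘ (extChartAt 𝓘(ℝ, E) p).symm)) y :=
  (contDiffAt_chart f hy).iteratedFDeriv_right (by exact_mod_cast le_top)

/-- The derivatives of order `j` at a point of a chart, as a linear map. -/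
def chartDeriv (j : ℕ) (hy : y ∈ (extChartAt 𝓘(ℝ, E) p).target) : Fun E M →ₗ[ℝ] E [×j]→L[ℝ] ℝ where
  toFun f := iteratedFDeriv ℝ j (f ∘ (extChartAt 𝓘(ℝ, E) p).symm) y
  map_add' f g := iteratedFDeriv_add_apply ((contDiffAt_chart f hy).of_le (by exact_mod_cast le_top))
    ((contDiffAt_chart g hy).of_le (by exact_mod_cast le_top))
  map_smul' r f := iteratedFDeriv_const_smul_apply
    ((contDiffAt_chart f hy).of_le (by exact_mod_cast le_top))

/-- In the Leibniz expansion of a derivative of order below `n + 1` of a product of a function in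
`𝔪^n` and one in `𝔪`, every term contains a vanishing factor. -/
lemma chartDeriv_eq_zero (hy : y ∈ (extChartAt 𝓘(ℝ, E) p).target) {n : ℕ} {f : Fun E M}
    (hf : f ∈ RingHom.ker (evalAt (E := E) ((extChartAt 𝓘(ℝ, E) p).symm y)) ^ n) (hj : j < n) :
    chartDeriv j hy f = 0 := by
  induction n generalizing f j with
  | zero => omega
  | succ n ih =>
    rw [pow_succ] at hf
    induction hf using Submodule.mul_induction_on' with
    | mem_mul_mem a ha b hb =>
      have ho := isOpen_extChartAt_target (I := 𝓘(ℝ, E)) p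
      have hd : ∀ f : Fun E M, ContDiffOn ℝ ∞ (f ∘ (extChartAt 𝓘(ℝ, E) p).symm)
          (extChartAt 𝓘(ℝ, E) p).target := fun f z hz => (contDiffAt_chart f hz).contDiffWithinAt
      have h := norm_iteratedFDerivWithin_mul_le (hd a) (hd b) ho.uniqueDiffOn hy (n := j)
        (by exact_mod_cast le_top)
      simp only [iteratedFDerivWithin_of_isOpen _ ho hy] at h
      refine norm_le_zero_iff.1 (h.trans (Finset.sum_nonpos fun i hi => le_of_eq ?_))
      have hi' := Finset.mem_range.1 hi
      -- Either fewer than `n` derivatives fall on `a`, or all of them do and `b` is evaluated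
      -- undifferentiated.
      rcases lt_or_ge i n with h1 | h1
      · have : iteratedFDeriv ℝ i (a ∘ (extChartAt 𝓘(ℝ, E) p).symm) y = 0 := ih ha h1
        rw [this, norm_zero, mul_zero, zero_mul]
      · rw [show j - i = 0 by omega, norm_iteratedFDeriv_zero,
          show (b ∘ (extChartAt 𝓘(ℝ, E) p).symm) y = 0 from hb, norm_zero, mul_zero]
    | add f _ g _ hf hg => rw [map_add, hf, hg, add_zero]

/-- Taylor coefficients may be computed with any representative, not only the one chosen in the
definition; their linearity in the jet follows. -/
lemma jetCoeff_eq (hy : y ∈ (extChartAt 𝓘(ℝ, E) p).target)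
    {s : Jet E ((extChartAt 𝓘(ℝ, E) p).symm y)} {f : Fun E M}
    (h : AdicCompletion.evalₐ ((jetFamily E M).ideal _) (j + 1) s = Ideal.Quotient.mk _ f) :
    jetCoeff p j ((extChartAt 𝓘(ℝ, E) p).symm y) s = chartDeriv j hy f := by
  have h1 := Function.surjInv_eq (Ideal.Quotient.mk_surjective
    (I := (jetFamily E M).ideal ((extChartAt 𝓘(ℝ, E) p).symm y) ^ (j + 1)))
      (AdicCompletion.evalₐ _ (j + 1) s)
  have h2 := chartDeriv_eq_zero hy (Ideal.Quotient.eq.1 (h1.trans h)) j.lt_succ_self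
  rw [map_sub, sub_eq_zero] at h2
  rw [← h2, jetCoeff, (extChartAt 𝓘(ℝ, E) p).right_inv hy]
  rfl

lemma evalₐ_combination {A : AugFamily M} {x : M} (k : ℕ) (a b : ℝ) {c d : A.Completed x}
    {g h : A.Alg x} (hc : AdicCompletion.evalₐ (A.ideal x) k c = Ideal.Quotient.mk _ g)
    (hd : AdicCompletion.evalₐ (A.ideal x) k d = Ideal.Quotient.mk _ h) :
    AdicCompletion.evalₐ (A.ideal x) k (a • c + b • d) = Ideal.Quotient.mk _ (a • g + b • h) := by
  rw [map_add, evalₐ_smul, evalₐ_smul, hc, hd]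
  rfl

lemma jetCoeff_combination (hy : y ∈ (extChartAt 𝓘(ℝ, E) p).target) (a b : ℝ)
    (s t : Jet E ((extChartAt 𝓘(ℝ, E) p).symm y)) :
    jetCoeff p j ((extChartAt 𝓘(ℝ, E) p).symm y) (a • s + b • t) =
      a • jetCoeff p j ((extChartAt 𝓘(ℝ, E) p).symm y) s +
      b • jetCoeff p j ((extChartAt 𝓘(ℝ, E) p).symm y) t := by
  obtain ⟨f, hf⟩ := Ideal.Quotient.mk_surjective
    (AdicCompletion.evalₐ ((jetFamily E M).ideal _) (j + 1) s)
  obtain ⟨g, hg⟩ := Ideal.Quotient.mk_surjective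
    (AdicCompletion.evalₐ ((jetFamily E M).ideal _) (j + 1) t)
  rw [jetCoeff_eq hy hf.symm, jetCoeff_eq hy hg.symm, ← map_smul, ← map_smul, ← map_add]
  exact jetCoeff_eq hy (evalₐ_combination _ _ _ hf.symm hg.symm)

lemma contDiffAt_slice {t : ∀ x : M, FormFibre E x ⊗[ℝ] Fun E M}
    (ht : t ∈ polySections E (jetFamily E M)) (hy : y ∈ (extChartAt 𝓘(ℝ, E) p).target) :
    ContDiffAt ℝ ∞ (fun z => iteratedFDeriv ℝ j
      ((slice ExteriorAlgebra.algebraMapInv.toLinearMap (t ((extChartAt 𝓘(ℝ, E) p).symm z)) :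
        Fun E M) ∘ (extChartAt 𝓘(ℝ, E) p).symm) z) y := by
  have hn := (isOpen_extChartAt_target (I := 𝓘(ℝ, E)) p).mem_nhds hy
  refine jet_polySections_induction (P := fun t => ContDiffAt ℝ ∞ (fun z => iteratedFDeriv ℝ j
      ((slice ExteriorAlgebra.algebraMapInv.toLinearMap (t ((extChartAt 𝓘(ℝ, E) p).symm z)) :
        Fun E M) ∘ (extChartAt 𝓘(ℝ, E) p).symm) z) y) (fun a l f => ?_) (fun s t hs ht => ?_) ht
  · have h1 : ContDiffAt ℝ ∞ (fun z => (if l = [] then (a ∘ (extChartAt 𝓘(ℝ, E) p).symm) z else 0) •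
        iteratedFDeriv ℝ j (f ∘ (extChartAt 𝓘(ℝ, E) p).symm) z) y := by
      have h0 : ContDiffAt ℝ ∞
          (fun z => if l = [] then (a ∘ (extChartAt 𝓘(ℝ, E) p).symm) z else 0) y := by
        split_ifs
        · exact contDiffAt_chart a hy
        · exact contDiffAt_const
      exact h0.smul (contDiffAt_iteratedFDeriv_chart f hy)
    refine h1.congr_of_eventuallyEq ?_
    filter_upwards [hn] with z hz
    change chartDeriv j hz (slice _ ((a _ • wedge l _) ⊗ₜ f)) = _ • chartDeriv j hz f
    rw [slice_tmul, map_smul, AlgHom.toLinearMap_apply]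
    congr 1
    rcases l with - | ⟨b, l⟩
    · rw [wedge_nil, map_smul, map_one, if_pos rfl, smul_eq_mul, mul_one]
      rfl
    · rw [if_neg (by simp)]
      exact algebraMapInv_of_mem (q := l.length) (Submodule.smul_mem _ _ (wedge_mem (b :: l) _))
  · refine (hs.add ht).congr_of_eventuallyEq ?_
    filter_upwards [hn] with z hz
    change chartDeriv j hz (slice _ (s _ + t _)) = chartDeriv j hz _ + chartDeriv j hz _
    rw [map_add, map_add]

variable [T2Space M]

/-- The coefficient of order `j` depends only on jets modulo `𝔪^(j+1)`. There `σ l` agrees with a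
polynomial family, whose coefficients are smooth functions times derivatives of fixed functions.
This smoothness is needed for `iteratedFDeriv` to be additive. -/
lemma contDiffAt_jetCoeff (σ : JetSplitting E M) (l : OneForms E M)
    (hy : y ∈ (extChartAt 𝓘(ℝ, E) p).target) :
    ContDiffAt ℝ ∞ (fun z => jetCoeff p j ((extChartAt 𝓘(ℝ, E) p).symm z)
      (σ.toFun _ (l.1 ((extChartAt 𝓘(ℝ, E) p).symm z)))) y := by
  obtain ⟨t, ht, h⟩ := mem_coeff_iff.1 (σ.smooth l) (j + 1)
    ⟨(extChartAt 𝓘(ℝ, E) p).symm y, trivial⟩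
  refine (contDiffAt_slice (j := j) ht hy).congr_of_eventuallyEq ?_
  have hc := ((contMDiffOn_extChartAt_symm (I := 𝓘(ℝ, E)) (n := ∞) p).continuousOn.continuousAt
    ((isOpen_extChartAt_target p).mem_nhds hy)).eventually (eventually_of_subtype (P := fun x =>
      CoeffFibre.tmul 1 (σ.toFun x (l.1 x)) - emb E (jetFamily E M) x (t x) ∈ fil (j + 1) x) h)
  filter_upwards [(isOpen_extChartAt_target p).mem_nhds hy, hc] with z hz hzt
  refine jetCoeff_eq hz ?_
  have h1 := mem_fil_iff.1 hzt ExteriorAlgebra.algebraMapInv.toLinearMap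
  have h2 : ∀ {x : M} (u : FormFibre E x ⊗[ℝ] Fun E M),
      comp ExteriorAlgebra.algebraMapInv.toLinearMap (emb E (jetFamily E M) x u) =
        AdicCompletion.of _ _ (slice ExteriorAlgebra.algebraMapInv.toLinearMap u) := fun {x} u =>
    slice_lTensor _ (IsScalarTower.toAlgHom ℝ (Fun E M) (Jet E x)).toLinearMap u
  rw [map_sub, map_sub, comp_tmul, h2, AlgHom.toLinearMap_apply, map_one, one_smul,
    AdicCompletion.evalₐ_of, sub_eq_zero] at h1
  exact h1

lemma one_tmul_combination {A : AugFamily M} {x : M} (a b : ℝ) (c d : A.Completed x) :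
    (CoeffFibre.tmul 1 (a • c + b • d) : CoeffFibre E A x) =
      a • CoeffFibre.tmul 1 c + b • CoeffFibre.tmul 1 d := by
  let T : A.Completed x →ₗ[ℝ] FormFibre E x ⊗[ℝ] A.Completed x := TensorProduct.mk ℝ _ _ 1
  have h : T (a • c + b • d) = a • T c + b • T d := by rw [map_add, map_smul, map_smul]
  exact h

/-- Joint continuity of the straight-line homotopy in time and starting point, for one of the
seminorms of the weak topology. -/
lemma tendstoUniformlyOn_combination {X Y F : Type*} [TopologicalSpace X] [TopologicalSpace Y]
    [NormedAddCommGroup F] [NormedSpace ℝ F] {A : X → Y → F} {B : Y → F} {x₀ : X} {K : Set Y}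
    (hK : IsCompact K) (hA : TendstoUniformlyOn A (A x₀) (𝓝 x₀) K) (hA₀ : ContinuousOn (A x₀) K)
    (hB : ContinuousOn B K) (t₀ : unitInterval) :
    TendstoUniformlyOn (fun (q : unitInterval × X) y => (1 - (q.1 : ℝ)) • A q.2 y + (q.1 : ℝ) • B y)
      (fun y => (1 - (t₀ : ℝ)) • A x₀ y + (t₀ : ℝ) • B y) (𝓝 (t₀, x₀)) K := by
  -- The change in time is multiplied by `B - A x₀`, which is bounded on the compact set; the change
  -- in the starting point has a factor of at most `1`.
  obtain ⟨C, hC⟩ := hK.exists_bound_of_continuousOn (hB.sub hA₀)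
  rw [Metric.tendstoUniformlyOn_iff]
  intro ε hε
  have h1 : ∀ᶠ q : unitInterval × X in 𝓝 (t₀, x₀), ∀ y ∈ K, dist (A x₀ y) (A q.2 y) < ε / 2 :=
    (continuous_snd.tendsto (t₀, x₀)).eventually
      (Metric.tendstoUniformlyOn_iff.1 hA _ (half_pos hε))
  have h2 : ∀ᶠ q : unitInterval × X in 𝓝 (t₀, x₀), |(t₀ : ℝ) - q.1| * C < ε / 2 := by
    have hc : Continuous fun q : unitInterval × X => |(t₀ : ℝ) - q.1| * C := by fun_prop
    refine (hc.tendsto (t₀, x₀)).eventually (gt_mem_nhds ?_)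
    simpa using half_pos hε
  filter_upwards [h1, h2] with ⟨t, x⟩ hx ht y hy
  have h3 : (1 - (t₀ : ℝ)) • A x₀ y + (t₀ : ℝ) • B y - ((1 - (t : ℝ)) • A x y + (t : ℝ) • B y) =
      (1 - (t : ℝ)) • (A x₀ y - A x y) + ((t₀ : ℝ) - t) • (B y - A x₀ y) := by
    module
  rw [dist_eq_norm, h3]
  have h4 : ‖(1 - (t : ℝ)) • (A x₀ y - A x y)‖ < ε / 2 := by
    rw [norm_smul, Real.norm_of_nonneg (by linarith [t.2.2]), ← dist_eq_norm]
    exact (mul_le_of_le_one_left dist_nonneg (by linarith [t.2.1])).trans_lt (hx y hy)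
  have h5 : ‖((t₀ : ℝ) - t) • (B y - A x₀ y)‖ < ε / 2 := by
    rw [norm_smul, Real.norm_eq_abs]
    exact (mul_le_mul_of_nonneg_left (hC y hy) (abs_nonneg _)).trans_lt ht
  exact (norm_add_le _ _).trans_lt (by linarith)

lemma iteratedFDeriv_combination {F : Type*} [NormedAddCommGroup F] [NormedSpace ℝ F]
    {f g h : E → F} {m : ℕ} {a b : ℝ} (hf : ContDiffAt ℝ ∞ f y) (hg : ContDiffAt ℝ ∞ g y)
    (hh : ∀ᶠ z in 𝓝 y, h z = a • f z + b • g z) :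
    iteratedFDeriv ℝ m h y = a • iteratedFDeriv ℝ m f y + b • iteratedFDeriv ℝ m g y := by
  have hm : ((m : ℕ) : WithTop ℕ∞) ≤ ∞ := by exact_mod_cast le_top
  have h1 : h =ᶠ[𝓝 y] (a • f) + (b • g) := hh
  rw [(h1.iteratedFDeriv ℝ m).eq_of_nhds]
  refine (iteratedFDeriv_add_apply ((hf.of_le hm).const_smul a)
    ((hg.of_le hm).const_smul b)).trans ?_
  exact congrArg₂ (· + ·) (iteratedFDeriv_const_smul_apply (hf.of_le hm))
    (iteratedFDeriv_const_smul_apply (hg.of_le hm))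

namespace JetSplitting

/-- Affine combinations of splittings. -/
def mix (t : ℝ) (σ τ : JetSplitting E M) : JetSplitting E M where
  toFun x := (1 - t) • σ.toFun x + t • τ.toFun x
  smooth l := by
    refine mem_of_eq_of_mem (funext fun x => ?_) (add_mem
      (Subalgebra.smul_mem _ (σ.smooth l) (1 - t)) (Subalgebra.smul_mem _ (τ.smooth l) t))
    exact one_tmul_combination _ _ _ _
  split x ξ f hf := by
    obtain ⟨g, hg⟩ := Ideal.Quotient.mk_surjective
      (AdicCompletion.evalₐ ((jetFamily E M).ideal _) 2 (σ.toFun x ξ))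
    obtain ⟨h, hh⟩ := Ideal.Quotient.mk_surjective
      (AdicCompletion.evalₐ ((jetFamily E M).ideal _) 2 (τ.toFun x ξ))
    obtain ⟨hg0, hg1⟩ := σ.split x ξ g hg.symm
    obtain ⟨hh0, hh1⟩ := τ.split x ξ h hh.symm
    refine split_of_repr (g := (1 - t) • g + t • h) ?_ ?_
      (evalₐ_combination 2 _ _ hg.symm hh.symm) f hf
    · change (1 - t) * g x + t * h x = 0
      rw [hg0, hh0, mul_zero, mul_zero, add_zero]
    · rw [diffAt_add, diffAt_smul, diffAt_smul, hg1, hh1, ← add_smul, sub_add_cancel, one_smul]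

lemma ext_toFun {σ τ : JetSplitting E M} (h : σ.toFun = τ.toFun) : σ = τ := by
  obtain ⟨f⟩ := σ
  subst h
  rfl

/-- The derivatives of order `m` of the Taylor coefficients of order `j` of `σ l`. -/
def taylor (σ : JetSplitting E M) (p : M) (l : OneForms E M) (j m : ℕ) :
    E → E [×m]→L[ℝ] (E [×j]→L[ℝ] ℝ) :=
  iteratedFDeriv ℝ m fun y => jetCoeff p j ((extChartAt 𝓘(ℝ, E) p).symm y)
    (σ.toFun _ (l.1 ((extChartAt 𝓘(ℝ, E) p).symm y)))

lemma taylor_mix (t : ℝ) (σ τ : JetSplitting E M) (l : OneForms E M) (m : ℕ)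
    (hy : y ∈ (extChartAt 𝓘(ℝ, E) p).target) :
    (mix t σ τ).taylor p l j m y = (1 - t) • σ.taylor p l j m y + t • τ.taylor p l j m y := by
  have h1 := fun ρ : JetSplitting E M => contDiffAt_jetCoeff (j := j) ρ l hy
  refine iteratedFDeriv_combination (h1 σ) (h1 τ) ?_
  filter_upwards [(isOpen_extChartAt_target p).mem_nhds hy] with z hz
  exact jetCoeff_combination hz _ _ _ _

lemma continuousOn_taylor (σ : JetSplitting E M) (l : OneForms E M) (m : ℕ) :
    ContinuousOn (σ.taylor p l j m) (extChartAt 𝓘(ℝ, E) p).target := fun y hy =>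
  ((contDiffAt_jetCoeff (j := j) σ l hy).iteratedFDeriv_right (m := 0) (i := m)
    (by rw [zero_add]; exact_mod_cast le_top)).continuousAt.continuousWithinAt

lemma tendstoUniformlyOn_taylor (σ : JetSplitting E M) (l : OneForms E M) (m : ℕ) {K : Set E}
    (hK : IsCompact K) (hKp : K ⊆ (extChartAt 𝓘(ℝ, E) p).target) :
    TendstoUniformlyOn (fun τ : JetSplitting E M => τ.taylor p l j m) (σ.taylor p l j m) (𝓝 σ) K := by
  have h := (continuous_apply (⟨p, l, ⟨j, m⟩⟩ : M × OneForms E M × (Σ _ : ℕ, ℕ))).comp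
    (continuous_induced_dom (f := fun (σ : JetSplitting E M)
      (i : M × OneForms E M × (Σ _ : ℕ, ℕ)) =>
      (UniformOnFun.ofFun {K | IsCompact K ∧ K ⊆ (extChartAt 𝓘(ℝ, E) i.1).target}
        (σ.taylor i.1 i.2.1 i.2.2.1 i.2.2.2))))
  exact UniformOnFun.tendsto_iff_tendstoUniformlyOn.1 (h.tendsto σ) K ⟨hK, hKp⟩

lemma continuous_of_taylor {X : Type*} [TopologicalSpace X] {f : X → JetSplitting E M}
    (h : ∀ (x : X) (p : M) (l : OneForms E M) (j m : ℕ) (K : Set E), IsCompact K →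
      K ⊆ (extChartAt 𝓘(ℝ, E) p).target →
      TendstoUniformlyOn (fun z => (f z).taylor p l j m) ((f x).taylor p l j m) (𝓝 x) K) :
    Continuous f :=
  continuous_induced_rng.2 (continuous_pi fun i => continuous_iff_continuousAt.2 fun x =>
    UniformOnFun.tendsto_iff_tendstoUniformlyOn.2 fun K hK => h x i.1 i.2.1 i.2.2.1 i.2.2.2 K hK.1 hK.2)

lemma continuous_mix (τ : JetSplitting E M) :
    Continuous fun q : unitInterval × JetSplitting E M => mix q.1 q.2 τ := by
  refine continuous_of_taylor fun q p l j m K hK hKp => ?_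
  have h := tendstoUniformlyOn_combination (F := E [×m]→L[ℝ] (E [×j]→L[ℝ] ℝ))
    (A := fun σ : JetSplitting E M => σ.taylor p l j m) (B := τ.taylor p l j m) hK
    (tendstoUniformlyOn_taylor (j := j) q.2 l m hK hKp)
    ((q.2.continuousOn_taylor l m).mono hKp) ((τ.continuousOn_taylor l m).mono hKp) q.1
  have h1 := h.congr (Filter.Eventually.of_forall fun r y hy =>
    (taylor_mix (j := j) r.1 r.2 τ l m (hKp hy)).symm)
  exact h1.congr_right fun y hy => (taylor_mix (j := j) q.1 q.2 τ l m (hKp hy)).symm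

end JetSplitting

/-- The straight-line homotopy `mix` contracts the affine space of splittings to any one of its
points. -/
instance [FiniteDimensional ℝ E] [SigmaCompactSpace M] :
    ContractibleSpace (JetSplitting E M) := by
  obtain ⟨τ⟩ := (inferInstance : Nonempty (JetSplitting E M))
  refine (contractible_iff_id_nullhomotopic _).2 ⟨τ, ⟨
    { toFun := fun q => JetSplitting.mix q.1 q.2 τ
      continuous_toFun := JetSplitting.continuous_mix τ
      map_zero_left := fun σ => JetSplitting.ext_toFun (funext fun x => ?_)
      map_one_left := fun σ => JetSplitting.ext_toFun (funext fun x => ?_) }⟩⟩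
  · change (1 - (0 : ℝ)) • σ.toFun x + (0 : ℝ) • τ.toFun x = σ.toFun x
    rw [sub_zero, one_smul, zero_smul, add_zero]
  · change (1 - (1 : ℝ)) • σ.toFun x + (1 : ℝ) • τ.toFun x = τ.toFun x
    rw [sub_self, one_smul, zero_smul, zero_add]

end Contractible

end FormalGeometry

end

theorem mainTheorem10 {E : Type*} [NormedAddCommGroup E] [NormedSpace ℝ E] [FiniteDimensional ℝ E]
    {M : Type*} [TopologicalSpace M] [ChartedSpace E M] [IsManifold 𝓘(ℝ, E) ∞ M]
    [T2Space M] [SigmaCompactSpace M] :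
    (∃ N : ℕ, ∀ (U : Opens M) (w : Fin N → FormalGeometry.Forms E U),
      (∀ i, ∃ q : ℕ, 0 < q ∧ w i ∈ FormalGeometry.Forms.deg E U q) → (List.ofFn w).prod = 0) ∧
    ContractibleSpace (FormalGeometry.JetSplitting E M) ∧
    ∀ σ : FormalGeometry.JetSplitting E M,
      ∃ g : FormalGeometry.CurvedLInfinity E E (FormalGeometry.Tangent E M),
        Nonempty (FormalGeometry.CEIso g σ) ∧ g.AugIsQuasiIso ∧
        ∀ g' : FormalGeometry.CurvedLInfinity E E (FormalGeometry.Tangent E M),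
          Nonempty (FormalGeometry.CEIso g' σ) → g' = g :=
  ⟨⟨_, fun _ => FormalGeometry.forms_prod_eq_zero⟩, inferInstance, fun σ =>
    ⟨σ.curvedLInfinity, ⟨σ.ceIso⟩, FormalGeometry.augIsQuasiIso σ, fun _ ⟨φ⟩ =>
      φ.eq_curvedLInfinity⟩⟩
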